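/- Work on $\mathbb T\times\mathbb R$ with $\mathbb T=\mathbb R/2\pi\mathbb Z$, and write $\|\cdot\|$ for the norm of $L^2=L^2(\mathbb T\times\mathbb R)$ (complex-valued functions, in particular real-valued ones). Let $\mathbb P_0 f(y)=\frac1{2\pi}\int_{\mathbb T}f(x,y)\,dx$ and $\mathbb P_{\neq}f=f-\mathbb P_0f$. For $f\in L^2$ with $\mathbb P_0f=0$ let $\Delta^{-1}f$ be the unique $\psi\in L^2$ with $\mathbb P_0\psi=0$ and $\Delta\psi=f$ in the sense of distributions. For $\nu>0$ let $$\mathcal L_\nu=-y^2\partial_x+2\partial_x\Delta^{-1}+\nu\Delta ,$$ where $\partial_x\Delta^{-1}$ is understood as $\partial_x\Delta^{-1}\mathbb P_{\neq}$, taken in the sense of distributions with its maximal domain $\{f\in L^2:\mathcal L_\nu f\in L^2\}$ (this is the linearization of the 2D Navier–Stokes vorticity equation around the Poiseuille flow $(y^2,0)$ with viscosity $\nu$). This operator generates a strongly continuous semigroup $(e^{\mathcal L_\nu t})_{t\ge0}$ on $L^2$. There is a constant $C>0$, independent of $\nu$, $g$ and $T$, such that for every $\nu>0$, every $g\in L^2$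 with $\mathbb P_0g=0$ and every $T>0$, $$\int_0^T\|\nabla e^{\mathcal L_\nu t}g\|^2\,dt\le \tfrac12\,\nu^{-1}\|g\|^2,$$ $$\int_0^T\|\partial_x e^{\mathcal L_\nu t}g\|\,dt\le C\,\nu^{-2/3}\|g\|,$$ $$\int_0^T\|\nabla\Delta^{-1}e^{\mathcal L_\nu t}\mathbb P_{\neq}g\|_{L^\infty}^2\,dt\le C\,(1+|\log\nu|)\,\nu^{-1/3}\|\mathbb P_{\neq}g\|^2 .$$ -/

import Mathlib

open MeasureTheory Set Filter Topology
open scoped ENNReal ContDiff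

noncomputable section

namespace Poiseuille

instance fact_two_pi_pos : Fact (0 < 2 * Real.pi) := ⟨Real.two_pi_pos⟩

/-- The cylinder `𝕋 × ℝ`, with `𝕋 = ℝ / 2πℤ`; its `volume` is the product Lebesgue measure
(so that `𝕋` has total mass `2π`). -/
abbrev Cyl : Type := AddCircle (2 * Real.pi) × ℝ

/-- The Hilbert space `L²(𝕋 × ℝ)` of complex-valued functions. -/
abbrev L2 : Type := Lp ℂ 2 (volume : Measure Cyl)

/-- The `x`-average `y ↦ (2π)⁻¹ ∫_𝕋 f(x, y) dx`, viewed as a function on the cylinder. -/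
def xMean (f : Cyl → ℂ) (p : Cyl) : ℂ :=
  (2 * Real.pi : ℂ)⁻¹ * ∫ x : AddCircle (2 * Real.pi), f (x, p.2)

theorem memLp_xMean (f : L2) : MemLp (xMean f) 2 (volume : Measure Cyl) := by
  have hf : MemLp f 2 (volume : Measure Cyl) := Lp.memLp f
  have hm : AEStronglyMeasurable (fun y : ℝ => ∫ x : AddCircle (2 * Real.pi), f (x, y)) volume :=
    hf.1.prod_swap.integral_prod_right'
  have hm2 : AEStronglyMeasurable (xMean f) (volume : Measure Cyl) :=
    (hm.comp_snd).const_mul _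
  refine ⟨hm2, ?_⟩
  have hfin : ∫⁻ p : Cyl, ‖f p‖ₑ ^ 2 < ⊤ := by
    have h := hf.2
    rw [eLpNorm_lt_top_iff_lintegral_rpow_enorm_lt_top (by norm_num) (by norm_num)] at h
    simpa using h
  rw [eLpNorm_lt_top_iff_lintegral_rpow_enorm_lt_top (by norm_num) (by norm_num)]
  have hsec : ∀ᵐ y : ℝ, AEStronglyMeasurable (fun x : AddCircle (2 * Real.pi) => f (x, y)) volume :=
    hf.1.prod_swap.prodMk_left
  set V : ℝ≥0∞ := volume (Set.univ : Set (AddCircle (2 * Real.pi)))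
  have hV : V ≠ ⊤ := measure_ne_top _ _
  set c : ℝ≥0∞ := ‖(2 * Real.pi : ℂ)⁻¹‖ₑ
  have key : ∀ᵐ y : ℝ, ‖∫ x : AddCircle (2 * Real.pi), f (x, y)‖ₑ ^ 2
      ≤ V * ∫⁻ x : AddCircle (2 * Real.pi), ‖f (x, y)‖ₑ ^ 2 := by
    filter_upwards [hsec] with y hy
    have h1 : ‖∫ x : AddCircle (2 * Real.pi), f (x, y)‖ₑ
        ≤ ∫⁻ x : AddCircle (2 * Real.pi), ‖f (x, y)‖ₑ := enorm_integral_le_lintegral_enorm _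
    have h2 := ENNReal.lintegral_mul_le_Lp_mul_Lq
      (volume : Measure (AddCircle (2 * Real.pi))) Real.HolderConjugate.two_two
      hy.enorm (aemeasurable_const (b := (1 : ℝ≥0∞)))
    simp only [Pi.mul_apply, mul_one, ENNReal.one_rpow, lintegral_const, one_mul] at h2
    calc ‖∫ x : AddCircle (2 * Real.pi), f (x, y)‖ₑ ^ 2
        ≤ ((∫⁻ x : AddCircle (2 * Real.pi), ‖f (x, y)‖ₑ ^ (2 : ℝ)) ^ (1 / 2 : ℝ)
            * V ^ (1 / 2 : ℝ)) ^ 2 := by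
          gcongr
          exact h1.trans h2
      _ = V * ∫⁻ x : AddCircle (2 * Real.pi), ‖f (x, y)‖ₑ ^ 2 := by
          rw [mul_pow, ← ENNReal.rpow_natCast, ← ENNReal.rpow_natCast, ← ENNReal.rpow_mul,
            ← ENNReal.rpow_mul]
          norm_num [mul_comm]
  have hpt : ∀ᵐ p : Cyl, ‖xMean f p‖ₑ ^ 2
      ≤ c ^ 2 * (V * ∫⁻ x : AddCircle (2 * Real.pi), ‖f (x, p.2)‖ₑ ^ 2) := by
    have := Measure.quasiMeasurePreserving_snd.ae
      (μa := (volume : Measure Cyl)) (μb := (volume : Measure ℝ)) key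
    filter_upwards [this] with p hp
    rw [xMean, enorm_mul, mul_pow]
    gcongr
  have hmeas : AEMeasurable (fun p : Cyl => ‖f p‖ₑ ^ 2) volume := hf.1.enorm.pow_const 2
  calc ∫⁻ p : Cyl, ‖xMean f p‖ₑ ^ (2 : ℝ≥0∞).toReal
      = ∫⁻ p : Cyl, ‖xMean f p‖ₑ ^ 2 := by simp
    _ ≤ ∫⁻ p : Cyl, c ^ 2 * (V * ∫⁻ x : AddCircle (2 * Real.pi), ‖f (x, p.2)‖ₑ ^ 2) :=
        lintegral_mono_ae hpt
    _ ≤ ∫⁻ _ : AddCircle (2 * Real.pi), ∫⁻ y : ℝ,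
          c ^ 2 * (V * ∫⁻ x : AddCircle (2 * Real.pi), ‖f (x, y)‖ₑ ^ 2) :=
        lintegral_prod_le _
    _ = c ^ 2 * (V * ∫⁻ p : Cyl, ‖f p‖ₑ ^ 2) * V := by
        have hs : ∫⁻ p : Cyl, ‖f p‖ₑ ^ 2
            = ∫⁻ y : ℝ, ∫⁻ x : AddCircle (2 * Real.pi), ‖f (x, y)‖ₑ ^ 2 :=
          lintegral_prod_symm _ hmeas
        rw [lintegral_const, lintegral_const_mul' _ _ (by simp [c]), lintegral_const_mul' _ _ hV, hs]
    _ < ⊤ := by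
        have : c ≠ ⊤ := by simp [c]
        exact ENNReal.mul_lt_top (ENNReal.mul_lt_top (by simp [this, lt_top_iff_ne_top])
          (ENNReal.mul_lt_top hV.lt_top hfin)) hV.lt_top

/-- The projection `ℙ₀` onto the zero `x`-Fourier mode. -/
def P0 (f : L2) : L2 := (memLp_xMean f).toLp (xMean f)

/-- The projection `ℙ_{≠} = 1 - ℙ₀` onto the nonzero `x`-Fourier modes. -/
def Pneq (f : L2) : L2 := f - P0 f

/-- Test functions: smooth (as functions of `(x, y) ∈ ℝ²`, `2π`-periodic in `x`) and compactly
supported on the cylinder. -/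
structure IsTest (φ : Cyl → ℂ) : Prop where
  smooth : ContDiff ℝ ∞ (fun p : ℝ × ℝ => φ ((p.1 : AddCircle (2 * Real.pi)), p.2))
  compact : HasCompactSupport φ

/-- Classical derivative `∂ₓ`. -/
def dx (φ : Cyl → ℂ) (p : Cyl) : ℂ :=
  deriv (fun s : ℝ => φ (p.1 + (s : AddCircle (2 * Real.pi)), p.2)) 0

/-- Classical derivative `∂_y`. -/
def dy (φ : Cyl → ℂ) (p : Cyl) : ℂ := deriv (fun s : ℝ => φ (p.1, s)) p.2

/-- Classical Laplacian `Δ = ∂ₓ² + ∂_y²`. -/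
def lap (φ : Cyl → ℂ) (p : Cyl) : ℂ := dx (dx φ) p + dy (dy φ) p

/-- `a = ∂ₓ f` in the sense of distributions. -/
def HasWeakDx (f a : L2) : Prop :=
  ∀ φ : Cyl → ℂ, IsTest φ → ∫ p, f p * dx φ p = -∫ p, a p * φ p

/-- `b = ∂_y f` in the sense of distributions. -/
def HasWeakDy (f b : L2) : Prop :=
  ∀ φ : Cyl → ℂ, IsTest φ → ∫ p, f p * dy φ p = -∫ p, b p * φ p

/-- `ψ = Δ⁻¹ f`: the (unique) `ψ ∈ L²` with zero `x`-average that satisfies `Δ ψ = f` in the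
sense of distributions. It exists for every `f ∈ L²` with `ℙ₀ f = 0`. -/
structure IsInvLaplacian (f ψ : L2) : Prop where
  mean : P0 ψ = 0
  eq : ∀ φ : Cyl → ℂ, IsTest φ → ∫ p, ψ p * lap φ p = ∫ p, f p * φ p

/-- `f` lies in the (maximal) `L²`-domain of `𝓛_ν = -y² ∂ₓ + 2 ∂ₓ Δ⁻¹ + ν Δ` and `𝓛_ν f = h`:
the identity holds in the sense of distributions. The term `∂ₓ Δ⁻¹` vanishes on the zero
`x`-mode, so it is `∂ₓ ψ` with `ψ = Δ⁻¹ ℙ_{≠} f`. -/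
def IsLin (ν : ℝ) (f h : L2) : Prop :=
  ∃ ψ : L2, IsInvLaplacian (Pneq f) ψ ∧
    ∀ φ : Cyl → ℂ, IsTest φ →
      ∫ p, h p * φ p =
        (∫ p, f p * ((p.2 : ℂ) ^ 2 * dx φ p)) - 2 * (∫ p, ψ p * dx φ p)
          + (ν : ℂ) * ∫ p, f p * lap φ p

/-- `S t = e^{𝓛_ν t}` for `t ≥ 0`: `S` is a strongly continuous semigroup on `L²(𝕋 × ℝ)` whose
infinitesimal generator is `𝓛_ν`. Values of `S` at negative times play no role. -/
structure IsSemigroup (ν : ℝ) (S : ℝ → L2 →L[ℂ] L2) : Prop where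
  zero : S 0 = ContinuousLinearMap.id ℂ L2
  add : ∀ s t : ℝ, 0 ≤ s → 0 ≤ t → S (s + t) = (S s).comp (S t)
  cont : ∀ f : L2, ContinuousOn (fun t : ℝ => S t f) (Ici 0)
  generator : ∀ f h : L2,
    Tendsto (fun t : ℝ => t⁻¹ • (S t f - f)) (𝓝[>] 0) (𝓝 h) ↔ IsLin ν f h

/-- `‖∇ f‖²_{L²}`, equal to `∞` if the distributional gradient of `f` is not in `L²`.
(Distributional derivatives are unique, so the infimum is over at most one element; the same
applies to the two definitions below.) -/
def gradNormSq (f : L2) : ℝ≥0∞ :=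
  ⨅ (a : L2) (b : L2) (_ : HasWeakDx f a) (_ : HasWeakDy f b), ‖a‖ₑ ^ 2 + ‖b‖ₑ ^ 2

/-- `‖∂ₓ f‖_{L²}`, equal to `∞` if the distributional derivative `∂ₓ f` is not in `L²`. -/
def dxNorm (f : L2) : ℝ≥0∞ := ⨅ (a : L2) (_ : HasWeakDx f a), ‖a‖ₑ

/-- `‖∇ Δ⁻¹ f‖_{L^∞}`, the essential supremum of the Euclidean length of the gradient of
`ψ = Δ⁻¹ f`; equal to `∞` if `ψ` does not exist. -/
def gradInvLapSup (f : L2) : ℝ≥0∞ :=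
  ⨅ (ψ : L2) (a : L2) (b : L2) (_ : IsInvLaplacian f ψ) (_ : HasWeakDx ψ a) (_ : HasWeakDy ψ b),
    eLpNorm (fun p : Cyl => Real.sqrt (‖a p‖ ^ 2 + ‖b p‖ ^ 2)) ∞ volume

end Poiseuille

end

/-! The operator respects Fourier modes in `x`. On `e^{ikx} u(y)` it acts as `-ik (y² + 2G) + ν
(∂_y² - k²)` with `G = (k² - ∂_y²)⁻¹`. Every estimate is proved for one mode with explicit
dependence on `k`, and the modes are then reassembled by orthogonality.

Generation. Since `y²` and `G` are symmetric, only viscosity enters the real part of the quadratic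
form, so each mode operator is dissipative on Schwartz functions. Its closure has `λ - A` onto: the
range is closed, and anything orthogonal to it is an `L²` weak solution of the adjoint resolvent
equation, which vanishes by a cutoff argument (`eq_zero_of_weak`). The same uniqueness shows that
this closure is the maximal distributional operator (`mem_modeGraph_of_weak`, `isLin_iff`). Yosida
approximation then gives the semigroup `flow` with exactly the required generator (`generator_iff`).

The first estimate is the integrated energy identity `d/dt ‖u‖² = -2ν ‖∇u‖²`, valid for data in the
domain and extended by density and Fatou.

The other two rest on hypocoercivity: along each mode with `k ≠ 0`, `‖u‖² + a ν t ‖u'‖² + b ν t² k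
Im⟨y u, u'⟩ + c ν t³ k² ⟨(y² + 2G) u, u⟩` does not increase (`hypoDeriv_nonpos`). The cross term,
the generator of dilations, produces damping of `k² ‖y u‖²` and, with a favourable sign, of `k² ‖∂_y
G u‖²`. The last term is conserved by the inviscid flow. A Hardy type inequality (`sq_norm_G_le`)
lets the damping absorb what comes from differentiating the weight `t³`, so the nonlocal part does
no harm. Hence `ν k² t³ ‖y u‖²` is bounded by the initial energy, and by the uncertainty principle
so is `ν |k| t² ‖u‖²`.

Second estimate: using the last bound on both halves of `[0, t]` gives `|k| ‖u(t)‖ ≲ (ν t²)⁻¹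
‖u(0)‖`, uniformly in `k`. For short times heat decay gives `|k| ‖u(t)‖ ≤ (ν t)^{-1/2} ‖u(0)‖`. The
two are integrated on either side of `t = ν^{-1/3}`.

Third estimate: in one dimension `∇Δ⁻¹` of a mode is bounded in the supremum norm by `|k|^{-1/2}
‖u‖` and by `‖u‖_{L¹}`. The weighted bound on `y u` controls the `L¹` norm. The squared factor is
therefore at most a constant times `|k|⁻¹ min(e^{-2νk²t}, (ν t³)^{-1/2})`. After Cauchy–Schwarz over
the modes, its time integral is summed over `k`; this is a harmonic sum cut off near `|k| =
ν^{-1/3}`, which is where the logarithm comes from (`tsum_cutoff_le`). -/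

noncomputable section

namespace Poiseuille

/-! ### Hille–Yosida theory for maximal dissipative relations on a Hilbert space. -/

section HilleYosida

open NormedSpace

variable {H : Type*} [NormedAddCommGroup H] [InnerProductSpace ℂ H]

variable [CompleteSpace H] in
theorem hasDerivAt_exp_apply (B : H →L[ℂ] H) (f : H) (t : ℝ) :
    HasDerivAt (fun s : ℝ => exp (s • B) f) (exp (t • B) (B f)) t := by
  have h := hasDerivAt_exp_smul_const (𝕂 := ℝ) B t
  have h2 := ((ContinuousLinearMap.apply ℂ H f).restrictScalars ℝ).hasFDerivAt.comp_hasDerivAt t h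
  simpa using! h2

variable [CompleteSpace H] in
theorem commute_exp_smul (B C : H →L[ℂ] H) (h : Commute B C) (t : ℝ) :
    Commute (exp (t • B)) C :=
  Commute.exp_left (𝔸 := H →L[ℂ] H) (h.smul_left t)

theorem hasDerivWithinAt_norm_sq {u : ℝ → H} {u' : H} {s : Set ℝ} {t : ℝ}
    (h : HasDerivWithinAt u u' s t) :
    HasDerivWithinAt (fun t => ‖u t‖ ^ 2) (2 * (inner ℂ u' (u t)).re) s t := by
  let _ : InnerProductSpace ℝ H := InnerProductSpace.rclikeToReal ℂ H
  have := h.norm_sq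
  convert! this using 2
  rw [real_inner_comm]
  rfl

variable [CompleteSpace H] in
theorem norm_exp_smul_apply_le (B : H →L[ℂ] H) (hB : ∀ f, (inner ℂ (B f) f).re ≤ 0) (f : H)
    {t : ℝ} (ht : 0 ≤ t) : ‖exp (t • B) f‖ ≤ ‖f‖ := by
  have hd : ∀ s : ℝ, HasDerivAt (fun s : ℝ => ‖exp (s • B) f‖ ^ 2)
      (2 * (inner ℂ (exp (s • B) (B f)) (exp (s • B) f)).re) s := fun s => by
    have := hasDerivWithinAt_norm_sq (hasDerivAt_exp_apply B f s).hasDerivWithinAt (s := univ)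
    simpa using this
  have hanti : Antitone (fun s : ℝ => ‖exp (s • B) f‖ ^ 2) := by
    apply antitone_of_hasDerivAt_nonpos hd
    intro s
    have hc : exp (s • B) (B f) = B (exp (s • B) f) :=
      congrArg (fun T : H →L[ℂ] H => T f) (commute_exp_smul B B (Commute.refl B) s).eq
    have := hB (exp (s • B) f)
    simp only [hc, Pi.zero_apply]
    linarith
  have h0 := hanti ht
  simp only [zero_smul, exp_zero, one_apply_eq_self] at h0
  exact (sq_le_sq₀ (norm_nonneg _) (norm_nonneg _)).1 h0

variable [CompleteSpace H] in
-- Duhamel interpolation: because the generators commute, the path `s ↦ exp(sB) exp((t-s)C) f` has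
-- derivative `exp(sB) exp((t-s)C) (B - C) f`, and both exponentials are contractions.
theorem norm_exp_smul_sub_le (B C : H →L[ℂ] H) (hB : ∀ f, (inner ℂ (B f) f).re ≤ 0)
    (hC : ∀ f, (inner ℂ (C f) f).re ≤ 0) (hBC : Commute B C) (f : H) {t : ℝ} (ht : 0 ≤ t) :
    ‖exp (t • B) f - exp (t • C) f‖ ≤ t * ‖B f - C f‖ := by
  have hd : ∀ s ∈ Icc (0 : ℝ) t, HasDerivWithinAt
      (fun s : ℝ => (exp (s • B) * exp ((t - s) • C)) f)
      (exp (s • B) (exp ((t - s) • C) (B f - C f))) (Icc 0 t) s := fun s _ => by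
    have h1 := hasDerivAt_exp_smul_const (𝕂 := ℝ) B s
    have h2 := (hasDerivAt_exp_smul_const (𝕂 := ℝ) C (t - s)).scomp s
      ((hasDerivAt_id s).const_sub t)
    have h3 := ((ContinuousLinearMap.apply ℂ H f).restrictScalars ℝ).hasFDerivAt.comp_hasDerivAt s
      (h1.mul h2)
    refine (h3.congr_deriv ?_).hasDerivWithinAt
    have hc := fun x => congrArg (fun T : H →L[ℂ] H => T x)
      (commute_exp_smul C B hBC.symm (t - s)).eq
    simp only [mul_apply_eq_comp] at hc
    have hc' := hc f
    rw [sub_eq_add_neg] at hc'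
    simp [← hc', sub_eq_add_neg]
  have := norm_image_sub_le_of_norm_deriv_le_segment' (C := ‖B f - C f‖) hd (fun s hs => by
    have h1 := norm_exp_smul_apply_le B hB (exp ((t - s) • C) (B f - C f)) hs.1
    have h2 := norm_exp_smul_apply_le C hC (B f - C f) (t := t - s) (by linarith [hs.2])
    exact h1.trans h2) t ⟨ht, le_rfl⟩
  simpa [mul_comm] using this

variable [CompleteSpace H] in
theorem norm_exp_smul_sub_self_le (B : H →L[ℂ] H) (hB : ∀ f, (inner ℂ (B f) f).re ≤ 0) (f : H)
    {s t : ℝ} (hs : 0 ≤ s) (hst : s ≤ t) :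
    ‖exp (t • B) f - exp (s • B) f‖ ≤ (t - s) * ‖B f‖ := by
  have := norm_image_sub_le_of_norm_deriv_le_segment' (f := fun s : ℝ => exp (s • B) f)
    (C := ‖B f‖) (a := s) (b := t) (fun r _ => (hasDerivAt_exp_apply B f r).hasDerivWithinAt)
    (fun r hr => norm_exp_smul_apply_le B hB _ (hs.trans hr.1)) t ⟨hst, le_rfl⟩
  simpa [mul_comm] using this

variable [CompleteSpace H] in
-- The remainder is measured by the oscillation of `exp(sB) B f` and not by `B² f`, because the
-- latter is not bounded uniformly over Yosida approximations when `f` is merely in the domain.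
theorem norm_exp_smul_taylor_le (B : H →L[ℂ] H) (f : H)
    {M t : ℝ} (ht : 0 ≤ t) (hM : ∀ s ∈ Ico 0 t, ‖exp (s • B) (B f) - B f‖ ≤ M) :
    ‖exp (t • B) f - f - t • B f‖ ≤ t * M := by
  have := norm_image_sub_le_of_norm_deriv_le_segment' (f := fun s : ℝ => exp (s • B) f - s • B f)
    (f' := fun s => exp (s • B) (B f) - B f) (C := M) (a := 0) (b := t)
    (fun r _ => by
      have h1 := (hasDerivAt_exp_apply B f r).sub ((hasDerivAt_id r).smul_const (B f))
      simpa using! h1.hasDerivWithinAt)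
    hM t ⟨ht, le_rfl⟩
  have e : exp (t • B) f - f - t • B f = exp (t • B) f - t • B f - f := by abel
  rw [e]
  simpa [mul_comm] using this

/-- A linear relation `A` (a set of pairs `(f, A f)`) that is dissipative, single-valued, and such
that `λ - A` is onto for every `λ > 0`. -/
structure IsMaxDissipative (A : Submodule ℂ (H × H)) : Prop where
  diss : ∀ p ∈ A, (inner ℂ p.2 p.1).re ≤ 0
  single : ∀ h, ((0 : H), h) ∈ A → h = 0
  range : ∀ lam : ℝ, 0 < lam → ∀ h : H, ∃ f : H, (f, lam • f - h) ∈ A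

variable {A : Submodule ℂ (H × H)}

/-- Pair `λ f - h` with `f` and use dissipativity together with Cauchy–Schwarz. -/
theorem resolvent_bound (hA : ∀ p ∈ A, (inner ℂ p.2 p.1).re ≤ 0) {lam : ℝ} {f h : H}
    (hf : (f, lam • f - h) ∈ A) : lam * ‖f‖ ≤ ‖h‖ := by
  have h1 := hA _ hf
  simp only [inner_sub_left, Complex.sub_re] at h1
  have h2 : (inner ℂ (lam • f) f).re = lam * ‖f‖ ^ 2 := by
    rw [← Complex.coe_smul, inner_smul_left, inner_self_eq_norm_sq_to_K]
    simp [← Complex.ofReal_pow]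
  have h3 : (inner ℂ h f).re ≤ ‖h‖ * ‖f‖ := (Complex.re_le_norm _).trans (norm_inner_le_norm _ _)
  rcases eq_or_lt_of_le (norm_nonneg f) with h0 | h0
  · rw [← h0]; simp
  · nlinarith

namespace IsMaxDissipative

theorem resolvent_unique (hA : IsMaxDissipative A) {lam : ℝ} (hl : 0 < lam) {f g h : H}
    (hf : (f, lam • f - h) ∈ A) (hg : (g, lam • g - h) ∈ A) : f = g := by
  have h1 : (f - g, lam • (f - g) - 0) ∈ A := by
    have := A.sub_mem hf hg
    simpa [smul_sub, sub_sub_sub_cancel_right] using! this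
  have := resolvent_bound hA.diss h1
  rw [norm_zero] at this
  exact sub_eq_zero.1 (norm_le_zero_iff.1 (by nlinarith [norm_nonneg (f - g)]))

theorem exists_resolvent (hA : IsMaxDissipative A) {lam : ℝ} (hl : 0 < lam) :
    ∃ R : H →L[ℂ] H, (∀ h, (R h, lam • R h - h) ∈ A) ∧ ∀ h, lam * ‖R h‖ ≤ ‖h‖ := by
  choose R hR using hA.range lam hl
  let L : H →ₗ[ℂ] H :=
    { toFun := R
      map_add' := fun x y => hA.resolvent_unique hl (hR _) (by
        have := A.add_mem (hR x) (hR y)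
        simpa [smul_add, add_sub_add_comm] using! this)
      map_smul' := fun c x => hA.resolvent_unique hl (hR _) (by
        have := A.smul_mem c (hR x)
        simpa [smul_sub, smul_comm c lam] using! this) }
  refine ⟨L.mkContinuous lam⁻¹ fun h => ?_, fun h => hR h, fun h => resolvent_bound hA.diss (hR h)⟩
  rw [inv_mul_eq_div, le_div_iff₀ hl, mul_comm]
  exact resolvent_bound hA.diss (hR h)

/-- The resolvent `(λ - A)⁻¹` (for `λ > 0`). -/
def res (hA : IsMaxDissipative A) (lam : ℝ) (hl : 0 < lam) : H →L[ℂ] H :=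
  (hA.exists_resolvent hl).choose

theorem res_mem (hA : IsMaxDissipative A) {lam : ℝ} (hl : 0 < lam) (h : H) :
    (hA.res lam hl h, lam • hA.res lam hl h - h) ∈ A :=
  (hA.exists_resolvent hl).choose_spec.1 h

theorem res_bound (hA : IsMaxDissipative A) {lam : ℝ} (hl : 0 < lam) (h : H) :
    lam * ‖hA.res lam hl h‖ ≤ ‖h‖ :=
  (hA.exists_resolvent hl).choose_spec.2 h

theorem res_eq (hA : IsMaxDissipative A) {lam : ℝ} (hl : 0 < lam) {f h : H}
    (hf : (f, lam • f - h) ∈ A) : hA.res lam hl h = f :=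
  hA.resolvent_unique hl (hA.res_mem hl h) hf

theorem res_sub (hA : IsMaxDissipative A) {lam : ℝ} (hl : 0 < lam) {f h : H}
    (hf : (f, h) ∈ A) : hA.res lam hl (lam • f - h) = f :=
  hA.res_eq hl (by simpa using hf)

/-- First resolvent identity, from applying the resolvent at `λ` to `(λ - A) R_μ h = h + (λ - μ) R_μ
h`. -/
theorem res_res (hA : IsMaxDissipative A) {lam mu : ℝ} (hl : 0 < lam) (hm : 0 < mu) (h : H) :
    hA.res lam hl h = hA.res mu hm h - (lam - mu) • hA.res lam hl (hA.res mu hm h) := by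
  have h1 := hA.res_sub hl (hA.res_mem hm h)
  have e : lam • hA.res mu hm h - (mu • hA.res mu hm h - h) = h + (lam - mu) • hA.res mu hm h := by
    rw [sub_smul]; abel
  rw [e, map_add, ContinuousLinearMap.map_smul_of_tower] at h1
  exact eq_sub_of_add_eq h1

theorem res_comm (hA : IsMaxDissipative A) {lam mu : ℝ} (hl : 0 < lam) (hm : 0 < mu) :
    Commute (hA.res lam hl) (hA.res mu hm) := by
  rcases eq_or_ne lam mu with h | h
  · subst h; exact Commute.refl _
  · refine ContinuousLinearMap.ext fun x => ?_
    have h1 := hA.res_res hl hm x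
    have h2 := hA.res_res hm hl x
    have h3 : (lam - mu) • (hA.res lam hl (hA.res mu hm x) - hA.res mu hm (hA.res lam hl x)) = 0 := by
      have e1 : (lam - mu) • hA.res lam hl (hA.res mu hm x) = hA.res mu hm x - hA.res lam hl x := by
        rw [eq_sub_iff_add_eq, ← eq_sub_iff_add_eq', ← h1]
      have e2 : (lam - mu) • hA.res mu hm (hA.res lam hl x) = hA.res mu hm x - hA.res lam hl x := by
        have h4 : (mu - lam) • hA.res mu hm (hA.res lam hl x) =
            hA.res lam hl x - hA.res mu hm x := by
          rw [eq_sub_iff_add_eq, ← eq_sub_iff_add_eq', ← h2]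
        rw [← neg_sub mu lam, neg_smul, h4, neg_sub]
      rw [smul_sub, e1, e2, sub_self]
    have := (smul_eq_zero.1 h3).resolve_left (sub_ne_zero.2 h)
    simpa using sub_eq_zero.1 this

/-- The Yosida approximation `λ (λ (λ - A)⁻¹ - 1)`. -/
def yosida (hA : IsMaxDissipative A) (lam : ℝ) (hl : 0 < lam) : H →L[ℂ] H :=
  lam • (lam • hA.res lam hl - 1)

theorem yosida_comm (hA : IsMaxDissipative A) {lam mu : ℝ} (hl : 0 < lam) (hm : 0 < mu) :
    Commute (hA.yosida lam hl) (hA.yosida mu hm) := by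
  have h := hA.res_comm hl hm
  refine Commute.smul_left (Commute.smul_right ?_ mu) lam
  refine Commute.sub_left (Commute.sub_right ?_ (Commute.one_right _)) (Commute.one_left _)
  exact (h.smul_left lam).smul_right mu

theorem yosida_diss (hA : IsMaxDissipative A) {lam : ℝ} (hl : 0 < lam) (f : H) :
    (inner ℂ (hA.yosida lam hl f) f).re ≤ 0 := by
  have h1 : (inner ℂ (lam • hA.res lam hl f) f).re ≤ ‖f‖ ^ 2 := by
    refine ((Complex.re_le_norm _).trans (norm_inner_le_norm _ _)).trans ?_
    rw [norm_smul, Real.norm_of_nonneg hl.le, sq]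
    exact mul_le_mul_of_nonneg_right (hA.res_bound hl f) (norm_nonneg _)
  have h2 : (inner ℂ f f).re = ‖f‖ ^ 2 := by
    rw [inner_self_eq_norm_sq_to_K]; simp [← Complex.ofReal_pow]
  have e : hA.yosida lam hl f = lam • (lam • hA.res lam hl f - f) := rfl
  rw [e, ← Complex.coe_smul lam (lam • hA.res lam hl f - f), inner_smul_left, Complex.conj_ofReal,
    Complex.re_ofReal_mul, inner_sub_left, Complex.sub_re, h2]
  exact mul_nonpos_of_nonneg_of_nonpos hl.le (by linarith)

theorem yosida_apply (hA : IsMaxDissipative A) {lam : ℝ} (hl : 0 < lam) {f h : H}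
    (hf : (f, h) ∈ A) : hA.yosida lam hl f = lam • hA.res lam hl h := by
  have e : hA.yosida lam hl f = lam • (lam • hA.res lam hl f - f) := rfl
  have h1 := hA.res_sub hl hf
  rw [map_sub, ContinuousLinearMap.map_smul_of_tower] at h1
  rw [e, sub_eq_iff_eq_add'.1 h1, add_sub_cancel_right]

/-- Density need not be assumed. If `w` is orthogonal to the domain and `g = (1 - A)⁻¹ w`,
dissipativity of the pair `(g, g - w)` reads `‖g‖² ≤ 0`, so `(0, -w)` lies in `A` and
single-valuedness forces `w = 0`. -/
theorem dense_domain (hA : IsMaxDissipative A) [CompleteSpace H] :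
    Dense {f : H | ∃ h, (f, h) ∈ A} := by
  let K : Submodule ℂ H := A.map (LinearMap.fst ℂ H H)
  have hK : (K : Set H) = {f : H | ∃ h, (f, h) ∈ A} := by
    ext f; simp [K]
  rw [← hK, Submodule.dense_iff_topologicalClosure_eq_top, Submodule.topologicalClosure_eq_top_iff,
    Submodule.eq_bot_iff]
  intro w hw
  have hm : (hA.res 1 one_pos w, hA.res 1 one_pos w - w) ∈ A := by
    simpa using hA.res_mem one_pos w
  have ho : inner ℂ w (hA.res 1 one_pos w) = 0 := by
    refine (Submodule.mem_orthogonal' K w).1 hw _ ?_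
    exact ⟨_, hm, rfl⟩
  have h1 := hA.diss _ hm
  simp only [inner_sub_left, ho, sub_zero] at h1
  rw [inner_self_eq_norm_sq_to_K] at h1
  have h0 : hA.res 1 one_pos w = 0 := by
    have h2 : ‖hA.res 1 one_pos w‖ ^ 2 ≤ 0 := by simpa [← Complex.ofReal_pow] using h1
    exact norm_eq_zero.1 (pow_eq_zero_iff two_ne_zero |>.1 (le_antisymm h2 (sq_nonneg _)))
  rw [h0] at hm
  simpa using hA.single _ hm

/-- For `(f, g)` in `A` one has `λ R_λ f - f = R_λ g = O(1/λ)`. The uniform bound on `λ R_λ` extends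
the convergence from the dense domain to the whole space. -/
theorem tendsto_res (hA : IsMaxDissipative A) [CompleteSpace H] (h : H) :
    Tendsto (fun n : ℕ => ((n : ℝ) + 1) • hA.res ((n : ℝ) + 1) (by positivity) h) atTop (𝓝 h) := by
  rw [Metric.tendsto_atTop]
  intro ε hε
  obtain ⟨f, ⟨g, hfg⟩, hf⟩ := hA.dense_domain.exists_dist_lt h (show 0 < ε / 3 by positivity)
  obtain ⟨N, hN⟩ := exists_nat_gt (‖g‖ / (ε / 3))
  refine ⟨N, fun n hn => ?_⟩
  have hl : (0 : ℝ) < (n : ℝ) + 1 := by positivity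
  have h1 : ‖((n : ℝ) + 1) • hA.res ((n : ℝ) + 1) hl (h - f)‖ ≤ ‖h - f‖ := by
    rw [norm_smul, Real.norm_of_nonneg hl.le]; exact hA.res_bound hl _
  have h2 : ((n : ℝ) + 1) • hA.res ((n : ℝ) + 1) hl f - f = hA.res ((n : ℝ) + 1) hl g := by
    have := hA.res_sub hl hfg
    rw [map_sub, ContinuousLinearMap.map_smul_of_tower] at this
    rw [sub_eq_iff_eq_add'.1 this, add_sub_cancel_right]
  have h3 : ‖hA.res ((n : ℝ) + 1) hl g‖ < ε / 3 := by
    have h4 := hA.res_bound hl g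
    have h5 : ‖g‖ < (n + 1) * (ε / 3) := by
      rw [← div_lt_iff₀ (by positivity)]
      exact hN.trans_le (by exact_mod_cast Nat.le_succ_of_le hn)
    exact lt_of_mul_lt_mul_left (h4.trans_lt h5) hl.le
  rw [dist_eq_norm] at hf ⊢
  have e : ((n : ℝ) + 1) • hA.res ((n : ℝ) + 1) hl h - h =
      ((n : ℝ) + 1) • hA.res ((n : ℝ) + 1) hl (h - f) +
        (((n : ℝ) + 1) • hA.res ((n : ℝ) + 1) hl f - f) - (h - f) := by
    rw [map_sub, smul_sub]; abel
  rw [e, h2]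
  calc _ ≤ ‖((n : ℝ) + 1) • hA.res ((n : ℝ) + 1) hl (h - f)‖ + ‖hA.res ((n : ℝ) + 1) hl g‖
        + ‖h - f‖ := (norm_sub_le _ _).trans (by gcongr; exact norm_add_le _ _)
    _ < ε := by linarith

/-- The Yosida approximations of the semigroup. -/
def approx (hA : IsMaxDissipative A) (n : ℕ) (t : ℝ) : H →L[ℂ] H :=
  exp (t • hA.yosida ((n : ℝ) + 1) (by positivity))

variable [CompleteSpace H]

theorem norm_approx_le (hA : IsMaxDissipative A) (n : ℕ) {t : ℝ} (ht : 0 ≤ t) (f : H) :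
    ‖hA.approx n t f‖ ≤ ‖f‖ :=
  norm_exp_smul_apply_le _ (hA.yosida_diss _) f ht

/-- On the domain the Yosida generators applied to `f'` are `λ R_λ h`, which converge, so
`norm_exp_smul_sub_le` compares two approximations. Contractivity handles general vectors. -/
theorem cauchySeq_approx (hA : IsMaxDissipative A) {t : ℝ} (ht : 0 ≤ t) (f : H) :
    CauchySeq fun n => hA.approx n t f := by
  rw [Metric.cauchySeq_iff']
  intro ε hε
  obtain ⟨f', ⟨h, hfh⟩, hf⟩ := hA.dense_domain.exists_dist_lt f (show 0 < ε / 4 by positivity)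
  have hc := (hA.tendsto_res h).cauchySeq
  rw [Metric.cauchySeq_iff'] at hc
  obtain ⟨N, hN⟩ := hc (ε / (4 * (t + 1))) (by positivity)
  refine ⟨N, fun n hn => ?_⟩
  have h1 := norm_exp_smul_sub_le _ _ (hA.yosida_diss (lam := (n : ℝ) + 1) (by positivity))
    (hA.yosida_diss (lam := (N : ℝ) + 1) (by positivity)) (hA.yosida_comm _ _) f' ht
  rw [hA.yosida_apply _ hfh, hA.yosida_apply _ hfh, ← dist_eq_norm
    (((n : ℝ) + 1) • _)] at h1
  have h2 : t * (ε / (4 * (t + 1))) ≤ ε / 4 := by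
    rw [← mul_div_assoc, div_le_div_iff₀ (by positivity) (by positivity)]
    nlinarith
  have h3 : ‖hA.approx n t f' - hA.approx N t f'‖ ≤ ε / 4 :=
    h1.trans ((mul_le_mul_of_nonneg_left (hN n hn).le ht).trans h2)
  have h4 := hA.norm_approx_le n ht (f - f')
  have h5 := hA.norm_approx_le N ht (f - f')
  rw [dist_eq_norm] at hf ⊢
  have e : hA.approx n t f - hA.approx N t f = hA.approx n t (f - f') +
      (hA.approx n t f' - hA.approx N t f') - hA.approx N t (f - f') := by
    simp only [map_sub]; abel
  rw [e]
  calc _ ≤ ‖hA.approx n t (f - f')‖ + ‖hA.approx n t f' - hA.approx N t f'‖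
        + ‖hA.approx N t (f - f')‖ := (norm_sub_le _ _).trans (by gcongr; exact norm_add_le _ _)
    _ < ε := by linarith

theorem exists_limit (hA : IsMaxDissipative A) (t : ℝ) : ∃ T : H →L[ℂ] H,
    0 ≤ t → ∀ f, Tendsto (fun n => hA.approx n t f) atTop (𝓝 (T f)) := by
  by_cases ht : 0 ≤ t
  · choose T hT using fun f => cauchySeq_tendsto_of_complete (hA.cauchySeq_approx ht f)
    exact ⟨continuousLinearMapOfTendsto (l := atTop) (fun n => hA.approx n t) (f := T)
      (tendsto_pi_nhds.2 hT), fun _ f => hT f⟩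
  -- At negative times the value is arbitrary.
  · exact ⟨0, fun h => absurd h ht⟩

/-- The semigroup generated by a maximal dissipative relation. -/
def semigroup (hA : IsMaxDissipative A) (t : ℝ) : H →L[ℂ] H := (hA.exists_limit t).choose

theorem tendsto_approx (hA : IsMaxDissipative A) {t : ℝ} (ht : 0 ≤ t) (f : H) :
    Tendsto (fun n => hA.approx n t f) atTop (𝓝 (hA.semigroup t f)) :=
  (hA.exists_limit t).choose_spec ht f

theorem norm_semigroup_le (hA : IsMaxDissipative A) {t : ℝ} (ht : 0 ≤ t) (f : H) :
    ‖hA.semigroup t f‖ ≤ ‖f‖ :=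
  le_of_tendsto (hA.tendsto_approx ht f).norm (Eventually.of_forall fun n =>
    hA.norm_approx_le n ht f)

theorem semigroup_zero (hA : IsMaxDissipative A) :
    hA.semigroup 0 = ContinuousLinearMap.id ℂ H := by
  refine ContinuousLinearMap.ext fun f => ?_
  refine tendsto_nhds_unique (hA.tendsto_approx le_rfl f) ?_
  simp [approx]

theorem semigroup_add (hA : IsMaxDissipative A) {s t : ℝ} (hs : 0 ≤ s) (ht : 0 ≤ t) :
    hA.semigroup (s + t) = (hA.semigroup s).comp (hA.semigroup t) := by
  refine ContinuousLinearMap.ext fun f => ?_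
  refine tendsto_nhds_unique (hA.tendsto_approx (add_nonneg hs ht) f) ?_
  have e : ∀ n, hA.approx n (s + t) f = hA.approx n s (hA.approx n t f - hA.semigroup t f)
      + hA.approx n s (hA.semigroup t f) := fun n => by
    have : hA.approx n (s + t) = hA.approx n s * hA.approx n t := by
      unfold approx
      let _ := NormedAlgebra.restrictScalars ℚ ℂ (H →L[ℂ] H)
      rw [add_smul, exp_add_of_commute]
      exact ((Commute.refl _).smul_left s).smul_right t
    rw [this, ← map_add, sub_add_cancel]; rfl
  simp only [e]
  have h1 : Tendsto (fun n => hA.approx n s (hA.approx n t f - hA.semigroup t f)) atTop (𝓝 0) := by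
    refine squeeze_zero_norm (fun n => hA.norm_approx_le n hs _) ?_
    have := ((hA.tendsto_approx ht f).sub_const (hA.semigroup t f)).norm
    simpa using this
  simpa using h1.add (hA.tendsto_approx hs (hA.semigroup t f))

theorem norm_semigroup_sub_le (hA : IsMaxDissipative A) {f h : H} (hf : (f, h) ∈ A) {s t : ℝ}
    (hs : 0 ≤ s) (hst : s ≤ t) :
    ‖hA.semigroup t f - hA.semigroup s f‖ ≤ (t - s) * ‖h‖ := by
  refine le_of_tendsto ((hA.tendsto_approx (hs.trans hst) f).sub (hA.tendsto_approx hs f)).norm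
    (Eventually.of_forall fun n => ?_)
  refine (norm_exp_smul_sub_self_le _ (hA.yosida_diss _) f hs hst).trans ?_
  have hl : (0 : ℝ) < (n : ℝ) + 1 := by positivity
  rw [hA.yosida_apply _ hf, norm_smul, Real.norm_of_nonneg hl.le]
  exact mul_le_mul_of_nonneg_left (hA.res_bound hl h) (by linarith)

theorem continuousOn_semigroup (hA : IsMaxDissipative A) (f : H) :
    ContinuousOn (fun t : ℝ => hA.semigroup t f) (Ici 0) := by
  rw [Metric.continuousOn_iff]
  intro t ht ε hε
  obtain ⟨f', ⟨h, hfh⟩, hf⟩ := hA.dense_domain.exists_dist_lt f (show 0 < ε / 3 by positivity)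
  refine ⟨ε / (3 * (‖h‖ + 1)), by positivity, fun s hs hst => ?_⟩
  have h1 : ‖hA.semigroup s f' - hA.semigroup t f'‖ ≤ ε / 3 := by
    have h2 : ‖hA.semigroup s f' - hA.semigroup t f'‖ ≤ |s - t| * ‖h‖ := by
      rcases le_total t s with h3 | h3
      · rw [abs_of_nonneg (sub_nonneg.2 h3)]
        exact hA.norm_semigroup_sub_le hfh ht h3
      · rw [norm_sub_rev, abs_sub_comm, abs_of_nonneg (sub_nonneg.2 h3)]
        exact hA.norm_semigroup_sub_le hfh hs h3
    rw [Real.dist_eq] at hst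
    have h4 : ε / (3 * (‖h‖ + 1)) * ‖h‖ ≤ ε / 3 := by
      rw [div_mul_eq_mul_div, div_le_div_iff₀ (by positivity) (by positivity)]
      nlinarith [norm_nonneg h]
    exact h2.trans ((mul_le_mul_of_nonneg_right hst.le (norm_nonneg _)).trans h4)
  have h4 := hA.norm_semigroup_le hs (f - f')
  have h5 := hA.norm_semigroup_le ht (f - f')
  rw [dist_eq_norm] at hf ⊢
  have e : hA.semigroup s f - hA.semigroup t f = hA.semigroup s (f - f') +
      (hA.semigroup s f' - hA.semigroup t f') - hA.semigroup t (f - f') := by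
    simp only [map_sub]; abel
  rw [e]
  calc _ ≤ ‖hA.semigroup s (f - f')‖ + ‖hA.semigroup s f' - hA.semigroup t f'‖
        + ‖hA.semigroup t (f - f')‖ := (norm_sub_le _ _).trans (by gcongr; exact norm_add_le _ _)
    _ < ε := by linarith

/-- The vector `h` need not lie in the domain, so it is replaced by a nearby `h'` that does, with
image `h''`. Passing to the limit in the Yosida parameter bounds the Taylor remainder by `t (2 ‖h -
h'‖ + t ‖h''‖)`. -/
theorem tendsto_generator (hA : IsMaxDissipative A) {f h : H} (hf : (f, h) ∈ A) :
    Tendsto (fun t : ℝ => t⁻¹ • (hA.semigroup t f - f)) (𝓝[>] 0) (𝓝 h) := by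
  rw [Metric.tendsto_nhds]
  intro ε hε
  obtain ⟨h', ⟨h'', hh⟩, hd⟩ := hA.dense_domain.exists_dist_lt h (show 0 < ε / 4 by positivity)
  have hev : ∀ᶠ t : ℝ in 𝓝[>] 0, t < ε / (4 * (‖h''‖ + 1)) :=
    nhdsWithin_le_nhds (eventually_lt_nhds (by positivity))
  filter_upwards [hev, self_mem_nhdsWithin] with t ht ht0
  have ht0 : 0 < t := ht0
  have key : ‖hA.semigroup t f - f - t • h‖ ≤ t * (2 * ‖h - h'‖ + t * ‖h''‖) := by
    have hlim : Tendsto (fun n : ℕ => ‖hA.approx n t f - f -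
        t • (((n : ℝ) + 1) • hA.res ((n : ℝ) + 1) (by positivity) h)‖) atTop
        (𝓝 ‖hA.semigroup t f - f - t • h‖) :=
      (((hA.tendsto_approx ht0.le f).sub_const f).sub ((hA.tendsto_res h).const_smul t)).norm
    have hlim2 : Tendsto (fun n : ℕ => t * (2 * ‖((n : ℝ) + 1) •
        hA.res ((n : ℝ) + 1) (by positivity) h - h‖ + (2 * ‖h - h'‖ + t * ‖h''‖))) atTop
        (𝓝 (t * (2 * ‖h - h‖ + (2 * ‖h - h'‖ + t * ‖h''‖)))) :=
      (((((hA.tendsto_res h).sub_const h).norm).const_mul 2).add_const _).const_mul t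
    rw [sub_self, norm_zero, mul_zero, zero_add] at hlim2
    refine le_of_tendsto_of_tendsto' hlim hlim2 fun n => ?_
    have hl : (0 : ℝ) < (n : ℝ) + 1 := by positivity
    rw [← hA.yosida_apply hl hf]
    refine norm_exp_smul_taylor_le _ f ht0.le fun s hs => ?_
    set B := hA.yosida ((n : ℝ) + 1) hl with hB
    rw [hA.yosida_apply hl hf]
    set j := ((n : ℝ) + 1) • hA.res ((n : ℝ) + 1) hl h with hj
    have n1 := norm_exp_smul_apply_le B (hA.yosida_diss hl) (j - h) hs.1
    have n2 := norm_exp_smul_apply_le B (hA.yosida_diss hl) (h - h') hs.1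
    have n3 := norm_exp_smul_sub_self_le B (hA.yosida_diss hl) h' le_rfl hs.1
    rw [zero_smul, exp_zero, sub_zero] at n3
    have n4 : ‖B h'‖ ≤ ‖h''‖ := by
      rw [hB, hA.yosida_apply hl hh, norm_smul, Real.norm_of_nonneg hl.le]
      exact hA.res_bound hl _
    have n5 : s * ‖B h'‖ ≤ t * ‖h''‖ := mul_le_mul hs.2.le n4 (norm_nonneg _) ht0.le
    have e : exp (s • B) j - j = exp (s • B) (j - h) + exp (s • B) (h - h') +
        (exp (s • B) h' - (1 : H →L[ℂ] H) h') - (h - h') - (j - h) := by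
      simp only [map_sub, one_apply_eq_self]; abel
    rw [e]
    refine (norm_sub_le _ _).trans ?_
    refine (add_le_add_left (norm_sub_le _ _) _).trans ?_
    refine (add_le_add_left (add_le_add_left (norm_add₃_le) _) _).trans ?_
    linarith
  rw [dist_eq_norm] at hd ⊢
  have e : t⁻¹ • (hA.semigroup t f - f) - h = t⁻¹ • (hA.semigroup t f - f - t • h) := by
    rw [smul_sub t⁻¹ _ (t • h), inv_smul_smul₀ ht0.ne']
  rw [e, norm_smul, norm_inv, Real.norm_of_nonneg ht0.le, inv_mul_lt_iff₀ ht0]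
  refine key.trans_lt (mul_lt_mul_of_pos_left ?_ ht0)
  have : t * ‖h''‖ ≤ ε / 4 := by
    refine (mul_le_mul_of_nonneg_right ht.le (norm_nonneg _)).trans ?_
    rw [div_mul_eq_mul_div, div_le_div_iff₀ (by positivity) (by positivity)]
    nlinarith [norm_nonneg h'']
  linarith

/-- Maximality gives the converse: solve `(1 - A) g = f - h`. Then `f - g` has right derivative `f -
g` at time zero, while a contraction semigroup cannot increase the norm, so `f = g`. -/
theorem generator_iff (hA : IsMaxDissipative A) (f h : H) :
    Tendsto (fun t : ℝ => t⁻¹ • (hA.semigroup t f - f)) (𝓝[>] 0) (𝓝 h) ↔ (f, h) ∈ A := by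
  refine ⟨fun hlim => ?_, hA.tendsto_generator⟩
  set g := hA.res 1 one_pos (f - h) with hg
  have hmem : (g, g - (f - h)) ∈ A := by
    simpa only [one_smul] using hA.res_mem one_pos (f - h)
  have h1 : Tendsto (fun t : ℝ => t⁻¹ • (hA.semigroup t (f - g) - (f - g))) (𝓝[>] 0)
      (𝓝 (f - g)) := by
    have := hlim.sub (hA.tendsto_generator hmem)
    convert this using 2
    · rw [map_sub, ← smul_sub]; congr 1; abel
    · abel
  have h2 : Tendsto (fun t : ℝ => (inner ℂ (t⁻¹ • (hA.semigroup t (f - g) - (f - g))) (f - g)).re)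
      (𝓝[>] 0) (𝓝 (inner ℂ (f - g) (f - g)).re) :=
    (Complex.continuous_re.tendsto _).comp (h1.inner tendsto_const_nhds)
  have h4 : (inner ℂ (f - g) (f - g)).re = ‖f - g‖ ^ 2 := by
    rw [inner_self_eq_norm_sq_to_K]; simp [← Complex.ofReal_pow]
  have h3 : (inner ℂ (f - g) (f - g)).re ≤ 0 := by
    refine le_of_tendsto h2 ?_
    filter_upwards [self_mem_nhdsWithin] with t ht
    have ht : (0 : ℝ) < t := ht
    rw [← Complex.coe_smul, inner_smul_left, Complex.conj_ofReal, Complex.re_ofReal_mul,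
      inner_sub_left, Complex.sub_re, h4]
    refine mul_nonpos_of_nonneg_of_nonpos (inv_nonneg.2 ht.le) ?_
    have := (Complex.re_le_norm _).trans
      (norm_inner_le_norm (𝕜 := ℂ) (hA.semigroup t (f - g)) (f - g))
    have := mul_le_mul_of_nonneg_right (hA.norm_semigroup_le ht.le (f - g)) (norm_nonneg (f - g))
    nlinarith
  rw [h4] at h3
  have h5 : f = g := sub_eq_zero.1
    (norm_eq_zero.1 (pow_eq_zero_iff two_ne_zero |>.1 (le_antisymm h3 (sq_nonneg _))))
  rw [← h5] at hmem
  simpa using hmem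

theorem semigroup_mem (hA : IsMaxDissipative A) {f h : H} (hf : (f, h) ∈ A) {t : ℝ}
    (ht : 0 ≤ t) : (hA.semigroup t f, hA.semigroup t h) ∈ A := by
  rw [← hA.generator_iff]
  have h1 := ((hA.semigroup t).continuous.tendsto h).comp (hA.tendsto_generator hf)
  refine h1.congr' ?_
  filter_upwards [self_mem_nhdsWithin] with s hs
  have hs : (0 : ℝ) < s := hs
  have e : hA.semigroup s (hA.semigroup t f) = hA.semigroup t (hA.semigroup s f) := by
    have h2 := hA.semigroup_add hs.le ht
    rw [add_comm, hA.semigroup_add ht hs.le] at h2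
    exact (congrArg (fun T : H →L[ℂ] H => T f) h2).symm
  simp only [Function.comp, e, ContinuousLinearMap.map_smul_of_tower, map_sub]

theorem hasDerivWithinAt_semigroup (hA : IsMaxDissipative A) {f h : H} (hf : (f, h) ∈ A) {t : ℝ}
    (ht : 0 ≤ t) :
    HasDerivWithinAt (fun s => hA.semigroup s f) (hA.semigroup t h) (Ici t) t := by
  rw [← hasDerivWithinAt_Ioi_iff_Ici, hasDerivWithinAt_iff_tendsto_slope' (by simp)]
  have h1 := hA.tendsto_generator (hA.semigroup_mem hf ht)
  have h2 : Tendsto (fun s : ℝ => s - t) (𝓝[>] t) (𝓝[>] 0) := by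
    refine tendsto_nhdsWithin_of_tendsto_nhds_of_eventually_within _ ?_ ?_
    · have : Tendsto (fun s : ℝ => s - t) (𝓝 t) (𝓝 (t - t)) := tendsto_id.sub_const t
      rw [sub_self] at this
      exact this.mono_left nhdsWithin_le_nhds
    · filter_upwards [self_mem_nhdsWithin] with s hs
      exact sub_pos.2 (mem_Ioi.1 hs)
  refine (h1.comp h2).congr' ?_
  filter_upwards [self_mem_nhdsWithin] with s hs
  have hs : t < s := hs
  have e := hA.semigroup_add (sub_pos.2 hs).le ht
  rw [sub_add_cancel] at e
  simp [slope, e]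

end IsMaxDissipative

end HilleYosida

/-! ### Algebra of one Fourier mode: commutators, the Hardy inequality and the hypocoercivity
functional. -/

section ModeAlgebra

variable {V : Type*} [AddCommGroup V] [Module ℂ V]
  {X : Type*} [NormedAddCommGroup X] [InnerProductSpace ℂ X]

/-- The relations between differentiation `D`, multiplication by the coordinate `Y` and the
Green operator `G = (k² - D²)⁻¹`, on a space `V` mapped by `ι` to a Hilbert space. -/
structure IsModeTriple (ι : V →ₗ[ℂ] X) (D Y G : V →ₗ[ℂ] V) (k : ℝ) : Prop where
  skew : ∀ u v, inner ℂ (ι (D u)) (ι v) = -inner ℂ (ι u) (ι (D v))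
  symm : ∀ u v, inner ℂ (ι (Y u)) (ι v) = inner ℂ (ι u) (ι (Y v))
  comm : ∀ v, D (Y v) = v + Y (D v)
  green : ∀ v, ((k ^ 2 : ℝ) : ℂ) • G v - D (D (G v)) = v

/-- The operator `-ik(y² + 2G) + ν(D² - k²)`. -/
def modeOp (D Y G : V →ₗ[ℂ] V) (nu k : ℝ) : V →ₗ[ℂ] V :=
  (-(Complex.I * k)) • (Y ∘ₗ Y + (2 : ℂ) • G)
    + (nu : ℂ) • (D ∘ₗ D - ((k ^ 2 : ℝ) : ℂ) • LinearMap.id)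

/-- Real and imaginary parts of the inner product. -/
def rp (ι : V →ₗ[ℂ] X) (u v : V) : ℝ := (inner ℂ (ι u) (ι v)).re

/-- Imaginary part of the inner product. -/
def sp (ι : V →ₗ[ℂ] X) (u v : V) : ℝ := (inner ℂ (ι u) (ι v)).im

variable {ι : V →ₗ[ℂ] X} {D Y G : V →ₗ[ℂ] V} {k nu : ℝ}

theorem rp_self (u : V) : rp ι u u = ‖ι u‖ ^ 2 := by
  rw [rp, inner_self_eq_norm_sq_to_K]; simp [← Complex.ofReal_pow]

theorem sp_self (u : V) : sp ι u u = 0 := by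
  rw [sp, inner_self_eq_norm_sq_to_K]; simp [← Complex.ofReal_pow]

theorem rp_comm (u v : V) : rp ι u v = rp ι v u := by
  rw [rp, rp, ← inner_conj_symm, Complex.conj_re]

theorem sp_comm (u v : V) : sp ι u v = -sp ι v u := by
  rw [sp, sp, ← inner_conj_symm, Complex.conj_im]

theorem abs_rp_le (u v : V) : |rp ι u v| ≤ ‖ι u‖ * ‖ι v‖ :=
  (Complex.abs_re_le_norm _).trans (norm_inner_le_norm _ _)

theorem abs_sp_le (u v : V) : |sp ι u v| ≤ ‖ι u‖ * ‖ι v‖ :=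
  (Complex.abs_im_le_norm _).trans (norm_inner_le_norm _ _)

theorem rp_add_left (u v w : V) : rp ι (u + v) w = rp ι u w + rp ι v w := by
  simp [rp]
theorem rp_add_right (u v w : V) : rp ι u (v + w) = rp ι u v + rp ι u w := by
  simp [rp]
theorem rp_sub_right (u v w : V) : rp ι u (v - w) = rp ι u v - rp ι u w := by
  simp [rp]
theorem rp_smul_right (c : ℝ) (u v : V) : rp ι u ((c : ℂ) • v) = c * rp ι u v := by
  simp [rp]
theorem rp_I_right (u v : V) : rp ι u (Complex.I • v) = -sp ι u v := by
  simp [rp, sp]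
theorem sp_add_right (u v w : V) : sp ι u (v + w) = sp ι u v + sp ι u w := by
  simp [sp]
theorem sp_sub_right (u v w : V) : sp ι u (v - w) = sp ι u v - sp ι u w := by
  simp [sp]
theorem sp_smul_right (c : ℝ) (u v : V) : sp ι u ((c : ℂ) • v) = c * sp ι u v := by
  simp [sp]
theorem sp_I_right (u v : V) : sp ι u (Complex.I • v) = rp ι u v := by
  simp [rp, sp]

theorem modeOp_apply (v : V) : modeOp D Y G nu k v =
    (-(Complex.I * k)) • (Y (Y v) + (2 : ℂ) • G v)
    + (nu : ℂ) • (D (D v) - ((k ^ 2 : ℝ) : ℂ) • v) := rfl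

set_option linter.unusedSimpArgs false in
theorem rp_modeOp (v w : V) : rp ι (modeOp D Y G nu k v) w =
    -k * (sp ι (Y (Y v)) w + 2 * sp ι (G v) w) + nu * (rp ι (D (D v)) w - k ^ 2 * rp ι v w) := by
  simp only [modeOp_apply, rp, sp, map_add, map_sub, map_smul, inner_add_left, inner_sub_left,
    inner_smul_left, Complex.add_re]
  simp [← Complex.ofReal_pow]

namespace IsModeTriple

theorem rp_D (hM : IsModeTriple ι D Y G k) (u v : V) : rp ι (D u) v = -rp ι u (D v) := by
  simp [rp, hM.skew]
theorem sp_D (hM : IsModeTriple ι D Y G k) (u v : V) : sp ι (D u) v = -sp ι u (D v) := by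
  simp [sp, hM.skew]
theorem rp_Y (hM : IsModeTriple ι D Y G k) (u v : V) : rp ι (Y u) v = rp ι u (Y v) := by
  simp [rp, hM.symm]
theorem sp_Y (hM : IsModeTriple ι D Y G k) (u v : V) : sp ι (Y u) v = sp ι u (Y v) := by
  simp [sp, hM.symm]

/-- The canonical commutation relation in integrated form: `Re ∫ y w̄ w' = -½ ∫ |w|²`. -/
theorem rp_Y_D_self (hM : IsModeTriple ι D Y G k) (w : V) :
    rp ι (Y w) (D w) = -(1 / 2) * ‖ι w‖ ^ 2 := by
  have h1 := hM.rp_D (Y w) w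
  rw [hM.comm, rp_add_left, rp_self, hM.rp_Y, rp_comm] at h1
  have h2 := hM.rp_Y w (D w)
  have h3 := rp_comm (ι := ι) (D w) (Y w)
  have h4 := hM.rp_Y w (D w)
  have h5 := rp_comm (ι := ι) w (Y (D w))
  have h6 := hM.rp_Y (D w) w
  linarith

theorem rp_G (hM : IsModeTriple ι D Y G k) (w v : V) :
    rp ι w v = k ^ 2 * rp ι w (G v) - rp ι w (D (D (G v))) := by
  conv_lhs => rw [← hM.green v]
  rw [rp_sub_right, rp_smul_right]

theorem sp_G (hM : IsModeTriple ι D Y G k) (w v : V) :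
    sp ι w v = k ^ 2 * sp ι w (G v) - sp ι w (D (D (G v))) := by
  conv_lhs => rw [← hM.green v]
  rw [sp_sub_right, sp_smul_right]

theorem sp_D_D_self (hM : IsModeTriple ι D Y G k) (v : V) : sp ι v (D (D v)) = 0 := by
  have h := hM.sp_D v (D v)
  rw [sp_self] at h
  linarith

theorem rp_D_D_self (hM : IsModeTriple ι D Y G k) (v : V) : rp ι v (D (D v)) = -‖ι (D v)‖ ^ 2 := by
  have h := hM.rp_D v (D v)
  rw [rp_self] at h
  linarith

theorem rp_D_D_Y_Y (hM : IsModeTriple ι D Y G k) (v : V) :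
    rp ι (D (D v)) (Y (Y v)) = ‖ι v‖ ^ 2 - ‖ι (Y (D v))‖ ^ 2 := by
  have e : D (Y (Y v)) = Y v + (Y v + Y (Y (D v))) := by
    rw [hM.comm, hM.comm, map_add]
  rw [hM.rp_D, e, rp_add_right, rp_add_right, rp_comm _ (Y v), hM.rp_Y_D_self, ← hM.rp_Y, rp_self]
  ring

theorem sp_D_D_Y_Y (hM : IsModeTriple ι D Y G k) (v : V) :
    sp ι (D (D v)) (Y (Y v)) = 2 * sp ι (Y v) (D v) := by
  have e : D (Y (Y v)) = Y v + (Y v + Y (Y (D v))) := by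
    rw [hM.comm, hM.comm, map_add]
  rw [hM.sp_D, e, sp_add_right, sp_add_right, ← hM.sp_Y (D v) (Y (D v)), sp_self,
    sp_comm (D v)]
  ring

theorem sp_G_self (hM : IsModeTriple ι D Y G k) (v : V) : sp ι (G v) v = 0 := by
  rw [hM.sp_G, sp_self, hM.sp_D_D_self]; ring

theorem rp_G_self (hM : IsModeTriple ι D Y G k) (v : V) :
    rp ι (G v) v = k ^ 2 * ‖ι (G v)‖ ^ 2 + ‖ι (D (G v))‖ ^ 2 := by
  rw [hM.rp_G, rp_self, hM.rp_D_D_self]; ring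

theorem rp_modeOp_self (hM : IsModeTriple ι D Y G k) (v : V) :
    rp ι (modeOp D Y G nu k v) v = -nu * ‖ι (D v)‖ ^ 2 - nu * k ^ 2 * ‖ι v‖ ^ 2 := by
  rw [rp_modeOp, hM.sp_Y, sp_self, hM.sp_G_self, rp_comm, hM.rp_D_D_self, rp_self]
  ring

theorem rp_modeOp_D_D (hM : IsModeTriple ι D Y G k) (v : V) :
    rp ι (modeOp D Y G nu k v) (D (D v)) =
      2 * k * sp ι (Y v) (D v) + nu * ‖ι (D (D v))‖ ^ 2 + nu * k ^ 2 * ‖ι (D v)‖ ^ 2 := by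
  -- The nonlocal term drops out: after moving both derivatives onto `G v`, substitute `v = k² G v -
  -- D² G v`; the remaining pairings are real.
  have h1 : sp ι (G v) (D (D v)) = 0 := by
    have a1 := hM.sp_D (G v) (D v)
    have a2 := hM.sp_D (D (G v)) v
    have a3 := hM.sp_G (D (D (G v))) v
    have a4 := hM.sp_D_D_self (G v)
    have a5 := sp_comm (ι := ι) (D (D (G v))) (G v)
    rw [sp_self, a5, a4] at a3
    linarith
  rw [rp_modeOp, h1, rp_self, hM.rp_D_D_self, sp_comm, hM.sp_D_D_Y_Y]
  ring

/-- The generator of dilations, `(YD + DY)`, paired with the mode operator. -/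
theorem sp_modeOp_dilation (hM : IsModeTriple ι D Y G k) (v : V) :
    rp ι (modeOp D Y G nu k v) (Complex.I • (Y (D v) + D (Y v))) =
      2 * k * ‖ι (Y v)‖ ^ 2 + 4 * k * ‖ι (D (G v))‖ ^ 2
      - 2 * nu * sp ι (D (D v)) (Y (D v)) + 2 * nu * k ^ 2 * sp ι (Y v) (D v) := by
  -- Multiplication by `y²` has homogeneity two, so its commutator with dilations reproduces `y²`
  -- with a definite sign.
  have w1 : rp ι (Y (Y v)) (Y (D v) + D (Y v)) = -2 * ‖ι (Y v)‖ ^ 2 := by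
    have e : Y (D v) = D (Y v) - v := by rw [hM.comm]; abel
    rw [e, rp_add_right, rp_sub_right, hM.rp_Y_D_self, hM.rp_Y, rp_self]
    ring
  -- The operator `S = YD + DY` is skew, so `v` can be isolated and replaced by `k² G v - D² G v`.
  -- The `k²` part vanishes by skewness, and only the commutator of `S` with `D²` survives. The
  -- result has the same sign as the local term, so the nonlocal part adds damping.
  have w2 : rp ι (G v) (Y (D v) + D (Y v)) = -2 * ‖ι (D (G v))‖ ^ 2 := by
    have a1 : rp ι (G v) (Y (D v) + D (Y v)) = -rp ι (Y (D (G v)) + D (Y (G v))) v := by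
      rw [rp_add_right, rp_add_left, ← hM.rp_Y, hM.rp_Y (D (G v)), hM.rp_D (Y (G v)),
        hM.rp_D (G v)]
      ring
    have a2 : rp ι (Y (D (G v)) + D (Y (G v))) (G v) = 0 := by
      rw [hM.comm, rp_add_left, rp_add_left, rp_self]
      have := hM.rp_Y_D_self (G v)
      rw [rp_comm, ← hM.rp_Y] at *
      rw [hM.rp_Y, rp_comm]
      linarith
    have a3 : rp ι (Y (D (G v)) + D (Y (G v))) (D (D (G v))) = -2 * ‖ι (D (G v))‖ ^ 2 := by
      rw [hM.comm, rp_add_left, rp_add_left, hM.rp_Y_D_self, hM.rp_D_D_self]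
      ring
    rw [a1, hM.rp_G, a2, a3]
    ring
  have w3 : sp ι (D (D v)) (Y (D v) + D (Y v)) = 2 * sp ι (D (D v)) (Y (D v)) := by
    rw [hM.comm, sp_add_right, sp_add_right, sp_comm _ v, hM.sp_D_D_self]
    ring
  have w4 : sp ι v (Y (D v) + D (Y v)) = 2 * sp ι (Y v) (D v) := by
    rw [hM.comm, sp_add_right, sp_add_right, sp_self, ← hM.sp_Y]
    ring
  rw [rp_modeOp, sp_I_right, sp_I_right, rp_I_right, rp_I_right, w1, w2, w3, w4]
  ring

/-- The inviscid part of the operator is `-ik` times `Y² + 2G` itself, so it contributes nothing to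
the real part. In the viscous part, `(D² - k²) G = -1` gives `-2ν ‖v‖²`, which outweighs the `+ν
‖v‖²` from commuting `D²` past `Y²`. -/
theorem rp_modeOp_energy (hM : IsModeTriple ι D Y G k) (v : V) :
    rp ι (modeOp D Y G nu k v) (Y (Y v) + (2 : ℂ) • G v) =
      -nu * (k ^ 2 * ‖ι (Y v)‖ ^ 2 + ‖ι (Y (D v))‖ ^ 2 + ‖ι v‖ ^ 2) := by
  have e2 : ∀ w : V, (2 : ℂ) • w = ((2 : ℝ) : ℂ) • w := fun w => by norm_num
  have w0 : sp ι (Y (Y v)) (Y (Y v) + (2 : ℂ) • G v)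
      + 2 * sp ι (G v) (Y (Y v) + (2 : ℂ) • G v) = 0 := by
    rw [e2, sp_add_right, sp_add_right, sp_smul_right, sp_smul_right, sp_self, sp_self,
      sp_comm (G v)]
    ring
  have w1 : rp ι (D (D v)) (G v) - k ^ 2 * rp ι v (G v) = -‖ι v‖ ^ 2 := by
    have a1 := hM.rp_D (D v) (G v)
    have a2 := hM.rp_D v (D (G v))
    have a3 := hM.rp_G v v
    rw [rp_self] at a3
    linarith
  rw [rp_modeOp, w0, e2, rp_add_right, rp_add_right, rp_smul_right, rp_smul_right,
    hM.rp_D_D_Y_Y, ← hM.rp_Y, rp_self]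
  linear_combination 2 * nu * w1

/-- A Hardy type inequality for the stream function. -/
theorem sq_norm_G_le (hM : IsModeTriple ι D Y G k) (v : V) :
    k ^ 2 * ‖ι (G v)‖ ^ 2 ≤ ‖ι (Y v)‖ ^ 2 + 5 * ‖ι (D (G v))‖ ^ 2 := by
  set p := G v with hp
  -- The uncertainty inequality for the stream function `p`.
  have h1 : ‖ι p‖ ^ 2 ≤ 2 * (‖ι (Y p)‖ * ‖ι (D p)‖) := by
    have a1 := hM.rp_Y_D_self p
    have a2 := (abs_le.1 (abs_rp_le (ι := ι) (Y p) (D p))).1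
    linarith
  -- Pair `k² p - D² p = v` with `Y² p`. The term `‖Y D p‖²` has a good sign and is dropped, and the
  -- commutator costs only `‖p‖²`, which `h1` controls.
  have h2 : k ^ 2 * ‖ι (Y p)‖ ^ 2 ≤ ‖ι (Y v)‖ * ‖ι (Y p)‖ + ‖ι p‖ ^ 2 := by
    have a1 := hM.rp_G (Y (Y p)) v
    have a2 := hM.rp_D_D_Y_Y p
    rw [← hp, hM.rp_Y (Y p) p, rp_self, rp_comm _ (D (D p)), a2, hM.rp_Y] at a1
    have a3 := (abs_le.1 (abs_rp_le (ι := ι) (Y p) (Y v))).2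
    nlinarith [sq_nonneg ‖ι (Y (D p))‖]
  have h3 : k ^ 2 * ‖ι (Y p)‖ ≤ ‖ι (Y v)‖ + 2 * ‖ι (D p)‖ := by
    rcases eq_or_lt_of_le (norm_nonneg (ι (Y p))) with h0 | h0
    · rw [← h0, mul_zero]; positivity
    · refine le_of_mul_le_mul_right ?_ h0
      linarith
  have h4 : k ^ 2 * ‖ι p‖ ^ 2 ≤ 2 * ‖ι (D p)‖ * (‖ι (Y v)‖ + 2 * ‖ι (D p)‖) := by
    calc k ^ 2 * ‖ι p‖ ^ 2 ≤ k ^ 2 * (2 * (‖ι (Y p)‖ * ‖ι (D p)‖)) := by gcongr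
      _ = 2 * ‖ι (D p)‖ * (k ^ 2 * ‖ι (Y p)‖) := by ring
      _ ≤ _ := by gcongr
  nlinarith [sq_nonneg (‖ι (D p)‖ - ‖ι (Y v)‖)]

end IsModeTriple

/-- `-D²`. -/
def negLap (D : V →ₗ[ℂ] V) : V →ₗ[ℂ] V := -(D ∘ₗ D)

/-- The symmetric generator of dilations `-(i/2)(YD + DY)`. -/
def dilation (D Y : V →ₗ[ℂ] V) : V →ₗ[ℂ] V := (-(1 / 2 : ℂ)) • Complex.I • (Y ∘ₗ D + D ∘ₗ Y)

/-- The conserved energy `Y² + 2G` of the inviscid dynamics. -/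
def energyOp (Y G : V →ₗ[ℂ] V) : V →ₗ[ℂ] V := Y ∘ₗ Y + (2 : ℂ) • G

/-- The hypocoercivity functional, with weights growing in time. -/
def hypo (ι : V →ₗ[ℂ] X) (D Y G : V →ₗ[ℂ] V) (nu k t : ℝ) (v : V) : ℝ :=
  rp ι v v + nu * t / 40 * rp ι (negLap D v) v + nu * t ^ 2 * k / 720 * rp ι (dilation D Y v) v
    + nu * t ^ 3 * k ^ 2 / 12960 * rp ι (energyOp Y G v) v

/-- The derivative of `hypo` along the flow of the mode operator. -/
def hypoDeriv (ι : V →ₗ[ℂ] X) (D Y G : V →ₗ[ℂ] V) (nu k t : ℝ) (v : V) : ℝ :=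
  2 * rp ι v (modeOp D Y G nu k v)
    + (nu / 40 * rp ι (negLap D v) v
      + nu * t / 40 * (2 * rp ι (negLap D v) (modeOp D Y G nu k v)))
    + (nu * (2 * t) * k / 720 * rp ι (dilation D Y v) v
      + nu * t ^ 2 * k / 720 * (2 * rp ι (dilation D Y v) (modeOp D Y G nu k v)))
    + (nu * (3 * t ^ 2) * k ^ 2 / 12960 * rp ι (energyOp Y G v) v
      + nu * t ^ 3 * k ^ 2 / 12960 * (2 * rp ι (energyOp Y G v) (modeOp D Y G nu k v)))

theorem rp_dilation_right (u v : V) :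
    rp ι u (dilation D Y v) = -(1 / 2) * rp ι u (Complex.I • (Y (D v) + D (Y v))) := by
  have e : dilation D Y v = ((-(1 / 2) : ℝ) : ℂ) • (Complex.I • (Y (D v) + D (Y v))) := by
    simp [dilation]
  rw [e, rp_smul_right]

theorem rp_negLap_right (u v : V) : rp ι u (negLap D v) = -rp ι u (D (D v)) := by
  simp [rp, negLap]

theorem energyOp_apply (v : V) : energyOp Y G v = Y (Y v) + (2 : ℂ) • G v := rfl

/-- The quadratic inequality behind the decay of the hypocoercivity functional. -/
theorem hypo_quadratic_nonpos {nu t K f y n m z d g a b : ℝ} (hnu : 0 ≤ nu) (ht : 0 ≤ t)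
    (b1 : |a| ≤ K * (y * n)) (b2 : |b| ≤ K * (m * z))
    (hH : K ^ 2 * g ^ 2 ≤ y ^ 2 + 5 * d ^ 2) :
    2 * (-nu * n ^ 2 - nu * K ^ 2 * f ^ 2)
    + (nu / 40 * n ^ 2 - nu * t / 40 * (2 * (2 * a + nu * m ^ 2 + nu * K ^ 2 * n ^ 2)))
    + (nu * (2 * t) / 720 * a
      - nu * t ^ 2 / 720 * (2 * K ^ 2 * y ^ 2 + 4 * K ^ 2 * d ^ 2 - 2 * nu * b
        + 2 * nu * K ^ 2 * a))
    + (nu * (3 * t ^ 2) * K ^ 2 / 12960 * (y ^ 2 + 2 * (K ^ 2 * g ^ 2 + d ^ 2))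
      - nu * t ^ 3 * K ^ 2 / 12960 * (2 * (nu * (K ^ 2 * y ^ 2 + z ^ 2 + f ^ 2)))) ≤ 0 := by
  obtain ⟨b1l, b1u⟩ := abs_le.1 b1
  obtain ⟨b2l, b2u⟩ := abs_le.1 b2
  -- Letters stand for norms: `n` for `Dv`, `y` for `Yv`, `m` for `D²v`, `z` for `YDv`, `d` for
  -- `DGv`, `g` for `Gv`, `f` for `v`; `a` and `b` are the two cross terms. `q1` gathers everything
  -- of order `ν`: the energy dissipation, the dilation damping and the derivatives of the weights.
  have q1 : -2 * n ^ 2 + n ^ 2 / 40 + (4 / 40 + 2 / 720) * (t * K * (y * n))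
      - 2 / 720 * (t * K * y) ^ 2 - 4 / 720 * (t * K * d) ^ 2
      + 9 / 12960 * (2 * (t * K * y) ^ 2 + 4 * (t * K * d) ^ 2) ≤ 0 := by
    nlinarith [sq_nonneg (n - (1 / 36) * (t * K * y)), sq_nonneg (t * K * d)]
  -- `q2` and `q3` gather the terms of order `ν² t`: viscous dissipation of the derivative and
  -- energy terms against the viscous error of the dilation term.
  have q2 : -2 / 40 * m ^ 2 + 2 / 720 * (t * K * (m * z)) - 2 / 12960 * (t * K * z) ^ 2 ≤ 0 := by
    nlinarith [sq_nonneg (m - (t * K * z) / 36)]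
  have q3 : -2 / 40 * n ^ 2 + 2 / 720 * (t * K * (y * n)) - 2 / 12960 * (t * K * y) ^ 2 ≤ 0 := by
    nlinarith [sq_nonneg (n - (t * K * y) / 36)]
  have r1 : -4 * (nu * t / 40) * a ≤ 4 * (nu * t / 40) * (K * (y * n)) := by
    have : 0 ≤ nu * t / 40 := by positivity
    nlinarith
  have r2 : nu * (2 * t) / 720 * a ≤ nu * (2 * t) / 720 * (K * (y * n)) := by
    gcongr
  have r3 : nu * t ^ 2 / 720 * (2 * nu) * b ≤ nu * t ^ 2 / 720 * (2 * nu) * (K * (m * z)) := by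
    gcongr
  have r4 : -(nu * t ^ 2 / 720 * (2 * nu * K ^ 2)) * a ≤
      nu * t ^ 2 / 720 * (2 * nu * K ^ 2) * (K * (y * n)) := by
    have : 0 ≤ nu * t ^ 2 / 720 * (2 * nu * K ^ 2) := by positivity
    nlinarith
  -- The Hardy inequality enters here: it bounds the energy by a multiple of `2y² + 4d²`, the
  -- combination that the dilation term damps.
  have r5 : nu * (3 * t ^ 2) * K ^ 2 / 12960 * (y ^ 2 + 2 * (K ^ 2 * g ^ 2 + d ^ 2)) ≤
      nu * (3 * t ^ 2) * K ^ 2 / 12960 * (3 * (2 * y ^ 2 + 4 * d ^ 2)) := by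
    have : 0 ≤ nu * (3 * t ^ 2) * K ^ 2 / 12960 := by positivity
    refine mul_le_mul_of_nonneg_left ?_ this
    nlinarith [sq_nonneg y, sq_nonneg d]
  have s1 := mul_nonpos_of_nonneg_of_nonpos hnu q1
  have s2 := mul_nonpos_of_nonneg_of_nonpos (show 0 ≤ nu ^ 2 * t by positivity) q2
  have s3 := mul_nonpos_of_nonneg_of_nonpos (show 0 ≤ nu ^ 2 * t * K ^ 2 by positivity) q3
  have s4 : 0 ≤ nu * K ^ 2 * f ^ 2 := by positivity
  have s5 : 0 ≤ nu * t ^ 3 * K ^ 2 / 12960 * (2 * nu) * f ^ 2 := by positivity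
  linear_combination s1 + s2 + s3 + r1 + r2 + r3 + r4 + r5 + 2 * s4 + s5

namespace IsModeTriple

theorem rp_negLap_self (hM : IsModeTriple ι D Y G k) (v : V) :
    rp ι (negLap D v) v = ‖ι (D v)‖ ^ 2 := by
  rw [rp_comm, rp_negLap_right, hM.rp_D_D_self, neg_neg]

theorem rp_dilation_self (hM : IsModeTriple ι D Y G k) (v : V) :
    rp ι (dilation D Y v) v = sp ι (Y v) (D v) := by
  rw [rp_comm, rp_dilation_right, rp_I_right, hM.comm, sp_add_right, sp_add_right, sp_self,
    ← hM.sp_Y]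
  ring

theorem rp_energyOp_self (hM : IsModeTriple ι D Y G k) (v : V) :
    rp ι (energyOp Y G v) v =
      ‖ι (Y v)‖ ^ 2 + 2 * (k ^ 2 * ‖ι (G v)‖ ^ 2 + ‖ι (D (G v))‖ ^ 2) := by
  have e : energyOp Y G v = Y (Y v) + ((2 : ℝ) : ℂ) • G v := by simp [energyOp]
  rw [e, rp_add_left, hM.rp_Y, rp_self, rp_comm, rp_smul_right, rp_comm v, hM.rp_G_self]

theorem hypoDeriv_nonpos (hM : IsModeTriple ι D Y G k) (hnu : 0 ≤ nu) {t : ℝ} (ht : 0 ≤ t)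
    (v : V) : hypoDeriv ι D Y G nu k t v ≤ 0 := by
  have hH := hM.sq_norm_G_le v
  have b1 : |k * sp ι (Y v) (D v)| ≤ |k| * (‖ι (Y v)‖ * ‖ι (D v)‖) := by
    rw [abs_mul]; exact mul_le_mul_of_nonneg_left (abs_sp_le _ _) (abs_nonneg _)
  have b2 : |k * sp ι (D (D v)) (Y (D v))| ≤ |k| * (‖ι (D (D v))‖ * ‖ι (Y (D v))‖) := by
    rw [abs_mul]; exact mul_le_mul_of_nonneg_left (abs_sp_le _ _) (abs_nonneg _)
  rw [hypoDeriv, hM.rp_negLap_self, hM.rp_dilation_self, hM.rp_energyOp_self,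
    rp_comm v, rp_comm (negLap D v), rp_comm (dilation D Y v), rp_comm (energyOp Y G v),
    rp_negLap_right, rp_dilation_right, energyOp_apply, hM.rp_modeOp_self, hM.rp_modeOp_D_D,
    hM.sp_modeOp_dilation, hM.rp_modeOp_energy]
  have hk : k ^ 2 = |k| ^ 2 := (sq_abs k).symm
  have hk : |k| ^ 2 = k ^ 2 := sq_abs k
  have := hypo_quadratic_nonpos (f := ‖ι v‖) (g := ‖ι (G v)‖)
    (d := ‖ι (D (G v))‖) hnu ht b1 b2 (by rw [hk]; exact hH)
  rw [hk] at this
  refine le_trans (le_of_eq ?_) this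
  ring

/-- The weights are geometric, `1/40`, `1/(40·18)` and `1/(40·18²)`. Half of the derivative term and
half of the weighted term combine with the worst cross term into the perfect square `(‖Dv‖ -
t|k|‖Yv‖/18)² / 80`; the other halves remain on the left. -/
theorem le_hypo (hM : IsModeTriple ι D Y G k) (hnu : 0 ≤ nu) {t : ℝ} (ht : 0 ≤ t) (v : V) :
    ‖ι v‖ ^ 2 + nu * t * (‖ι (D v)‖ ^ 2 / 80 + (t * |k| * ‖ι (Y v)‖) ^ 2 / 25920)
      ≤ hypo ι D Y G nu k t v := by
  rw [hypo, rp_self, hM.rp_negLap_self, hM.rp_dilation_self, hM.rp_energyOp_self]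
  have b1 : |k * sp ι (Y v) (D v)| ≤ |k| * (‖ι (Y v)‖ * ‖ι (D v)‖) := by
    rw [abs_mul]; exact mul_le_mul_of_nonneg_left (abs_sp_le _ _) (abs_nonneg _)
  obtain ⟨b1l, b1u⟩ := abs_le.1 b1
  have q1 : 0 ≤ ‖ι (D v)‖ ^ 2 / 80 - (t * |k| * (‖ι (Y v)‖ * ‖ι (D v)‖)) / 720
      + (t * |k| * ‖ι (Y v)‖) ^ 2 / 25920 := by
    nlinarith [sq_nonneg (‖ι (D v)‖ - (t * |k| * ‖ι (Y v)‖) / 18)]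
  have q2 := mul_nonneg (mul_nonneg hnu ht) q1
  have q3 : -(nu * t ^ 2 / 720 * (|k| * (‖ι (Y v)‖ * ‖ι (D v)‖))) ≤
      nu * t ^ 2 / 720 * (k * sp ι (Y v) (D v)) := by
    rw [← mul_neg]; gcongr
  have q4 : 0 ≤ nu * t ^ 3 * k ^ 2 / 12960 * (2 * (k ^ 2 * ‖ι (G v)‖ ^ 2 + ‖ι (D (G v))‖ ^ 2)) := by
    positivity
  have hk : |k| ^ 2 = k ^ 2 := sq_abs k
  have e : (t * |k| * ‖ι (Y v)‖) ^ 2 = t ^ 2 * k ^ 2 * ‖ι (Y v)‖ ^ 2 := by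
    rw [mul_pow, mul_pow, hk]
  rw [e] at q2 ⊢
  nlinarith

/-- Heisenberg's uncertainty inequality. It converts control of `Yv` and `Dv` into decay of `v`. -/
theorem sq_norm_le (hM : IsModeTriple ι D Y G k) (v : V) :
    ‖ι v‖ ^ 2 ≤ 2 * (‖ι (Y v)‖ * ‖ι (D v)‖) := by
  have a1 := hM.rp_Y_D_self v
  have a2 := (abs_le.1 (abs_rp_le (ι := ι) (Y v) (D v))).1
  linarith

/-- By the uncertainty inequality the factor `t |k| ‖v‖²` is dominated by the geometric mean of the
terms weighted `ν t` and `ν t³` in the functional. -/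
theorem decay_of_hypo (hM : IsModeTriple ι D Y G k) (hnu : 0 ≤ nu) {t : ℝ} (ht : 0 ≤ t) (v : V) :
    nu * |k| * t ^ 2 * ‖ι v‖ ^ 2 ≤ 1440 * hypo ι D Y G nu k t v := by
  have h1 := hM.le_hypo hnu ht v
  have h2 : nu * |k| * t ^ 2 * ‖ι v‖ ^ 2 ≤
      nu * t * (t * |k| * (2 * (‖ι (Y v)‖ * ‖ι (D v)‖))) := by
    calc nu * |k| * t ^ 2 * ‖ι v‖ ^ 2 = nu * t * (t * |k| * ‖ι v‖ ^ 2) := by ring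
      _ ≤ _ := by gcongr; exact hM.sq_norm_le v
  have h3 : t * |k| * (2 * (‖ι (Y v)‖ * ‖ι (D v)‖)) ≤
      1440 * (‖ι (D v)‖ ^ 2 / 80 + (t * |k| * ‖ι (Y v)‖) ^ 2 / 25920) := by
    nlinarith [sq_nonneg (‖ι (D v)‖ - (t * |k| * ‖ι (Y v)‖) / 18)]
  have h4 := mul_le_mul_of_nonneg_left h3 (mul_nonneg hnu ht)
  nlinarith [sq_nonneg ‖ι v‖]

theorem weight_of_hypo (hM : IsModeTriple ι D Y G k) (hnu : 0 ≤ nu) {t : ℝ} (ht : 0 ≤ t) (v : V) :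
    nu * k ^ 2 * t ^ 3 * ‖ι (Y v)‖ ^ 2 ≤ 25920 * hypo ι D Y G nu k t v := by
  have h1 := hM.le_hypo hnu ht v
  have e : nu * k ^ 2 * t ^ 3 * ‖ι (Y v)‖ ^ 2 =
      25920 * (nu * t * ((t * |k| * ‖ι (Y v)‖) ^ 2 / 25920)) := by
    rw [← sq_abs k]; ring
  have h2 : 0 ≤ nu * t * (‖ι (D v)‖ ^ 2 / 80) := by positivity
  rw [e]
  nlinarith [sq_nonneg ‖ι v‖]

/-- Separation: `D²`, `Y²` and `YD` are controlled by the mode operator. -/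
theorem exists_separation (hM : IsModeTriple ι D Y G k) (hnu : 0 < nu) (hk : k ≠ 0) :
    ∃ C : ℝ, 0 ≤ C ∧ ∀ v, ‖ι (D (D v))‖ ≤ C * (‖ι (modeOp D Y G nu k v)‖ + ‖ι v‖) ∧
      ‖ι (Y (Y v))‖ ≤ C * (‖ι (modeOp D Y G nu k v)‖ + ‖ι v‖) ∧
      ‖ι (Y (D v))‖ ≤ C * (‖ι (modeOp D Y G nu k v)‖ + ‖ι v‖) ∧
      ‖ι (G v)‖ ≤ C * (‖ι (modeOp D Y G nu k v)‖ + ‖ι v‖) := by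
  have hk2 : 0 < k ^ 2 := by positivity
  have hK : 0 < |k| := abs_pos.2 hk
  have hmu : 0 < min nu |k| := lt_min hnu hK
  refine ⟨2 / min nu |k| * (1 + 2 / |k| + |k| + nu) + 1 + 1 / k ^ 2, by positivity, fun v => ?_⟩
  have hG : k ^ 2 * ‖ι (G v)‖ ≤ ‖ι v‖ := by
    rcases eq_or_lt_of_le (norm_nonneg (ι (G v))) with h0 | h0
    · rw [← h0, mul_zero]; positivity
    · refine le_of_mul_le_mul_right ?_ h0
      have a1 := hM.rp_G_self v
      have a2 := (abs_le.1 (abs_rp_le (ι := ι) (G v) v)).2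
      nlinarith [sq_nonneg ‖ι (D (G v))‖]
  -- The operator is paired with `D²v` and with `i Y²v`. The first isolates `ν ‖D²v‖²`, the second
  -- `k ‖Y²v‖²`; both leave only the cross term `Im⟨Yv, Dv⟩` and terms of lower order.
  have h1 := hM.rp_modeOp_D_D (nu := nu) v
  have h2 := rp_modeOp (ι := ι) (D := D) (Y := Y) (G := G) (k := k) (nu := nu) v
    (Complex.I • Y (Y v))
  rw [sp_I_right, sp_I_right, rp_I_right, rp_I_right, rp_I_right, rp_self, ← hM.sp_Y v, sp_self,
    hM.sp_D_D_Y_Y] at h2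
  have h3 := hM.rp_D_D_Y_Y v
  have i1 := (abs_le.1 (abs_rp_le (ι := ι) (modeOp D Y G nu k v) (D (D v)))).2
  have i2 := abs_le.1 (abs_sp_le (ι := ι) (modeOp D Y G nu k v) (Y (Y v)))
  have i3 := abs_le.1 (abs_rp_le (ι := ι) (G v) (Y (Y v)))
  have i4 := abs_le.1 (abs_sp_le (ι := ι) (Y v) (D v))
  have i5 := (abs_le.1 (abs_rp_le (ι := ι) (D (D v)) (Y (Y v)))).1
  have i6 : ‖ι (Y v)‖ ^ 2 ≤ ‖ι v‖ * ‖ι (Y (Y v))‖ := by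
    rw [← rp_self, hM.rp_Y]
    exact (le_abs_self _).trans (abs_rp_le _ _)
  have i7 : ‖ι (D v)‖ ^ 2 ≤ ‖ι v‖ * ‖ι (D (D v))‖ := by
    have a1 := hM.rp_D_D_self v
    have a2 := (abs_le.1 (abs_rp_le (ι := ι) v (D (D v)))).1
    linarith
  have hkJ : |k * sp ι (Y v) (D v)| ≤ |k| * (‖ι (Y v)‖ * ‖ι (D v)‖) := by
    rw [abs_mul]; exact mul_le_mul_of_nonneg_left (abs_sp_le _ _) (abs_nonneg _)
  have hkJ := abs_le.1 hkJ
  have hGk : |k| * ‖ι (G v)‖ ≤ ‖ι v‖ / |k| := by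
    rw [le_div_iff₀ hK]
    calc |k| * ‖ι (G v)‖ * |k| = |k| ^ 2 * ‖ι (G v)‖ := by ring
      _ ≤ _ := by rw [sq_abs]; exact hG
  have p0 := norm_nonneg (ι v)
  have p1 := norm_nonneg (ι (Y v))
  have p2 := norm_nonneg (ι (D v))
  have p3 := norm_nonneg (ι (D (D v)))
  have p4 := norm_nonneg (ι (Y (Y v)))
  have p5 := norm_nonneg (ι (modeOp D Y G nu k v))
  -- Interpolation makes the cross term linear in the second order quantities, hence absorbable by
  -- their squares.
  have j0 : ‖ι (Y v)‖ * ‖ι (D v)‖ ≤ ‖ι v‖ * (‖ι (D (D v))‖ + ‖ι (Y (Y v))‖) / 2 := by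
    refine abs_le_of_sq_le_sq' ?_ (by positivity) |>.2
    have := mul_le_mul i6 i7 (by positivity) (by positivity)
    nlinarith [mul_nonneg (sq_nonneg ‖ι v‖) (sq_nonneg (‖ι (D (D v))‖ - ‖ι (Y (Y v))‖))]
  have j1 : nu * ‖ι (D (D v))‖ ^ 2 ≤ ‖ι (modeOp D Y G nu k v)‖ * ‖ι (D (D v))‖
      + |k| * (‖ι v‖ * (‖ι (D (D v))‖ + ‖ι (Y (Y v))‖)) := by
    have := mul_le_mul_of_nonneg_left j0 hK.le
    linarith only [mul_nonneg (mul_nonneg hnu.le hk2.le) (sq_nonneg ‖ι (D v)‖), this, h1, i1,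
      hkJ.1]
  have j2 : |k| * ‖ι (Y (Y v))‖ ^ 2 ≤ ‖ι (modeOp D Y G nu k v)‖ * ‖ι (Y (Y v))‖
      + 2 * (‖ι v‖ / |k|) * ‖ι (Y (Y v))‖
      + nu * (‖ι v‖ * (‖ι (D (D v))‖ + ‖ι (Y (Y v))‖)) := by
    have a1 := mul_le_mul_of_nonneg_left j0 hnu.le
    have a2 := mul_le_mul_of_nonneg_right hGk p4
    have a3 : |k * rp ι (G v) (Y (Y v))| ≤ |k| * ‖ι (G v)‖ * ‖ι (Y (Y v))‖ := by
      rw [abs_mul, mul_assoc]; exact mul_le_mul_of_nonneg_left (abs_rp_le _ _) (abs_nonneg _)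
    have a3 := abs_le.1 a3
    have a4 : nu * |sp ι (Y v) (D v)| ≤ nu * (‖ι (Y v)‖ * ‖ι (D v)‖) :=
      mul_le_mul_of_nonneg_left (abs_sp_le _ _) hnu.le
    have a5 := mul_le_mul_of_nonneg_left i4.1 hnu.le
    have a6 := mul_le_mul_of_nonneg_left i4.2 hnu.le
    rcases abs_cases k with ⟨hc, _⟩ | ⟨hc, _⟩
    · have e : |k| * ‖ι (Y (Y v))‖ ^ 2 = k * ‖ι (Y (Y v))‖ ^ 2 := by rw [hc]
      linarith only [e, h2, a3.1, a2, a5, a6, a1, i2.1, i2.2]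
    · have e : |k| * ‖ι (Y (Y v))‖ ^ 2 = -(k * ‖ι (Y (Y v))‖ ^ 2) := by rw [hc, neg_mul]
      linarith only [e, h2, a3.2, a2, a5, a6, a1, i2.1, i2.2]
  have hS : ‖ι (D (D v))‖ + ‖ι (Y (Y v))‖ ≤
      2 / min nu |k| * (1 + 2 / |k| + |k| + nu) * (‖ι (modeOp D Y G nu k v)‖ + ‖ι v‖) := by
    set a := ‖ι (modeOp D Y G nu k v)‖
    set f := ‖ι v‖
    set m := ‖ι (D (D v))‖
    set w := ‖ι (Y (Y v))‖
    have c1 : min nu |k| * m ^ 2 ≤ nu * m ^ 2 :=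
      mul_le_mul_of_nonneg_right (min_le_left _ _) (sq_nonneg _)
    have c2 : min nu |k| * w ^ 2 ≤ |k| * w ^ 2 :=
      mul_le_mul_of_nonneg_right (min_le_right _ _) (sq_nonneg _)
    have c3 : min nu |k| * (m + w) ^ 2 ≤ 2 * (min nu |k| * m ^ 2 + min nu |k| * w ^ 2) := by
      nlinarith [mul_nonneg hmu.le (sq_nonneg (m - w))]
    have c4 : min nu |k| * (m + w) ^ 2 ≤
        (2 * ((1 + 2 / |k| + |k| + nu) * (a + f))) * (m + w) := by
      have d : 0 ≤ f * (m + w) + (2 / |k| + |k| + nu) * a * (m + w) + 2 * (f / |k|) * m := by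
        positivity
      linear_combination c3 + 2 * c1 + 2 * c2 + 2 * j1 + 2 * j2 + 2 * d
    rcases eq_or_lt_of_le (add_nonneg p3 p4) with h0 | h0
    · rw [← h0]; positivity
    · rw [div_mul_eq_mul_div, div_mul_eq_mul_div, le_div_iff₀ hmu]
      refine le_of_mul_le_mul_right ?_ h0
      linarith only [c4]
  -- The mixed term follows from `Re⟨D²v, Y²v⟩ = ‖v‖² - ‖YDv‖²`.
  have hz : ‖ι (Y (D v))‖ ≤ ‖ι v‖ + (‖ι (D (D v))‖ + ‖ι (Y (Y v))‖) := by
    refine abs_le_of_sq_le_sq' ?_ (by positivity) |>.2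
    linarith only [mul_nonneg p3 p4, mul_nonneg p0 p3, mul_nonneg p0 p4, sq_nonneg ‖ι (D (D v))‖,
      sq_nonneg ‖ι (Y (Y v))‖, h3, i5]
  have hg : ‖ι (G v)‖ ≤ 1 / k ^ 2 * (‖ι (modeOp D Y G nu k v)‖ + ‖ι v‖) := by
    rw [div_mul_eq_mul_div, le_div_iff₀ hk2]; linarith only [hG, p5]
  have e : ∀ a b c s : ℝ, (a + b + c) * s = a * s + b * s + c * s := fun a b c s => by ring
  have t1 : 0 ≤ 1 / k ^ 2 * (‖ι (modeOp D Y G nu k v)‖ + ‖ι v‖) := by positivity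
  have t2 : 0 ≤ 2 / min nu |k| * (1 + 2 / |k| + |k| + nu) *
    (‖ι (modeOp D Y G nu k v)‖ + ‖ι v‖) := by positivity
  rw [e, one_mul]
  refine ⟨?_, ?_, ?_, ?_⟩
  · linarith only [hS, p4, t1, p5, p0]
  · linarith only [hS, p3, t1, p5, p0]
  · linarith only [hS, hz, t1, p5, p0]
  · linarith only [hg, t2, p5, p0]

end IsModeTriple

end ModeAlgebra

/-! ### From the core to solution curves in the closed graph. -/

section Curve

variable {V : Type*} [AddCommGroup V] [Module ℂ V]
  {X : Type*} [NormedAddCommGroup X] [InnerProductSpace ℂ X]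
  {ι : V →ₗ[ℂ] X} {D Y G : V →ₗ[ℂ] V} {k nu : ℝ}

/-- The closed graph of an operator `A : V → V`, seen in `X × X` through `ι`. -/
def closedGraph (ι : V →ₗ[ℂ] X) (A : V →ₗ[ℂ] V) : Submodule ℂ (X × X) :=
  (LinearMap.range (ι.prod (ι ∘ₗ A))).topologicalClosure

/-- The embedding of the core into the closed graph. -/
def toGraph (ι : V →ₗ[ℂ] X) (A : V →ₗ[ℂ] V) : V →ₗ[ℂ] closedGraph ι A :=
  (ι.prod (ι ∘ₗ A)).codRestrict _ fun v => Submodule.le_topologicalClosure _ ⟨v, rfl⟩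

variable {A : V →ₗ[ℂ] V}

theorem toGraph_fst (v : V) : (toGraph ι A v : X × X).1 = ι v := rfl
theorem toGraph_snd (v : V) : (toGraph ι A v : X × X).2 = ι (A v) := rfl

theorem norm_toGraph (v : V) : ‖ι (A v)‖ + ‖ι v‖ ≤ 2 * ‖toGraph ι A v‖ := by
  have h1 : ‖ι v‖ ≤ ‖toGraph ι A v‖ := norm_fst_le (toGraph ι A v : X × X)
  have h2 : ‖ι (A v)‖ ≤ ‖toGraph ι A v‖ := norm_snd_le (toGraph ι A v : X × X)
  linarith

theorem mem_closedGraph_iff {p : X × X} : p ∈ closedGraph ι A ↔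
    ∀ ε > 0, ∃ v, ‖ι v - p.1‖ < ε ∧ ‖ι (A v) - p.2‖ < ε := by
  rw [closedGraph, ← SetLike.mem_coe, Submodule.topologicalClosure_coe, Metric.mem_closure_iff]
  refine forall₂_congr fun ε _ => ⟨?_, ?_⟩
  · rintro ⟨_, ⟨v, rfl⟩, hv⟩
    rw [dist_comm, dist_eq_norm] at hv
    exact ⟨v, (norm_fst_le _).trans_lt hv, (norm_snd_le _).trans_lt hv⟩
  · rintro ⟨v, h1, h2⟩
    refine ⟨_, ⟨v, rfl⟩, ?_⟩
    rw [dist_comm, dist_eq_norm]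
    exact max_lt h1 h2

theorem denseRange_toGraph : DenseRange (toGraph ι A) := by
  rintro ⟨p, hp⟩
  rw [Metric.mem_closure_iff]
  intro ε hε
  obtain ⟨v, h1, h2⟩ := mem_closedGraph_iff.1 hp ε hε
  refine ⟨_, ⟨v, rfl⟩, ?_⟩
  rw [dist_comm, dist_eq_norm]
  exact max_lt h1 h2

variable [CompleteSpace X] in
/-- The extension to the closed graph of an operator dominated by `A`. -/
def graphExt (ι : V →ₗ[ℂ] X) (A Q : V →ₗ[ℂ] V) : closedGraph ι A →L[ℂ] X :=
  (ι ∘ₗ Q).extendOfNorm (toGraph ι A)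

/-- Symmetric operators dominated by `A`. -/
structure IsGraphSymm (ι : V →ₗ[ℂ] X) (A Q : V →ₗ[ℂ] V) : Prop where
  bound : ∃ C, 0 ≤ C ∧ ∀ v, ‖ι (Q v)‖ ≤ C * (‖ι (A v)‖ + ‖ι v‖)
  symm : ∀ u v, rp ι (Q u) v = rp ι (Q v) u

namespace IsGraphSymm

variable {Q : V →ₗ[ℂ] V}

variable [CompleteSpace X] in
theorem ext_apply (hQ : IsGraphSymm ι A Q) (v : V) :
    graphExt ι A Q (toGraph ι A v) = ι (Q v) := by
  obtain ⟨C, hC, h⟩ := hQ.bound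
  refine LinearMap.extendOfNorm_eq denseRange_toGraph ⟨C * 2, fun v => ?_⟩ v
  rw [mul_assoc]
  exact (h v).trans (mul_le_mul_of_nonneg_left (norm_toGraph v) hC)

variable [CompleteSpace X] in
theorem ext_symm (hQ : IsGraphSymm ι A Q) (w w' : closedGraph ι A) :
    (inner ℂ (graphExt ι A Q w) (w' : X × X).1).re =
      (inner ℂ (graphExt ι A Q w') (w : X × X).1).re := by
  refine DenseRange.induction_on₂ (e := toGraph ι A) (p := fun w w' =>
    (inner ℂ (graphExt ι A Q w) (w' : X × X).1).re =
      (inner ℂ (graphExt ι A Q w') (w : X × X).1).re) denseRange_toGraph ?_ ?_ w w'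
  · exact isClosed_eq (by fun_prop) (by fun_prop)
  · intro a b
    simp only [hQ.ext_apply, toGraph_fst]
    exact hQ.symm a b

variable [CompleteSpace X] in
-- The curve is only continuous in the graph norm, and differentiable only in `X`. Symmetry rewrites
-- the difference quotient of the quadratic form as `Re⟨Q w(s) + Q w(t), slope⟩`, so nothing more
-- than continuity of `Q w` is needed.
theorem hasDerivWithinAt (hQ : IsGraphSymm ι A Q) {w : ℝ → closedGraph ι A} {t : ℝ}
    (hw : ContinuousWithinAt w (Ici t) t)
    (hd : HasDerivWithinAt (fun s => (w s : X × X).1) (w t : X × X).2 (Ici t) t) :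
    HasDerivWithinAt (fun s => (inner ℂ (graphExt ι A Q (w s)) (w s : X × X).1).re)
      (2 * (inner ℂ (graphExt ι A Q (w t)) (w t : X × X).2).re) (Ici t) t := by
  rw [hasDerivWithinAt_iff_tendsto_slope] at hd ⊢
  have h1 : Tendsto (fun s => (inner ℂ (graphExt ι A Q (w s) + graphExt ι A Q (w t))
      (slope (fun s => (w s : X × X).1) t s)).re) (𝓝[Ici t \ {t}] t)
      (𝓝 (inner ℂ (graphExt ι A Q (w t) + graphExt ι A Q (w t)) (w t : X × X).2).re) := by
    refine (Complex.continuous_re.tendsto _).comp (Tendsto.inner (Tendsto.add ?_ ?_) hd)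
    · exact ((graphExt ι A Q).continuous.tendsto _).comp
        (hw.mono_left (nhdsWithin_mono _ sdiff_subset))
    · exact tendsto_const_nhds
  rw [← two_smul ℝ, ← Complex.coe_smul, inner_smul_left, Complex.conj_ofReal,
    Complex.re_ofReal_mul] at h1
  refine h1.congr fun s => ?_
  have h2 := hQ.ext_symm (w s) (w t)
  rw [slope_def_module, slope_def_module, ← Complex.coe_smul, inner_smul_right,
    Complex.re_ofReal_mul, inner_add_left, inner_sub_right, inner_sub_right, smul_eq_mul]
  simp only [Complex.add_re, Complex.sub_re]
  rw [h2]
  ring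

end IsGraphSymm

/-- The separation estimate is what makes the unbounded weights of `hypo` continuous in the graph
norm; the next two lemmas serve the same purpose. -/
theorem IsModeTriple.isGraphSymm_negLap (hM : IsModeTriple ι D Y G k) (hnu : 0 < nu)
    (hk : k ≠ 0) : IsGraphSymm ι (modeOp D Y G nu k) (negLap D) := by
  obtain ⟨C, hC, h⟩ := hM.exists_separation hnu hk
  refine ⟨⟨C, hC, fun v => ?_⟩, fun u v => ?_⟩
  · simpa [negLap] using (h v).1
  · rw [rp_comm, rp_negLap_right, rp_comm _ u, rp_negLap_right, ← hM.rp_D, rp_comm, hM.rp_D]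

theorem IsModeTriple.isGraphSymm_dilation (hM : IsModeTriple ι D Y G k) (hnu : 0 < nu)
    (hk : k ≠ 0) : IsGraphSymm ι (modeOp D Y G nu k) (dilation D Y) := by
  obtain ⟨C, hC, h⟩ := hM.exists_separation hnu hk
  refine ⟨⟨2 * C + 1, by positivity, fun v => ?_⟩, fun u v => ?_⟩
  · have e : ι (dilation D Y v) = (-(1 / 2 : ℂ)) • Complex.I •
        ((2 : ℂ) • ι (Y (D v)) + ι v) := by
      have : Y (D v) + D (Y v) = (2 : ℂ) • Y (D v) + v := by
        rw [hM.comm, two_smul]; abel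
      rw [← map_smul, ← map_add, ← this, ← map_smul, ← map_smul]
      rfl
    have h1 : ‖ι (dilation D Y v)‖ ≤ 2 * ‖ι (Y (D v))‖ + ‖ι v‖ := by
      rw [e, norm_smul, norm_smul, Complex.norm_I]
      have := norm_add_le ((2 : ℂ) • ι (Y (D v))) (ι v)
      rw [norm_smul] at this
      norm_num at this ⊢
      linarith [norm_nonneg (ι v), norm_nonneg (ι (Y (D v)))]
    have := (h v).2.2.1
    have p := norm_nonneg (ι (modeOp D Y G nu k v))
    linarith
  · rw [rp_comm, rp_dilation_right, rp_comm _ u, rp_dilation_right, rp_I_right, rp_I_right,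
      sp_add_right, sp_add_right, ← hM.sp_Y v, sp_comm (Y v), hM.sp_D u, sp_comm v (D (Y u)),
      hM.sp_D (Y u), hM.sp_Y u (D v)]
    have := hM.sp_D u (Y v)
    linarith

theorem IsModeTriple.isGraphSymm_energyOp (hM : IsModeTriple ι D Y G k) (hnu : 0 < nu)
    (hk : k ≠ 0) : IsGraphSymm ι (modeOp D Y G nu k) (energyOp Y G) := by
  obtain ⟨C, hC, h⟩ := hM.exists_separation hnu hk
  refine ⟨⟨3 * C, by positivity, fun v => ?_⟩, fun u v => ?_⟩
  · rw [energyOp_apply, map_add, map_smul]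
    refine (norm_add_le _ _).trans ?_
    rw [norm_smul]
    norm_num
    linarith [(h v).2.1, (h v).2.2.2]
  · have e : ∀ w, energyOp Y G w = Y (Y w) + ((2 : ℝ) : ℂ) • G w := fun w => by simp [energyOp]
    have hG : rp ι u (G v) = rp ι v (G u) := by
      have a1 := hM.rp_G (G v) u
      have a2 := hM.rp_G (G u) v
      have a3 := hM.rp_D (G v) (D (G u))
      have a4 := hM.rp_D (G u) (D (G v))
      have a5 := rp_comm (ι := ι) (D (G u)) (D (G v))
      have a6 := rp_comm (ι := ι) (G u) (G v)
      rw [rp_comm u, rp_comm v, a1, a2, a6]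
      linarith
    rw [e, e, rp_add_left, rp_add_left, hM.rp_Y, hM.rp_Y, rp_comm _ v, rp_comm (_ • G v) u,
      rp_smul_right, rp_smul_right, hG, ← hM.rp_Y, rp_comm (Y u), hM.rp_Y v, hM.rp_Y (Y v), hM.rp_Y v]

variable [CompleteSpace X] in
/-- Along a curve in the closed graph, the hypocoercivity functional does not increase; the bound
is stated for approximations in the core. -/
theorem IsModeTriple.exists_approx_of_curve (hM : IsModeTriple ι D Y G k) (hnu : 0 < nu)
    (hk : k ≠ 0) {u h : ℝ → X}
    (hc : ∀ t, 0 ≤ t → (u t, h t) ∈ closedGraph ι (modeOp D Y G nu k))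
    (hu : ContinuousOn u (Ici 0)) (hh : ContinuousOn h (Ici 0))
    (hd : ∀ t, 0 ≤ t → HasDerivWithinAt u (h t) (Ici t) t) {t ε : ℝ} (ht : 0 ≤ t) (hε : 0 < ε) :
    ∃ v, ‖ι v - u t‖ < ε ∧ hypo ι D Y G nu k t v < ‖u 0‖ ^ 2 + ε := by
  set A := modeOp D Y G nu k with hA
  have s1 : IsGraphSymm ι A (negLap D) := hM.isGraphSymm_negLap hnu hk
  have s2 : IsGraphSymm ι A (dilation D Y) := hM.isGraphSymm_dilation hnu hk
  have s3 : IsGraphSymm ι A (energyOp Y G) := hM.isGraphSymm_energyOp hnu hk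
  let q : (V →ₗ[ℂ] V) → closedGraph ι A → ℝ :=
    fun Q w => (inner ℂ (graphExt ι A Q w) (w : X × X).1).re
  let dq : (V →ₗ[ℂ] V) → closedGraph ι A → ℝ :=
    fun Q w => 2 * (inner ℂ (graphExt ι A Q w) (w : X × X).2).re
  have hqc : ∀ Q, Continuous (q Q) := fun Q => by fun_prop
  have hdqc : ∀ Q, Continuous (dq Q) := fun Q => by fun_prop
  let E : ℝ → closedGraph ι A → ℝ := fun t w =>
    ‖(w : X × X).1‖ ^ 2 + nu * t / 40 * q (negLap D) w + nu * t ^ 2 * k / 720 * q (dilation D Y) w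
      + nu * t ^ 3 * k ^ 2 / 12960 * q (energyOp Y G) w
  let E' : ℝ → closedGraph ι A → ℝ := fun t w =>
    2 * (inner ℂ (w : X × X).2 (w : X × X).1).re
      + (nu / 40 * q (negLap D) w + nu * t / 40 * dq (negLap D) w)
      + (nu * (2 * t) * k / 720 * q (dilation D Y) w + nu * t ^ 2 * k / 720 * dq (dilation D Y) w)
      + (nu * (3 * t ^ 2) * k ^ 2 / 12960 * q (energyOp Y G) w
        + nu * t ^ 3 * k ^ 2 / 12960 * dq (energyOp Y G) w)
  have hEv : ∀ t v, E t (toGraph ι A v) = hypo ι D Y G nu k t v := fun t v => by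
    simp only [E, q, s1.ext_apply, s2.ext_apply, s3.ext_apply, toGraph_fst, hypo, rp_self]
    rfl
  have hE'v : ∀ t v, E' t (toGraph ι A v) = hypoDeriv ι D Y G nu k t v := fun t v => by
    simp only [E', q, dq, s1.ext_apply, s2.ext_apply, s3.ext_apply, toGraph_fst, toGraph_snd,
      hypoDeriv]
    rw [rp_comm v]
    rfl
  have hE'c : ∀ t, Continuous (E' t) := fun t => by fun_prop
  have hEc : ∀ t, Continuous (E t) := fun t => by fun_prop
  -- The derivative is continuous in the graph norm, so its sign passes from the core to the closed
  -- graph.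
  have hE'0 : ∀ t, 0 ≤ t → ∀ w, E' t w ≤ 0 := fun t ht w => by
    refine DenseRange.induction_on (e := toGraph ι A) (p := fun w => E' t w ≤ 0)
      denseRange_toGraph w (isClosed_le (hE'c t) continuous_const) fun v => ?_
    rw [hE'v]
    exact hM.hypoDeriv_nonpos hnu.le ht v
  -- Freezing the curve before time zero makes it continuous on the whole line.
  let w : ℝ → closedGraph ι A := fun s => ⟨(u (max s 0), h (max s 0)), hc _ (le_max_right _ _)⟩
  have hw0 : ∀ s, 0 ≤ s → (w s : X × X) = (u s, h s) := fun s hs => by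
    simp only [w, max_eq_left hs]
  have hwc : Continuous w := by
    have m : Continuous fun s : ℝ => max s 0 := by fun_prop
    refine Continuous.subtype_mk (Continuous.prodMk ?_ ?_) _
    · exact hu.comp_continuous m fun s => mem_Ici.2 (le_max_right _ _)
    · exact hh.comp_continuous m fun s => mem_Ici.2 (le_max_right _ _)
  have hwd : ∀ s, 0 ≤ s → HasDerivWithinAt (fun s => (w s : X × X).1) (w s : X × X).2 (Ici s) s :=
    fun s hs => by
      rw [hw0 s hs]
      refine (hd s hs).congr (fun r hr => ?_) ?_
      · rw [hw0 r (hs.trans hr)]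
      · rw [hw0 s hs]
  have hEd : ∀ s, 0 ≤ s → HasDerivWithinAt (fun s => E s (w s)) (E' s (w s)) (Ici s) s :=
    fun s hs => by
      have d1 := s1.hasDerivWithinAt hwc.continuousWithinAt (hwd s hs)
      have d2 := s2.hasDerivWithinAt hwc.continuousWithinAt (hwd s hs)
      have d3 := s3.hasDerivWithinAt hwc.continuousWithinAt (hwd s hs)
      have d0 := hasDerivWithinAt_norm_sq (hwd s hs)
      have c1 : HasDerivWithinAt (fun s : ℝ => nu * s / 40) (nu / 40) (Ici s) s := by
        simpa using (((hasDerivAt_id s).const_mul nu).div_const 40).hasDerivWithinAt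
      have c2 : HasDerivWithinAt (fun s : ℝ => nu * s ^ 2 * k / 720) (nu * (2 * s) * k / 720)
          (Ici s) s := by
        simpa using! ((((hasDerivAt_pow 2 s).const_mul nu).mul_const k).div_const 720).hasDerivWithinAt
      have c3 : HasDerivWithinAt (fun s : ℝ => nu * s ^ 3 * k ^ 2 / 12960)
          (nu * (3 * s ^ 2) * k ^ 2 / 12960) (Ici s) s := by
        simpa using!
          ((((hasDerivAt_pow 3 s).const_mul nu).mul_const (k ^ 2)).div_const 12960).hasDerivWithinAt
      exact ((d0.add (c1.mul d1)).add (c2.mul d2)).add (c3.mul d3)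
  have hcont : ContinuousOn (fun s => E s (w s)) (Icc 0 t) := by
    have : Continuous fun s => E s (w s) := by
      have := hwc
      fun_prop
    exact this.continuousOn
  have hle := image_le_of_deriv_right_le_deriv_boundary hcont (fun s hs => hEd s hs.1)
    (B := fun _ => ‖u 0‖ ^ 2) (B' := fun _ => 0) (by
      simp [E, hw0 0 le_rfl]) continuousOn_const (fun s _ => hasDerivWithinAt_const _ _ _)
    (fun s hs => hE'0 s hs.1 _) (show t ∈ Icc 0 t from ⟨ht, le_rfl⟩)
  have hopen : IsOpen {p : closedGraph ι A | ‖(p : X × X).1 - u t‖ < ε ∧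
      E t p < ‖u 0‖ ^ 2 + ε} :=
    by
    have h1 : Continuous fun p : closedGraph ι A => ‖(p : X × X).1 - u t‖ := by fun_prop
    exact (isOpen_lt h1 continuous_const).inter (isOpen_lt (hEc t) continuous_const)
  -- The bound holds for the extended functional at `w t`. By continuity it holds up to `ε` at a
  -- nearby element of the core, where the norms of `Yv` and `Dv` make sense.
  obtain ⟨v, hv⟩ := (denseRange_toGraph (ι := ι) (A := A)).exists_mem_open hopen ⟨w t, by
    refine ⟨?_, by linarith⟩
    rw [hw0 t ht]; simpa using hε⟩
  refine ⟨v, hv.1, ?_⟩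
  rw [← hEv]
  exact hv.2

end Curve

/-! ### Realization of the abstract mode on Schwartz functions of one variable. -/

section SchwartzModel

open SchwartzMap
open scoped SchwartzMap FourierTransform LineDeriv

/-- `L²(ℝ)`. -/
abbrev LR : Type := Lp ℂ 2 (volume : Measure ℝ)

/-- The embedding of the Schwartz space in `L²(ℝ)`. -/
def toL : 𝓢(ℝ, ℂ) →ₗ[ℂ] LR := (toLpCLM ℂ ℂ 2 (volume : Measure ℝ)).toLinearMap

theorem toL_apply (v : 𝓢(ℝ, ℂ)) : toL v = v.toLp 2 volume := rfl

theorem denseRange_toL : DenseRange toL :=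
  denseRange_toLpCLM (p := 2) (by norm_num)

theorem inner_toL (u v : 𝓢(ℝ, ℂ)) :
    inner ℂ (toL u) (toL v) = ∫ y, (starRingEnd ℂ) (u y) * v y := by
  refine (SchwartzMap.inner_toL2_toL2_eq u v volume).trans ?_
  simp [RCLike.inner_apply, mul_comm]

theorem norm_sq_toL (v : 𝓢(ℝ, ℂ)) : ‖toL v‖ ^ 2 = ∫ y, ‖v y‖ ^ 2 := by
  have h : ((‖toL v‖ ^ 2 : ℝ) : ℂ) = ((∫ y, ‖v y‖ ^ 2 : ℝ) : ℂ) := by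
    rw [← integral_complex_ofReal]
    have h1 := inner_self_eq_norm_sq_to_K (𝕜 := ℂ) (toL v)
    rw [inner_toL] at h1
    push_cast
    refine h1.symm.trans ?_
    refine integral_congr_ae (Eventually.of_forall fun y => ?_)
    simpa using Complex.conj_mul' (v y)
  exact_mod_cast h

/-- Differentiation on the Schwartz space. -/
def Dop : 𝓢(ℝ, ℂ) →ₗ[ℂ] 𝓢(ℝ, ℂ) := (derivCLM ℂ ℂ).toLinearMap

/-- Multiplication by a function on the Schwartz space. -/
def mulOp (m : ℝ → ℂ) : 𝓢(ℝ, ℂ) →ₗ[ℂ] 𝓢(ℝ, ℂ) := (smulLeftCLM ℂ m).toLinearMap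

/-- Multiplication by the coordinate on the Schwartz space. -/
def Yop : 𝓢(ℝ, ℂ) →ₗ[ℂ] 𝓢(ℝ, ℂ) := mulOp fun y => (y : ℂ)

/-- The Fourier symbol of `(k² - D²)⁻¹`. -/
def greenSymbol (k : ℝ) (ξ : ℝ) : ℂ := (((k ^ 2 + (2 * Real.pi * ξ) ^ 2)⁻¹ : ℝ) : ℂ)

/-- The Green operator `(k² - D²)⁻¹` (and `0` for `k = 0`). -/
def Gop (k : ℝ) : 𝓢(ℝ, ℂ) →ₗ[ℂ] 𝓢(ℝ, ℂ) :=
  if k = 0 then 0 else (fourierMultiplierCLM ℂ (greenSymbol k)).toLinearMap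

theorem Dop_apply (v : 𝓢(ℝ, ℂ)) (y : ℝ) : Dop v y = deriv v y := rfl

theorem mulOp_apply {m : ℝ → ℂ} (hm : m.HasTemperateGrowth) (v : 𝓢(ℝ, ℂ)) (y : ℝ) :
    mulOp m v y = m y * v y :=
  smulLeftCLM_apply_apply hm v y

theorem temperate_coe : Function.HasTemperateGrowth fun y : ℝ => (y : ℂ) :=
  Complex.ofRealCLM.hasTemperateGrowth

theorem Yop_apply (v : 𝓢(ℝ, ℂ)) (y : ℝ) : Yop v y = y * v y := mulOp_apply temperate_coe v y

theorem temperate_greenSymbol {k : ℝ} (hk : k ≠ 0) : (greenSymbol k).HasTemperateGrowth := by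
  have h1 := Function.hasTemperateGrowth_one_add_norm_sq_rpow (H := ℝ) (-1)
  have h2 : Function.HasTemperateGrowth fun ξ : ℝ => (2 * Real.pi / k) * ξ := by fun_prop
  have h3 : Function.HasTemperateGrowth fun ξ : ℝ =>
      (((k ^ 2)⁻¹ * (1 + ‖(2 * Real.pi / k) * ξ‖ ^ 2) ^ (-1 : ℝ) : ℝ) : ℂ) :=
    temperate_coe.comp ((Function.HasTemperateGrowth.const _).mul (h1.comp h2))
  convert h3 using 2 with ξ
  rw [greenSymbol, Real.rpow_neg_one, ← mul_inv, Real.norm_eq_abs, sq_abs]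
  congr 2
  field_simp

/-- The Fourier symbol of `D`. -/
def derivSymbol (ξ : ℝ) : ℂ := 2 * Real.pi * Complex.I * ξ

theorem temperate_derivSymbol : derivSymbol.HasTemperateGrowth :=
  (Function.HasTemperateGrowth.const _).mul temperate_coe

theorem Dop_eq_multiplier (v : 𝓢(ℝ, ℂ)) : Dop v = fourierMultiplierCLM ℂ derivSymbol v := by
  have h := lineDeriv_eq_fourierMultiplierCLM (1 : ℝ) v
  have e : Dop v = ∂_{(1 : ℝ)} v := by
    ext y
    rw [Dop_apply, lineDerivOp_apply_eq_fderiv]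
    exact (fderiv_apply_one_eq_deriv).symm
  have e2 : derivSymbol = fun ξ : ℝ => (2 * Real.pi * Complex.I : ℂ) • (inner ℝ ξ (1 : ℝ) : ℂ) := by
    ext ξ
    simp [derivSymbol]
  have h3 : Function.HasTemperateGrowth fun ξ : ℝ => (inner ℝ ξ (1 : ℝ) : ℂ) := by
    simpa using temperate_coe
  rw [e, h, e2]
  rw [← fourierMultiplierCLM_ofReal (𝕜 := ℂ)]
  · exact (congrArg (fun T => T v) (fourierMultiplierCLM_smul h3 (2 * Real.pi * Complex.I))).symm
  · fun_prop

theorem multiplier_smul {g : ℝ → ℂ} (hg : g.HasTemperateGrowth) (c : ℂ) (v : 𝓢(ℝ, ℂ)) :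
    fourierMultiplierCLM ℂ (c • g) v = c • fourierMultiplierCLM ℂ g v :=
  congrArg (fun T => T v) (fourierMultiplierCLM_smul hg c)

theorem multiplier_add {g₁ g₂ : ℝ → ℂ} (h₁ : g₁.HasTemperateGrowth) (h₂ : g₂.HasTemperateGrowth)
    (v : 𝓢(ℝ, ℂ)) : fourierMultiplierCLM ℂ (g₁ + g₂) v
      = fourierMultiplierCLM ℂ g₁ v + fourierMultiplierCLM ℂ g₂ v := by
  simp only [fourierMultiplierCLM_apply, smulLeftCLM_add h₁ h₂, add_apply]
  exact FourierTransform.fourierInv_add _ _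

theorem Gop_zero (v : 𝓢(ℝ, ℂ)) : Gop 0 v = 0 := by simp [Gop]

theorem Gop_neg (k : ℝ) : Gop (-k) = Gop k := by
  have : greenSymbol (-k) = greenSymbol k := by ext; simp [greenSymbol]
  simp [Gop, this]

theorem Gop_apply {k : ℝ} (hk : k ≠ 0) (v : 𝓢(ℝ, ℂ)) :
    Gop k v = fourierMultiplierCLM ℂ (greenSymbol k) v := by
  simp [Gop, hk]

theorem Dop_Gop (k : ℝ) (v : 𝓢(ℝ, ℂ)) : Dop (Gop k v) = Gop k (Dop v) := by
  rcases eq_or_ne k 0 with rfl | hk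
  · simp [Gop_zero]
  rw [Gop_apply hk, Gop_apply hk, Dop_eq_multiplier, Dop_eq_multiplier,
    fourierMultiplierCLM_fourierMultiplierCLM_apply temperate_derivSymbol
      (temperate_greenSymbol hk),
    fourierMultiplierCLM_fourierMultiplierCLM_apply (temperate_greenSymbol hk)
      temperate_derivSymbol, mul_comm]

theorem green_Gop {k : ℝ} (hk : k ≠ 0) (v : 𝓢(ℝ, ℂ)) :
    ((k ^ 2 : ℝ) : ℂ) • Gop k v - Dop (Dop (Gop k v)) = v := by
  have hg := temperate_greenSymbol hk
  have hd := temperate_derivSymbol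
  rw [Gop_apply hk, Dop_eq_multiplier, Dop_eq_multiplier,
    fourierMultiplierCLM_fourierMultiplierCLM_apply hd hg,
    fourierMultiplierCLM_fourierMultiplierCLM_apply hd (hd.mul hg), sub_eq_iff_eq_add,
    ← multiplier_smul hg]
  have h1 : fourierMultiplierCLM ℂ (fun _ : ℝ => (1 : ℂ)) v = v := by
    rw [fourierMultiplierCLM_const]; simp
  nth_rewrite 2 [← h1]
  rw [← multiplier_add (Function.HasTemperateGrowth.const _) (hd.mul (hd.mul hg))]
  congr 2
  ext ξ
  have hpos : (k ^ 2 + (2 * Real.pi * ξ) ^ 2 : ℂ) ≠ 0 := by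
    have : 0 < k ^ 2 + (2 * Real.pi * ξ) ^ 2 := by positivity
    exact_mod_cast this.ne'
  simp only [Pi.smul_apply, Pi.mul_apply, Pi.add_apply, greenSymbol, derivSymbol, smul_eq_mul]
  push_cast
  linear_combination mul_inv_cancel₀ hpos - (2 * Real.pi * ξ) ^ 2
    * (k ^ 2 + (2 * Real.pi * ξ) ^ 2 : ℂ)⁻¹ * Complex.I_sq

theorem Dop_skew (u v : 𝓢(ℝ, ℂ)) :
    inner ℂ (toL (Dop u)) (toL v) = -inner ℂ (toL u) (toL (Dop v)) := by
  rw [inner_toL, inner_toL]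
  have := integral_bilinear_deriv_right_eq_neg_left u v
    ((ContinuousLinearMap.mul ℝ ℂ).comp (Complex.conjCLE : ℂ →L[ℝ] ℂ))
  rw [eq_neg_iff_add_eq_zero, add_comm, ← eq_neg_iff_add_eq_zero]
  exact this

theorem Yop_symm (u v : 𝓢(ℝ, ℂ)) :
    inner ℂ (toL (Yop u)) (toL v) = inner ℂ (toL u) (toL (Yop v)) := by
  rw [inner_toL, inner_toL]
  refine integral_congr_ae (Eventually.of_forall fun y => ?_)
  simp [Yop_apply]
  ring

theorem Dop_mulOp {m m' : ℝ → ℂ} (hm : m.HasTemperateGrowth) (hm' : m'.HasTemperateGrowth)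
    (h : ∀ y, HasDerivAt m (m' y) y) (v : 𝓢(ℝ, ℂ)) :
    Dop (mulOp m v) = mulOp m' v + mulOp m (Dop v) := by
  ext y
  have e : ⇑(mulOp m v) = fun y => m y * v y := funext fun y => mulOp_apply hm v y
  have h2 : HasDerivAt (fun y => m y * v y) (m' y * v y + m y * deriv v y) y :=
    (h y).mul v.differentiableAt.hasDerivAt
  rw [Dop_apply, e, h2.deriv, _root_.add_apply, mulOp_apply hm', mulOp_apply hm, Dop_apply]

theorem Dop_Yop (v : 𝓢(ℝ, ℂ)) : Dop (Yop v) = v + Yop (Dop v) := by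
  have := Dop_mulOp temperate_coe (Function.HasTemperateGrowth.const (1 : ℂ))
    (fun y => Complex.ofRealCLM.hasDerivAt) v
  rw [Yop, this]
  congr 1
  ext y
  rw [mulOp_apply (Function.HasTemperateGrowth.const (1 : ℂ)), one_mul]

theorem isModeTriple {k : ℝ} (hk : k ≠ 0) : IsModeTriple toL Dop Yop (Gop k) k where
  skew := Dop_skew
  symm := Yop_symm
  comm := Dop_Yop
  green := green_Gop hk

end SchwartzModel

/-! ### Green operator on `L²(ℝ)` and one-dimensional supremum bounds. -/

section SchwartzBounds

open SchwartzMap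
open scoped SchwartzMap

theorem norm_Gop_le {k : ℝ} (hk : k ≠ 0) (v : 𝓢(ℝ, ℂ)) : k ^ 2 * ‖toL (Gop k v)‖ ≤ ‖toL v‖ := by
  have h := (isModeTriple hk).rp_G_self v
  have h1 := (le_abs_self _).trans (abs_rp_le (ι := toL) (Gop k v) v)
  rcases (norm_nonneg (toL (Gop k v))).eq_or_lt with h0 | h0
  · rw [← h0]; simp
  · nlinarith [sq_nonneg ‖toL (Dop (Gop k v))‖]

theorem norm_Dop_Gop_le {k : ℝ} (hk : k ≠ 0) (v : 𝓢(ℝ, ℂ)) :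
    |k| * ‖toL (Dop (Gop k v))‖ ≤ ‖toL v‖ := by
  have h := (isModeTriple hk).rp_G_self v
  have h1 := (le_abs_self _).trans (abs_rp_le (ι := toL) (Gop k v) v)
  have h2 := norm_Gop_le hk v
  refine abs_le_of_sq_le_sq' (b := ‖toL v‖) ?_ (norm_nonneg _) |>.2
  rw [mul_pow, sq_abs]
  have : 0 < k ^ 2 := by positivity
  nlinarith [norm_nonneg (toL v), norm_nonneg (toL (Gop k v)), sq_nonneg (k ^ 2 * ‖toL (Gop k v)‖)]

/-- The extension to `L²(ℝ)` of an operator on the Schwartz space. -/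
def extL (T : 𝓢(ℝ, ℂ) →ₗ[ℂ] 𝓢(ℝ, ℂ)) : LR →L[ℂ] LR := (toL ∘ₗ T).extendOfNorm toL

theorem extL_toL {T : 𝓢(ℝ, ℂ) →ₗ[ℂ] 𝓢(ℝ, ℂ)} {C : ℝ} (h : ∀ v, ‖toL (T v)‖ ≤ C * ‖toL v‖)
    (v : 𝓢(ℝ, ℂ)) : extL T (toL v) = toL (T v) :=
  LinearMap.extendOfNorm_eq denseRange_toL ⟨C, h⟩ v

theorem norm_extL_le {T : 𝓢(ℝ, ℂ) →ₗ[ℂ] 𝓢(ℝ, ℂ)} {C : ℝ} (h : ∀ v, ‖toL (T v)‖ ≤ C * ‖toL v‖)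
    (u : LR) : ‖extL T u‖ ≤ C * ‖u‖ :=
  LinearMap.norm_extendOfNorm_apply_le denseRange_toL C h u

theorem Gop_bound (k : ℝ) (v : 𝓢(ℝ, ℂ)) : ‖toL (Gop k v)‖ ≤ (k ^ 2)⁻¹ * ‖toL v‖ := by
  rcases eq_or_ne k 0 with rfl | hk
  · simp [Gop_zero]
  · rw [inv_mul_eq_div, le_div_iff₀ (by positivity), mul_comm]
    exact norm_Gop_le hk v

theorem Dop_Gop_bound (k : ℝ) (v : 𝓢(ℝ, ℂ)) :
    ‖toL ((Dop ∘ₗ Gop k) v)‖ ≤ |k|⁻¹ * ‖toL v‖ := by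
  rcases eq_or_ne k 0 with rfl | hk
  · simp [Gop_zero]
  · rw [inv_mul_eq_div, le_div_iff₀ (by positivity), mul_comm]
    exact norm_Dop_Gop_le hk v

/-- The Green operator on `L²(ℝ)`. -/
def greenL (k : ℝ) : LR →L[ℂ] LR := extL (Gop k)

/-- The derivative of the Green operator on `L²(ℝ)`. -/
def dgreenL (k : ℝ) : LR →L[ℂ] LR := extL (Dop ∘ₗ Gop k)

theorem greenL_toL (k : ℝ) (v : 𝓢(ℝ, ℂ)) : greenL k (toL v) = toL (Gop k v) := extL_toL (Gop_bound k) v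

theorem dgreenL_toL (k : ℝ) (v : 𝓢(ℝ, ℂ)) : dgreenL k (toL v) = toL (Dop (Gop k v)) :=
  extL_toL (Dop_Gop_bound k) v

theorem greenL_zero (u : LR) : greenL 0 u = 0 := by
  have := norm_extL_le (Gop_bound 0) u
  exact norm_le_zero_iff.1 (this.trans (by simp))

theorem Gop_symm (k : ℝ) (u v : 𝓢(ℝ, ℂ)) :
    inner ℂ (toL (Gop k u)) (toL v) = inner ℂ (toL u) (toL (Gop k v)) := by
  rcases eq_or_ne k 0 with rfl | hk
  · simp [Gop_zero]
  have h := isModeTriple hk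
  nth_rewrite 1 [← h.green v]
  nth_rewrite 2 [← h.green u]
  rw [map_sub, map_sub, inner_sub_left, inner_sub_right, map_smul, map_smul, inner_smul_left,
    inner_smul_right, Complex.conj_ofReal]
  congr 1
  rw [h.skew, ← neg_eq_iff_eq_neg.2 (h.skew (Gop k u) (Dop (Gop k v)))]

/-- Decay at infinity selects the solution `f(y) = ∫_y^∞ e^{K(y-s)} v(s) ds`, whose kernel is at
most one. -/
theorem norm_le_of_deriv_eq {f v : ℝ → ℂ} {K : ℝ} (hK : 0 ≤ K)
    (hd : ∀ y, HasDerivAt f (K * f y - v y) y) (hf : Tendsto f atTop (𝓝 0)) (hv : Integrable v)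
    (y : ℝ) : ‖f y‖ ≤ ∫ s, ‖v s‖ := by
  have h1 : ∀ s : ℝ, HasDerivAt (fun s : ℝ => Complex.exp (K * (y - s)) * f s)
      (-(Complex.exp (K * (y - s)) * v s)) s := by
    intro s
    have e1 : HasDerivAt (fun s : ℝ => (K * (y - s) : ℂ)) (-K : ℂ) s := by
      have := ((Complex.ofRealCLM.hasDerivAt (x := s)).const_sub (y : ℂ)).const_mul (K : ℂ)
      simpa using this
    refine (e1.cexp.mul (hd s)).congr_deriv ?_
    ring
  have hnorm : ∀ s ∈ Ioi y, ‖Complex.exp (K * (y - s))‖ ≤ 1 := by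
    intro s hs
    rw [Complex.norm_exp]
    refine Real.exp_le_one_iff.2 ?_
    have : (K * (y - s) : ℂ).re = K * (y - s) := by
      rw [← Complex.ofReal_sub, ← Complex.ofReal_mul, Complex.ofReal_re]
    rw [this]
    exact mul_nonpos_of_nonneg_of_nonpos hK (by simpa using (le_of_lt hs : y ≤ s))
  have hint : IntegrableOn (fun s : ℝ => Complex.exp (K * (y - s)) * v s) (Ioi y) := by
    refine Integrable.bdd_mul (c := 1) hv.integrableOn ?_ ?_
    · exact Continuous.aestronglyMeasurable (by fun_prop)
    · exact (ae_restrict_iff' measurableSet_Ioi).2 (Eventually.of_forall hnorm)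
  have htend : Tendsto (fun s : ℝ => Complex.exp (K * (y - s)) * f s) atTop (𝓝 0) := by
    refine squeeze_zero_norm' ?_ (tendsto_zero_iff_norm_tendsto_zero.1 hf)
    filter_upwards [eventually_gt_atTop y] with s hs
    rw [norm_mul]
    exact mul_le_of_le_one_left (norm_nonneg _) (hnorm s hs)
  have key := integral_Ioi_of_hasDerivAt_of_tendsto' (a := y) (fun s _ => h1 s) hint.neg htend
  simp only [sub_self, mul_zero, Complex.exp_zero, one_mul, zero_sub, integral_neg] at key
  rw [← neg_inj.1 key]
  calc ‖∫ s in Ioi y, Complex.exp (K * (y - s)) * v s‖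
      ≤ ∫ s in Ioi y, ‖Complex.exp (K * (y - s)) * v s‖ := norm_integral_le_integral_norm _
    _ ≤ ∫ s in Ioi y, ‖v s‖ := by
        refine setIntegral_mono_on hint.norm hv.norm.integrableOn measurableSet_Ioi fun s hs => ?_
        rw [norm_mul]
        exact mul_le_of_le_one_left (norm_nonneg _) (hnorm s hs)
    _ ≤ ∫ s, ‖v s‖ :=
        setIntegral_le_integral hv.norm (Eventually.of_forall fun s => norm_nonneg _)

/-- Completing the square, the derivative of `‖f‖²` is at least `-‖v‖² / (2K)`; integrate from `y`
to infinity, where `f` vanishes. -/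
theorem norm_sq_le_of_deriv_eq {f v : ℝ → ℂ} {K : ℝ} (hK : 0 < K)
    (hd : ∀ y, HasDerivAt f (K * f y - v y) y) (hf : Tendsto f atTop (𝓝 0))
    (hf2 : Integrable fun y => ‖f y‖ ^ 2) (hv : Integrable fun y => ‖v y‖ ^ 2)
    (hvm : AEStronglyMeasurable v)
    (y : ℝ) : 2 * K * ‖f y‖ ^ 2 ≤ ∫ s, ‖v s‖ ^ 2 := by
  have hcont : Continuous f := continuous_iff_continuousAt.2 fun y => (hd y).continuousAt
  have h1 : ∀ s, HasDerivAt (fun s : ℝ => ‖f s‖ ^ 2)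
      (2 * K * ‖f s‖ ^ 2 - 2 * ((starRingEnd ℂ) (f s) * v s).re) s := by
    intro s
    refine ((hd s).norm_sq).congr_deriv ?_
    rw [inner_sub_right, mul_sub, Complex.inner, Complex.inner]
    have : (K * f s * (starRingEnd ℂ) (f s)).re = K * ‖f s‖ ^ 2 := by
      rw [mul_assoc, Complex.mul_conj', ← Complex.ofReal_pow, ← Complex.ofReal_mul,
        Complex.ofReal_re]
    rw [this, mul_comm (v s)]
    ring
  have hcross : ∀ s, |2 * ((starRingEnd ℂ) (f s) * v s).re|
      ≤ 2 * K * ‖f s‖ ^ 2 + ‖v s‖ ^ 2 / (2 * K) := by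
    intro s
    have h2 : |((starRingEnd ℂ) (f s) * v s).re| ≤ ‖f s‖ * ‖v s‖ := by
      refine (Complex.abs_re_le_norm _).trans ?_
      rw [norm_mul, RCLike.norm_conj]
    rw [abs_mul, abs_two]
    have h3 : 2 * (‖f s‖ * ‖v s‖) ≤ 2 * K * ‖f s‖ ^ 2 + ‖v s‖ ^ 2 / (2 * K) := by
      rw [← sub_nonneg]
      have : 2 * K * ‖f s‖ ^ 2 + ‖v s‖ ^ 2 / (2 * K) - 2 * (‖f s‖ * ‖v s‖)
          = (2 * K * ‖f s‖ - ‖v s‖) ^ 2 / (2 * K) := by field_simp; ring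
      rw [this]; positivity
    linarith
  have hint2 : Integrable fun s => 2 * ((starRingEnd ℂ) (f s) * v s).re := by
    refine Integrable.mono' ((hf2.const_mul (2 * K)).add (hv.div_const (2 * K))) ?_
      (Eventually.of_forall hcross)
    refine AEStronglyMeasurable.const_mul ?_ _
    exact Complex.continuous_re.comp_aestronglyMeasurable
      ((Complex.continuous_conj.comp hcont).aestronglyMeasurable.mul hvm)
  have htend : Tendsto (fun s : ℝ => ‖f s‖ ^ 2) atTop (𝓝 0) := by
    simpa using (tendsto_zero_iff_norm_tendsto_zero.1 hf).pow 2
  have key := integral_Ioi_of_hasDerivAt_of_tendsto' (a := y) (fun s _ => h1 s)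
    ((hf2.const_mul (2 * K)).sub hint2).integrableOn htend
  have : ‖f y‖ ^ 2 ≤ ∫ s in Ioi y, ‖v s‖ ^ 2 / (2 * K) := by
    have e : ‖f y‖ ^ 2 = ∫ s in Ioi y,
        -(2 * K * ‖f s‖ ^ 2 - 2 * ((starRingEnd ℂ) (f s) * v s).re) := by
      rw [integral_neg, key]; ring
    rw [e]
    refine setIntegral_mono_on ((hf2.const_mul (2 * K)).sub hint2).neg.integrableOn
      (hv.div_const _).integrableOn measurableSet_Ioi fun s _ => ?_
    have := (abs_le.1 (hcross s)).2
    linarith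
  have h4 : ∫ s in Ioi y, ‖v s‖ ^ 2 / (2 * K) ≤ ∫ s, ‖v s‖ ^ 2 / (2 * K) :=
    setIntegral_le_integral (hv.div_const _) (Eventually.of_forall fun s => by positivity)
  have := this.trans h4
  rw [integral_div] at this
  rw [le_div_iff₀ (by positivity)] at this
  linarith

theorem integrable_norm_sq (v : 𝓢(ℝ, ℂ)) : Integrable fun y => ‖v y‖ ^ 2 :=
  (v.memLp 2 volume).integrable_norm_pow (by norm_num)

theorem tendsto_zero_atTop (v : 𝓢(ℝ, ℂ)) : Tendsto v atTop (𝓝 0) :=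
  v.tendsto_cocompact.mono_left atTop_le_cocompact

theorem tendsto_zero_atBot (v : 𝓢(ℝ, ℂ)) : Tendsto v atBot (𝓝 0) :=
  v.tendsto_cocompact.mono_left atBot_le_cocompact

theorem sup_bounds_of_right {f v : 𝓢(ℝ, ℂ)} {K : ℝ} (hK : 0 < K)
    (h : Dop f = (K : ℂ) • f - v) (y : ℝ) :
    ‖f y‖ ≤ ∫ s, ‖v s‖ ∧ 2 * K * ‖f y‖ ^ 2 ≤ ‖toL v‖ ^ 2 := by
  have hd : ∀ y, HasDerivAt f (K * f y - v y) y := by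
    intro y
    have := f.differentiableAt.hasDerivAt (x := y)
    rwa [← Dop_apply, h] at this
  refine ⟨norm_le_of_deriv_eq hK.le hd (tendsto_zero_atTop f) v.integrable y, ?_⟩
  rw [norm_sq_toL]
  exact norm_sq_le_of_deriv_eq hK hd (tendsto_zero_atTop f) (integrable_norm_sq f)
    (integrable_norm_sq v) v.continuous.aestronglyMeasurable y

/-- The reflection `y ↦ -y` reduces this to integration towards `+∞`. -/
theorem sup_bounds_of_left {f v : 𝓢(ℝ, ℂ)} {K : ℝ} (hK : 0 < K)
    (h : Dop f = -(K : ℂ) • f - v) (y : ℝ) :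
    ‖f y‖ ≤ ∫ s, ‖v s‖ ∧ 2 * K * ‖f y‖ ^ 2 ≤ ‖toL v‖ ^ 2 := by
  have hd : ∀ y, HasDerivAt (fun s => f (-s)) (K * f (-y) - (fun s => -v (-s)) y) y := by
    intro y
    have := f.differentiableAt.hasDerivAt (x := -y)
    rw [← Dop_apply, h] at this
    refine (this.scomp y (hasDerivAt_neg y)).congr_deriv ?_
    simp
    ring
  have hf : Tendsto (fun s => f (-s)) atTop (𝓝 0) :=
    (tendsto_zero_atBot f).comp tendsto_neg_atTop_atBot
  have h1 := norm_le_of_deriv_eq hK.le hd hf (v.integrable.comp_neg.neg) (-y)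
  have h2 := norm_sq_le_of_deriv_eq hK hd hf (integrable_norm_sq f).comp_neg
    (by simpa using (integrable_norm_sq v).comp_neg)
    (by exact (v.continuous.comp continuous_neg).neg.aestronglyMeasurable) (-y)
  simp only [neg_neg, norm_neg] at h1 h2
  rw [integral_neg_eq_self (fun s => ‖v s‖)] at h1
  rw [integral_neg_eq_self (fun s => ‖v s‖ ^ 2)] at h2
  rw [norm_sq_toL]
  exact ⟨h1, h2⟩

/-- Factor `k² - D² = (|k| - D)(|k| + D)`. The combinations `D G v ± |k| G v` each solve a first
order equation with right side `v`, and half their sum and difference recover both quantities. The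
two alternatives are the `L¹` and the `L²` bound. -/
theorem sup_bounds_Gop {k : ℝ} (hk : k ≠ 0) {v : 𝓢(ℝ, ℂ)} {B : ℝ}
    (hB : ∫ s, ‖v s‖ ≤ B ∨ ‖toL v‖ ^ 2 ≤ 2 * |k| * B ^ 2 ∧ 0 ≤ B) (y : ℝ) :
    |k| * ‖Gop k v y‖ ≤ B ∧ ‖Dop (Gop k v) y‖ ≤ B := by
  have hK : 0 < |k| := abs_pos.2 hk
  have hg : Dop (Dop (Gop k v)) = ((|k| : ℝ) : ℂ) • ((|k| : ℝ) : ℂ) • Gop k v - v := by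
    have := green_Gop hk v
    rw [smul_smul, ← Complex.ofReal_mul, abs_mul_abs_self, ← pow_two]
    nth_rewrite 3 [← this]
    abel
  have h1 : Dop (Dop (Gop k v) + ((|k| : ℝ) : ℂ) • Gop k v)
      = ((|k| : ℝ) : ℂ) • (Dop (Gop k v) + ((|k| : ℝ) : ℂ) • Gop k v) - v := by
    rw [map_add, map_smul, hg, smul_add]; abel
  have h2 : Dop (Dop (Gop k v) - ((|k| : ℝ) : ℂ) • Gop k v)
      = -((|k| : ℝ) : ℂ) • (Dop (Gop k v) - ((|k| : ℝ) : ℂ) • Gop k v) - v := by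
    rw [map_sub, map_smul, hg, neg_smul, smul_sub]; abel
  obtain ⟨b1, b2⟩ := sup_bounds_of_right hK h1 y
  obtain ⟨b3, b4⟩ := sup_bounds_of_left hK h2 y
  have hh : ∀ c : ℝ, 2 * |k| * c ^ 2 ≤ ‖toL v‖ ^ 2 → ‖toL v‖ ^ 2 ≤ 2 * |k| * B ^ 2 ∧ 0 ≤ B →
      c ≤ B := fun c h3 h4 => abs_le_of_sq_le_sq' (by nlinarith) h4.2 |>.2
  have p1 : ‖(Dop (Gop k v) + ((|k| : ℝ) : ℂ) • Gop k v) y‖ ≤ B :=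
    hB.elim (fun h => b1.trans h) (hh _ b2)
  have p2 : ‖(Dop (Gop k v) - ((|k| : ℝ) : ℂ) • Gop k v) y‖ ≤ B :=
    hB.elim (fun h => b3.trans h) (hh _ b4)
  set a := Dop (Gop k v) y
  set b := ((|k| : ℝ) : ℂ) * Gop k v y with hb
  have p1' : ‖a + b‖ ≤ B := p1
  have p2' : ‖a - b‖ ≤ B := p2
  have q1 : |k| * ‖Gop k v y‖ = ‖b‖ := by simp [hb]
  rw [q1]
  have e1 : (2 : ℂ) * b = (a + b) - (a - b) := by ring
  have e2 : (2 : ℂ) * a = (a + b) + (a - b) := by ring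
  have n1 := norm_sub_le (a + b) (a - b)
  have n2 := norm_add_le (a + b) (a - b)
  rw [← e1, norm_mul] at n1
  rw [← e2, norm_mul] at n2
  simp only [Complex.norm_ofNat] at n1 n2
  constructor <;> linarith

/-- Cauchy–Schwarz against the weight `δ² + s²`, whose reciprocal has integral `π/δ`. The scale `δ`
is left free and later balances `‖v‖` against `‖Yv‖`. -/
theorem sq_integral_norm_le {δ : ℝ} (hδ : 0 < δ) (v : 𝓢(ℝ, ℂ)) :
    (∫ s, ‖v s‖) ^ 2 ≤ Real.pi / δ * (δ ^ 2 * ‖toL v‖ ^ 2 + ‖toL (Yop v)‖ ^ 2) := by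
  set A := ∫ s, ‖v s‖
  set W := δ ^ 2 * ‖toL v‖ ^ 2 + ‖toL (Yop v)‖ ^ 2 with hW
  have hA : 0 ≤ A := integral_nonneg fun _ => norm_nonneg _
  have hW0 : 0 ≤ W := by positivity
  rcases hA.eq_or_lt with h0 | h0
  · rw [← h0, zero_pow two_ne_zero]; exact mul_nonneg (by positivity) hW0
  have hP : Integrable fun s : ℝ => (δ ^ 2 + s ^ 2)⁻¹ := by
    have := (integrable_inv_one_add_sq.comp_div hδ.ne').const_mul (δ ^ 2)⁻¹
    refine this.congr (Eventually.of_forall fun s => ?_)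
    have : 0 < δ ^ 2 + s ^ 2 := by positivity
    simp only
    rw [← mul_inv]
    congr 1
    field_simp
  have hPi : ∫ s : ℝ, (δ ^ 2 + s ^ 2)⁻¹ = Real.pi / δ := by
    have h := Measure.integral_comp_div (fun s : ℝ => (1 + s ^ 2)⁻¹) δ
    rw [integral_univ_inv_one_add_sq, abs_of_pos hδ] at h
    have e : ∀ s : ℝ, (δ ^ 2 + s ^ 2)⁻¹ = (δ ^ 2)⁻¹ * (1 + (s / δ) ^ 2)⁻¹ := by
      intro s
      rw [← mul_inv]
      congr 1
      field_simp
    simp_rw [e]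
    rw [integral_const_mul, h, smul_eq_mul]
    field_simp
  have hWi : Integrable fun s => (δ ^ 2 + s ^ 2) * ‖v s‖ ^ 2 := by
    have := ((integrable_norm_sq v).const_mul (δ ^ 2)).add (integrable_norm_sq (Yop v))
    refine this.congr (Eventually.of_forall fun s => ?_)
    simp [Yop_apply, mul_pow, sq_abs]
    ring
  have hWe : ∫ s, (δ ^ 2 + s ^ 2) * ‖v s‖ ^ 2 = W := by
    rw [hW, norm_sq_toL, norm_sq_toL, ← integral_const_mul, ← integral_add
      ((integrable_norm_sq v).const_mul (δ ^ 2)) (integrable_norm_sq (Yop v))]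
    refine integral_congr_ae (Eventually.of_forall fun s => ?_)
    simp [Yop_apply, mul_pow, sq_abs]
    ring
  have key : ∀ c : ℝ, 0 < c → 2 * A ≤ c * (Real.pi / δ) + c⁻¹ * W := by
    intro c hc
    rw [← hPi, ← hWe, ← integral_const_mul, ← integral_const_mul, ← integral_const_mul,
      ← integral_add (hP.const_mul c) (hWi.const_mul _)]
    refine integral_mono (v.integrable.norm.const_mul 2)
      ((hP.const_mul c).add (hWi.const_mul _)) fun s => ?_
    have hp : 0 < δ ^ 2 + s ^ 2 := by positivity
    simp only
    rw [← sub_nonneg]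
    have : c * (δ ^ 2 + s ^ 2)⁻¹ + c⁻¹ * ((δ ^ 2 + s ^ 2) * ‖v s‖ ^ 2) - 2 * ‖v s‖
        = (c - (δ ^ 2 + s ^ 2) * ‖v s‖) ^ 2 / (c * (δ ^ 2 + s ^ 2)) := by
      field_simp; ring
    rw [this]; positivity
  have hq : 0 < Real.pi / δ := by positivity
  -- This is the value of `c` that turns the family of linear bounds into the quadratic one.
  have := key (A / (Real.pi / δ)) (by positivity)
  rw [div_mul_cancel₀ _ hq.ne', inv_div, div_mul_eq_mul_div] at this
  have h3 : A ≤ Real.pi / δ * W / A := by linarith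
  rw [le_div_iff₀ h0] at h3
  linarith

end SchwartzBounds

/-! ### Cutoff multipliers and the energy estimate for weak solutions. -/

section ModeRelation

open SchwartzMap
open scoped SchwartzMap

/-- Multiplication by `y ↦ f (y / R)` on the Schwartz space. -/
def scaleMul (f : 𝓢(ℝ, ℂ)) (R : ℝ) : 𝓢(ℝ, ℂ) →ₗ[ℂ] 𝓢(ℝ, ℂ) := mulOp fun y => f (y / R)

theorem temperate_scale (f : 𝓢(ℝ, ℂ)) (R : ℝ) :
    Function.HasTemperateGrowth fun y : ℝ => f (y / R) := by
  have h : Function.HasTemperateGrowth fun y : ℝ => y / R := by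
    simp only [div_eq_mul_inv]; fun_prop
  exact f.hasTemperateGrowth.comp h

theorem scaleMul_apply (f : 𝓢(ℝ, ℂ)) (R : ℝ) (v : 𝓢(ℝ, ℂ)) (y : ℝ) :
    scaleMul f R v y = f (y / R) * v y := mulOp_apply (temperate_scale f R) v y

theorem norm_toL_le_of_norm_le {v w : 𝓢(ℝ, ℂ)} {C : ℝ} (hC : 0 ≤ C)
    (h : ∀ y, ‖v y‖ ≤ C * ‖w y‖) : ‖toL v‖ ≤ C * ‖toL w‖ := by
  refine abs_le_of_sq_le_sq' ?_ (by positivity) |>.2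
  rw [mul_pow, norm_sq_toL, norm_sq_toL, ← integral_const_mul]
  refine integral_mono (integrable_norm_sq v) ((integrable_norm_sq w).const_mul _) fun y => ?_
  simp only
  rw [← mul_pow]
  gcongr
  exact h y

theorem scaleMul_bound (f : 𝓢(ℝ, ℂ)) (R : ℝ) (v : 𝓢(ℝ, ℂ)) :
    ‖toL (scaleMul f R v)‖ ≤ SchwartzMap.seminorm ℂ 0 0 f * ‖toL v‖ := by
  refine norm_toL_le_of_norm_le (apply_nonneg _ _) fun y => ?_
  rw [scaleMul_apply, norm_mul]
  gcongr
  exact norm_le_seminorm ℂ f _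

/-- Multiplication by `y ↦ f (y / R)` on `L²(ℝ)`. -/
def scaleMulL (f : 𝓢(ℝ, ℂ)) (R : ℝ) : LR →L[ℂ] LR := extL (scaleMul f R)

theorem scaleMulL_toL (f : 𝓢(ℝ, ℂ)) (R : ℝ) (v : 𝓢(ℝ, ℂ)) :
    scaleMulL f R (toL v) = toL (scaleMul f R v) := extL_toL (scaleMul_bound f R) v

theorem norm_scaleMulL_le (f : 𝓢(ℝ, ℂ)) (R : ℝ) (u : LR) :
    ‖scaleMulL f R u‖ ≤ SchwartzMap.seminorm ℂ 0 0 f * ‖u‖ := norm_extL_le (scaleMul_bound f R) u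

theorem norm_adjoint_scaleMulL_le (f : 𝓢(ℝ, ℂ)) (R : ℝ) (u : LR) :
    ‖(scaleMulL f R).adjoint u‖ ≤ SchwartzMap.seminorm ℂ 0 0 f * ‖u‖ := by
  refine ((scaleMulL f R).adjoint.le_opNorm u).trans ?_
  gcongr
  rw [LinearIsometryEquiv.norm_map]
  exact ContinuousLinearMap.opNorm_le_bound _ (apply_nonneg _ _) (norm_scaleMulL_le f R)

theorem inner_scaleMul (f : 𝓢(ℝ, ℂ)) (R : ℝ) (v : 𝓢(ℝ, ℂ)) (u : LR) :
    inner ℂ (toL (scaleMul f R v)) u = inner ℂ (toL v) ((scaleMulL f R).adjoint u) := by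
  rw [ContinuousLinearMap.adjoint_inner_right, scaleMulL_toL]

theorem Dop_scaleMul (f : 𝓢(ℝ, ℂ)) {R : ℝ} (v : 𝓢(ℝ, ℂ)) :
    Dop (scaleMul f R v) = (R⁻¹ : ℂ) • scaleMul (Dop f) R v + scaleMul f R (Dop v) := by
  have hT : Function.HasTemperateGrowth fun y : ℝ => (R⁻¹ : ℂ) * Dop f (y / R) :=
    (Function.HasTemperateGrowth.const _).mul (temperate_scale (Dop f) R)
  have h := Dop_mulOp (m := fun y => f (y / R)) (temperate_scale f R) hT
    (fun y => by
      have h1 := (f.differentiableAt (x := y / R)).hasDerivAt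
      have h2 : HasDerivAt (fun y : ℝ => y / R) R⁻¹ y := by
        simpa using (hasDerivAt_id y).div_const R
      refine (h1.scomp y h2).congr_deriv ?_
      simp [Dop_apply]) v
  rw [scaleMul, h]
  congr 1
  ext y
  rw [mulOp_apply hT, _root_.smul_apply, scaleMul_apply, smul_eq_mul]
  simp [mul_assoc]

theorem Yop_Yop_scaleMul (f : 𝓢(ℝ, ℂ)) {R : ℝ} (hR : R ≠ 0) (v : 𝓢(ℝ, ℂ)) :
    Yop (Yop (scaleMul f R v)) = (R ^ 2 : ℂ) • scaleMul (Yop (Yop f)) R v := by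
  ext y
  have : (R : ℂ) ≠ 0 := by exact_mod_cast hR
  simp only [Yop_apply, scaleMul_apply, _root_.smul_apply, smul_eq_mul]
  push_cast
  field_simp

/-- A weak solution of `D²w = p - Dq` satisfies the energy estimate. -/
theorem re_inner_le_of_weak {w p q : LR}
    (h : ∀ x : 𝓢(ℝ, ℂ), inner ℂ (toL (Dop (Dop x))) w
      = inner ℂ (toL x) p + inner ℂ (toL (Dop x)) q) :
    (inner ℂ w p).re ≤ ‖q‖ ^ 2 / 4 := by
  -- Testing with `G θ` gains regularity: the Green operator with `k = 1` represents `w` by `L²`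
  -- data, which gives it a derivative in `L²`.
  have hw : w = greenL 1 (w - p) + dgreenL 1 q := by
    have hd : ∀ θ : 𝓢(ℝ, ℂ), inner ℂ (toL θ) w = inner ℂ (toL θ) (greenL 1 (w - p) + dgreenL 1 q) := by
      intro θ
      have hg : ∀ z : LR, inner ℂ (toL θ) (greenL 1 z) = inner ℂ (toL (Gop 1 θ)) z := by
        intro z
        refine denseRange_toL.induction_on z (isClosed_eq (by fun_prop) (by fun_prop)) fun v => ?_
        rw [greenL_toL, Gop_symm]
      have hdg : ∀ z : LR, inner ℂ (toL θ) (dgreenL 1 z) = -inner ℂ (toL (Dop (Gop 1 θ))) z := by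
        intro z
        refine denseRange_toL.induction_on z (isClosed_eq (by fun_prop) (by fun_prop)) fun v => ?_
        rw [dgreenL_toL, Dop_Gop, ← Gop_symm, Dop_skew, neg_neg]
      have h1 := h (Gop 1 θ)
      have h2 := green_Gop one_ne_zero θ
      have h3 : Dop (Dop (Gop 1 θ)) = Gop 1 θ - θ := by
        nth_rewrite 3 [← h2]
        simp
      rw [h3, map_sub, inner_sub_left] at h1
      rw [inner_add_right, hg, hdg, inner_sub_right]
      linear_combination -h1
    refine ext_inner_left ℂ fun z => ?_
    exact denseRange_toL.induction_on z (isClosed_eq (by fun_prop) (by fun_prop)) hd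
  obtain ⟨w', hw'⟩ : ∃ w' : LR, w' = dgreenL 1 (w - p) + greenL 1 q - q := ⟨_, rfl⟩
  -- The pair `(w, w')` is a limit of pairs `(x, Dx)` with `x` Schwartz. Hence `w` itself may be
  -- used as a test function, which yields `-‖w'‖² = Re⟨w, p⟩ + Re⟨w', q⟩`.
  have happ : ∀ U : Set (LR × LR), IsClosed U → (∀ x : 𝓢(ℝ, ℂ), (toL x, toL (Dop x)) ∈ U) →
      (w, w') ∈ U := by
    intro U hU hx
    have : ∀ a b : LR, (greenL 1 a + dgreenL 1 b, dgreenL 1 a + greenL 1 b - b) ∈ U := by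
      intro a b
      refine denseRange_toL.induction_on a (hU.preimage (by fun_prop)) fun a => ?_
      refine denseRange_toL.induction_on b (hU.preimage (by fun_prop)) fun b => ?_
      have h2 := green_Gop one_ne_zero b
      have h3 : Dop (Dop (Gop 1 b)) = Gop 1 b - b := by
        nth_rewrite 3 [← h2]
        simp
      have := hx (Gop 1 a + Dop (Gop 1 b))
      rw [map_add Dop, h3] at this
      simp only [greenL_toL, dgreenL_toL]
      convert this using 2
      · rw [map_add]
      · rw [map_add, map_sub]; abel
    have := this (w - p) q
    rwa [← hw, ← hw'] at this
  have h1 : ∀ x : 𝓢(ℝ, ℂ), -inner ℂ (toL (Dop x)) w'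
      = inner ℂ (toL x) p + inner ℂ (toL (Dop x)) q := by
    intro x
    rw [← h x]
    exact happ {z | -inner ℂ (toL (Dop x)) z.2 = inner ℂ (toL (Dop (Dop x))) z.1}
      (isClosed_eq (by fun_prop) (by fun_prop)) fun y => (Dop_skew (Dop x) y).symm
  have h2 : -inner ℂ w' w' = inner ℂ w p + inner ℂ w' q :=
    happ {z | -inner ℂ z.2 w' = inner ℂ z.1 p + inner ℂ z.2 q}
      (isClosed_eq (by fun_prop) (by fun_prop)) h1
  have h3 := congrArg Complex.re h2
  rw [inner_self_eq_norm_sq_to_K, Complex.neg_re, Complex.add_re] at h3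
  have h4 : ((‖w'‖ : ℂ) ^ 2).re = ‖w'‖ ^ 2 := by
    rw [← Complex.ofReal_pow, Complex.ofReal_re]
  have h5 := (abs_le.1 ((Complex.abs_re_le_norm _).trans (norm_inner_le_norm w' q))).1
  have h6 : -‖w'‖ ^ 2 = (inner ℂ w p).re + (inner ℂ w' q).re := by
    rw [← h4]; exact h3
  nlinarith [sq_nonneg (‖w'‖ - ‖q‖ / 2)]

/-- A real-valued cutoff function in the Schwartz space. -/
theorem exists_cutoff : ∃ η : 𝓢(ℝ, ℂ), HasCompactSupport η ∧
    (∀ y, (starRingEnd ℂ) (η y) = η y) ∧ (∀ y, ‖1 - η y‖ ≤ |y|) ∧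
    SchwartzMap.seminorm ℂ 0 0 η ≤ 1 := by
  let b : ContDiffBump (0 : ℝ) := ⟨1, 2, by norm_num, by norm_num⟩
  have hc : HasCompactSupport fun y : ℝ => ((b y : ℝ) : ℂ) :=
    b.hasCompactSupport.comp_left (g := fun x : ℝ => (x : ℂ)) Complex.ofReal_zero
  have hs : ContDiff ℝ ∞ fun y : ℝ => ((b y : ℝ) : ℂ) :=
    Complex.ofRealCLM.contDiff.comp b.contDiff
  refine ⟨hc.toSchwartzMap hs, hc, fun y => Complex.conj_ofReal _, fun y => ?_, ?_⟩
  · change ‖(1 : ℂ) - ((b y : ℝ) : ℂ)‖ ≤ |y|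
    rw [← Complex.ofReal_one, ← Complex.ofReal_sub, Complex.norm_real, Real.norm_eq_abs,
      abs_of_nonneg (sub_nonneg.2 b.le_one)]
    rcases le_or_gt |y| 1 with hy | hy
    · rw [b.one_of_mem_closedBall (by simpa using hy)]; simp
    · linarith [b.nonneg (x := y)]
  · refine seminorm_le_bound ℂ 0 0 _ zero_le_one fun y => ?_
    rw [pow_zero, one_mul, norm_iteratedFDeriv_zero]
    change ‖((b y : ℝ) : ℂ)‖ ≤ 1
    rw [Complex.norm_real, Real.norm_eq_abs, abs_of_nonneg b.nonneg]
    exact b.le_one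

end ModeRelation

/-! ### Uniqueness of weak solutions of the resolvent equation. -/

section ModeUniqueness

open SchwartzMap
open scoped SchwartzMap

theorem adjoint_scaleMulL {f : 𝓢(ℝ, ℂ)} (hf : ∀ y, (starRingEnd ℂ) (f y) = f y) (R : ℝ) :
    (scaleMulL f R).adjoint = scaleMulL f R := by
  symm
  rw [ContinuousLinearMap.eq_adjoint_iff]
  intro x y
  refine denseRange_toL.induction_on x (isClosed_eq (by fun_prop) (by fun_prop)) fun v => ?_
  refine denseRange_toL.induction_on y (isClosed_eq (by fun_prop) (by fun_prop)) fun w => ?_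
  rw [scaleMulL_toL, scaleMulL_toL, inner_toL, inner_toL]
  refine integral_congr_ae (Eventually.of_forall fun s => ?_)
  simp only [scaleMul_apply, map_mul, hf]
  ring

theorem im_inner_scaleMulL {f g : 𝓢(ℝ, ℂ)} (hf : ∀ y, (starRingEnd ℂ) (f y) = f y)
    (hg : ∀ y, (starRingEnd ℂ) (g y) = g y) (R : ℝ) (u : LR) :
    (inner ℂ (scaleMulL f R u) (scaleMulL g R u)).im = 0 := by
  refine denseRange_toL.induction_on u (isClosed_eq (by fun_prop) (by fun_prop)) fun v => ?_
  rw [← Complex.conj_eq_iff_im, scaleMulL_toL, scaleMulL_toL, inner_toL, ← integral_conj]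
  refine integral_congr_ae (Eventually.of_forall fun s => ?_)
  simp only [scaleMul_apply, map_mul, hf, hg, Complex.conj_conj]
  ring

theorem im_inner_greenL (k : ℝ) (u : LR) : (inner ℂ u (greenL k u)).im = 0 := by
  refine denseRange_toL.induction_on u (isClosed_eq (by fun_prop) (by fun_prop)) fun v => ?_
  rw [← Complex.conj_eq_iff_im, inner_conj_symm, greenL_toL, Gop_symm]

/-- For Schwartz `v` the error is at most `R⁻¹ ‖Yv‖`, because `|1 - η(y/R)| ≤ |y|/R`; the uniform
bound on the cutoffs extends this by density. -/
theorem tendsto_scaleMulL {η : 𝓢(ℝ, ℂ)} (h1 : ∀ y, ‖1 - η y‖ ≤ |y|)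
    (h2 : SchwartzMap.seminorm ℂ 0 0 η ≤ 1) (u : LR) :
    Tendsto (fun R : ℝ => scaleMulL η R u) atTop (𝓝 u) := by
  rw [Metric.tendsto_nhds]
  intro ε hε
  obtain ⟨v, hv⟩ := denseRange_toL.exists_dist_lt u (show 0 < ε / 3 by positivity)
  rw [dist_eq_norm] at hv
  have h3 : Tendsto (fun R : ℝ => ‖toL (Yop v)‖ / R) atTop (𝓝 0) :=
    tendsto_const_nhds.div_atTop tendsto_id
  filter_upwards [eventually_gt_atTop 0, h3.eventually (gt_mem_nhds (show 0 < ε / 3 by positivity))]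
    with R hR hR2
  have e1 : ‖scaleMulL η R (toL v) - toL v‖ ≤ R⁻¹ * ‖toL (Yop v)‖ := by
    rw [scaleMulL_toL, ← map_sub]
    refine norm_toL_le_of_norm_le (by positivity) fun y => ?_
    rw [_root_.sub_apply, scaleMul_apply, Yop_apply, ← sub_one_mul, norm_mul, norm_mul,
      ← norm_neg, neg_sub, ← mul_assoc]
    gcongr
    refine (h1 _).trans ?_
    rw [abs_div, abs_of_pos hR, Complex.norm_real, Real.norm_eq_abs, inv_mul_eq_div]
  have e2 : ‖scaleMulL η R (u - toL v)‖ ≤ ‖u - toL v‖ :=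
    (norm_scaleMulL_le η R _).trans (mul_le_of_le_one_left (norm_nonneg _) h2)
  rw [inv_mul_eq_div] at e1
  rw [dist_eq_norm]
  have e3 : scaleMulL η R u - u
      = scaleMulL η R (u - toL v) + (scaleMulL η R (toL v) - toL v) - (u - toL v) := by
    rw [map_sub]; abel
  rw [e3]
  refine (norm_sub_le _ _).trans_lt ?_
  have := norm_add_le (scaleMulL η R (u - toL v)) (scaleMulL η R (toL v) - toL v)
  linarith

theorem scaleMul_hasCompactSupport {η : 𝓢(ℝ, ℂ)} (h : HasCompactSupport η) {R : ℝ} (hR : R ≠ 0)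
    (v : 𝓢(ℝ, ℂ)) : HasCompactSupport (scaleMul η R v) := by
  have h1 : HasCompactSupport fun y : ℝ => η (R⁻¹ • y) :=
    HasCompactSupport.comp_smul h (inv_ne_zero hR)
  have h2 : ⇑(scaleMul η R v) = (fun y : ℝ => η (R⁻¹ • y)) * ⇑v := by
    ext y
    simp [scaleMul_apply, div_eq_inv_mul]
  rw [h2]
  exact h1.mul_right

/-- The mode operator on the Schwartz space. -/
abbrev modeS (nu k : ℝ) : 𝓢(ℝ, ℂ) →ₗ[ℂ] 𝓢(ℝ, ℂ) := modeOp Dop Yop (Gop k) nu k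

theorem inner_modeS (nu k : ℝ) (v : 𝓢(ℝ, ℂ)) (u : LR) :
    inner ℂ (toL (modeS nu k v)) u
      = Complex.I * k * (inner ℂ (toL (Yop (Yop v))) u + 2 * inner ℂ (toL (Gop k v)) u)
        + nu * (inner ℂ (toL (Dop (Dop v))) u - k ^ 2 * inner ℂ (toL v) u) := by
  rw [modeOp_apply]
  simp only [map_add, map_smul, map_sub, inner_add_left, inner_smul_left, inner_sub_left, map_neg,
    map_mul, Complex.conj_I, Complex.conj_ofReal, neg_mul, neg_neg, Complex.ofReal_pow, map_pow,
    map_ofNat]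

/-- Localize `u` to `η(y/R) u` and apply the energy estimate. The potential `y²` is bounded on the
support, real, and hence invisible in the real part; the commutators with the cutoff cost `O(R⁻²)`.
The nonlocal term is not localized, but it tends to `2k Im⟨u, G u⟩ = 0`. What remains is `(λ + ν k²)
‖u‖² ≤ 0`. The value `k = 0` is allowed and used later for the Laplacian. -/
theorem eq_zero_of_weak {nu k lam : ℝ} (hnu : 0 < nu) (hlam : 0 < lam) {u : LR}
    (h : ∀ θ : 𝓢(ℝ, ℂ), HasCompactSupport θ →
      inner ℂ (toL (modeS nu k θ)) u = lam * inner ℂ (toL θ) u) : u = 0 := by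
  obtain ⟨η, hc, hreal, h1, hs⟩ := exists_cutoff
  set s1 := SchwartzMap.seminorm ℂ 0 0 (Dop η) with hs1
  set s2 := SchwartzMap.seminorm ℂ 0 0 (Dop (Dop η)) with hs2
  set z : ℝ := lam + nu * k ^ 2 with hz
  have hz0 : 0 < z := by positivity
  have hrealN : ∀ y, (starRingEnd ℂ) (Yop (Yop η) y) = Yop (Yop η) y := by
    intro y; simp [Yop_apply, hreal]
  have key : ∀ R : ℝ, 0 < R → z * ‖scaleMulL η R u‖ ^ 2
      + 2 * k * (inner ℂ (scaleMulL η R u) (scaleMulL η R (greenL k u))).im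
      ≤ nu * ((s1 ^ 2 + s2) * ‖u‖ ^ 2) / R ^ 2 := by
    intro R hR
    set w := scaleMulL η R u with hw
    set n := scaleMulL (Yop (Yop η)) R u with hn
    set g := scaleMulL η R (greenL k u) with hg
    set m1 := (scaleMulL (Dop η) R).adjoint u with hm1
    set m2 := (scaleMulL (Dop (Dop η)) R).adjoint u with hm2
    -- Testing with `η(·/R) x` and expanding `D²(η(·/R) x)` by Leibniz: `m1` and `m2` carry the
    -- first and second derivative of the cutoff, `n` carries `y²`, and `g` is the cutoff applied to
    -- `G u`.
    have hweak := re_inner_le_of_weak (w := w)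
      (p := (nu⁻¹ : ℂ) • ((z : ℂ) • w - (Complex.I * k) • ((R ^ 2 : ℂ) • n + (2 : ℂ) • g))
        - ((R ^ 2)⁻¹ : ℂ) • m2) (q := -((2 * R⁻¹ : ℝ) : ℂ) • m1) (by
      intro x
      have e := h (scaleMul η R x) (scaleMul_hasCompactSupport hc hR.ne' x)
      have eG : inner ℂ (toL (Gop k (scaleMul η R x))) u = inner ℂ (toL x) g := by
        rw [hg, ← adjoint_scaleMulL hreal, ← inner_scaleMul]
        refine denseRange_toL.induction_on u (isClosed_eq (by fun_prop) (by fun_prop)) fun v => ?_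
        rw [greenL_toL, Gop_symm]
      have eM : ∀ x, inner ℂ (toL (scaleMul η R x)) u = inner ℂ (toL x) w := by
        intro x
        rw [hw, inner_scaleMul, adjoint_scaleMulL hreal]
      have eN : inner ℂ (toL (scaleMul (Yop (Yop η)) R x)) u = inner ℂ (toL x) n := by
        rw [hn, inner_scaleMul, adjoint_scaleMulL hrealN]
      rw [inner_modeS, Yop_Yop_scaleMul η hR.ne', Dop_scaleMul, map_add Dop, map_smul Dop,
        Dop_scaleMul, Dop_scaleMul, eG] at e
      simp only [map_add, map_smul, inner_add_left, inner_smul_left, eM, eN] at e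
      rw [inner_scaleMul, inner_scaleMul, ← hm1, ← hm2] at e
      simp only [map_inv₀, map_pow, Complex.conj_ofReal] at e
      simp only [inner_sub_right, inner_smul_right, inner_add_right]
      have hnu' : (nu : ℂ) ≠ 0 := by exact_mod_cast hnu.ne'
      have hR' : (R : ℂ) ≠ 0 := by exact_mod_cast hR.ne'
      have hzc : (z : ℂ) = lam + nu * k ^ 2 := by rw [hz]; push_cast; ring
      rw [hzc]
      push_cast
      field_simp at e ⊢
      linear_combination e)
    have b1 : ‖m1‖ ≤ s1 * ‖u‖ := norm_adjoint_scaleMulL_le _ _ _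
    have b2 : ‖m2‖ ≤ s2 * ‖u‖ := norm_adjoint_scaleMulL_le _ _ _
    have bw : ‖w‖ ≤ ‖u‖ :=
      (norm_scaleMulL_le η R u).trans (mul_le_of_le_one_left (norm_nonneg _) hs)
    have hwn : (inner ℂ w n).im = 0 := im_inner_scaleMulL hreal hrealN R u
    have hwm : (inner ℂ w m2).re ≤ s2 * ‖u‖ ^ 2 := by
      refine (Complex.re_le_norm _).trans ((norm_inner_le_norm _ _).trans ?_)
      calc ‖w‖ * ‖m2‖ ≤ ‖u‖ * (s2 * ‖u‖) := by gcongr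
        _ = s2 * ‖u‖ ^ 2 := by ring
    have hre : (inner ℂ w ((nu⁻¹ : ℂ) • ((z : ℂ) • w - (Complex.I * k) • ((R ^ 2 : ℂ) • n
        + (2 : ℂ) • g)) - ((R ^ 2)⁻¹ : ℂ) • m2)).re
        = nu⁻¹ * (z * ‖w‖ ^ 2 + k * (R ^ 2 * (inner ℂ w n).im + 2 * (inner ℂ w g).im))
          - (R ^ 2)⁻¹ * (inner ℂ w m2).re := by
      simp only [inner_sub_right, inner_smul_right, inner_add_right]
      rw [inner_self_eq_norm_sq_to_K]
      have q1 : ((nu : ℂ)⁻¹) = ((nu⁻¹ : ℝ) : ℂ) := by push_cast; rfl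
      have q2 : (((R : ℂ) ^ 2)⁻¹) = (((R ^ 2)⁻¹ : ℝ) : ℂ) := by push_cast; rfl
      have q3 : ((R : ℂ) ^ 2) = ((R ^ 2 : ℝ) : ℂ) := by push_cast; rfl
      have q4 : ((RCLike.ofReal ‖w‖ : ℂ) ^ 2) = ((‖w‖ ^ 2 : ℝ) : ℂ) := by push_cast; rfl
      rw [q1, q2, q3, q4]
      simp only [Complex.sub_re, Complex.mul_re, Complex.mul_im,
        Complex.add_im, Complex.add_re, Complex.I_re, Complex.I_im, Complex.ofReal_re,
        Complex.ofReal_im, Complex.re_ofNat, Complex.im_ofNat]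
      ring
    rw [hre, hwn, norm_smul, norm_neg, Complex.norm_real, Real.norm_eq_abs,
      abs_of_nonneg (by positivity)] at hweak
    have b1' : ‖m1‖ ^ 2 ≤ s1 ^ 2 * ‖u‖ ^ 2 := by rw [← mul_pow]; gcongr
    have h5 : nu⁻¹ * (z * ‖w‖ ^ 2 + 2 * k * (inner ℂ w g).im)
        ≤ (R ^ 2)⁻¹ * ((s1 ^ 2 + s2) * ‖u‖ ^ 2) := by
      have h6 : (2 * R⁻¹ * ‖m1‖) ^ 2 / 4 = (R ^ 2)⁻¹ * ‖m1‖ ^ 2 := by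
        field_simp; ring
      rw [h6] at hweak
      have hRi : 0 < (R ^ 2)⁻¹ := by positivity
      nlinarith
    rw [inv_mul_le_iff₀ hnu] at h5
    rw [mul_div_assoc, div_eq_inv_mul]
    exact h5
  have hlim1 : Tendsto (fun R : ℝ => z * ‖scaleMulL η R u‖ ^ 2
      + 2 * k * (inner ℂ (scaleMulL η R u) (scaleMulL η R (greenL k u))).im) atTop
      (𝓝 (z * ‖u‖ ^ 2 + 2 * k * (inner ℂ u (greenL k u)).im)) := by
    have t1 := tendsto_scaleMulL h1 hs u
    have t2 := tendsto_scaleMulL h1 hs (greenL k u)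
    exact ((t1.norm.pow 2).const_mul z).add
      (((Complex.continuous_im.tendsto _).comp (t1.inner t2)).const_mul _)
  have hlim2 : Tendsto (fun R : ℝ => nu * ((s1 ^ 2 + s2) * ‖u‖ ^ 2) / R ^ 2) atTop (𝓝 0) :=
    tendsto_const_nhds.div_atTop (tendsto_pow_atTop two_ne_zero)
  have hfin := le_of_tendsto_of_tendsto hlim1 hlim2
    ((eventually_gt_atTop 0).mono fun R hR => key R hR)
  rw [im_inner_greenL] at hfin
  have : ‖u‖ = 0 := by
    by_contra hne
    have : 0 < ‖u‖ ^ 2 := by positivity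
    nlinarith [mul_pos hz0 this]
  exact norm_eq_zero.1 this

end ModeUniqueness

/-! ### The closed mode operator: resolvent and maximality. -/

section ModeRange

open SchwartzMap
open scoped SchwartzMap

/-- The maximal mode operator, as a closed linear relation on `L²(ℝ)`. -/
def modeGraph (nu k : ℝ) : Submodule ℂ (LR × LR) := closedGraph toL (modeS nu k)

theorem isClosed_modeGraph (nu k : ℝ) : IsClosed (modeGraph nu k : Set (LR × LR)) :=
  Submodule.isClosed_topologicalClosure _

theorem modeGraph_induction {nu k : ℝ} {P : LR × LR → Prop} (hP : IsClosed {p | P p})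
    (h : ∀ v, P (toL v, toL (modeS nu k v))) {p : LR × LR} (hp : p ∈ modeGraph nu k) : P p := by
  refine closure_minimal (s := (LinearMap.range (toL.prod (toL ∘ₗ modeS nu k)) : Set (LR × LR)))
    ?_ hP hp
  rintro _ ⟨v, rfl⟩
  exact h v

theorem toL_mem_modeGraph (nu k : ℝ) (v : 𝓢(ℝ, ℂ)) :
    (toL v, toL (modeS nu k v)) ∈ modeGraph nu k :=
  Submodule.le_topologicalClosure _ ⟨v, rfl⟩

/-- The formal adjoint reverses the sign of `k`; this is why weak formulations below involve `-k`.
-/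
theorem inner_modeS_comm (nu k : ℝ) (v w : 𝓢(ℝ, ℂ)) :
    inner ℂ (toL v) (toL (modeS nu k w)) = inner ℂ (toL (modeS nu (-k) v)) (toL w) := by
  rw [inner_modeS, ← inner_conj_symm, inner_modeS]
  simp only [map_add, map_mul, map_sub, map_pow, Complex.conj_I, Complex.conj_ofReal, map_ofNat,
    inner_conj_symm]
  rw [Yop_symm, Yop_symm, Gop_neg, Gop_symm, Dop_skew, ← neg_eq_iff_eq_neg.2 (Dop_skew v (Dop w))]
  push_cast
  ring

theorem inner_of_mem_modeGraph {nu k : ℝ} {p : LR × LR} (hp : p ∈ modeGraph nu k) (θ : 𝓢(ℝ, ℂ)) :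
    inner ℂ (toL θ) p.2 = inner ℂ (toL (modeS nu (-k) θ)) p.1 :=
  modeGraph_induction (P := fun p => inner ℂ (toL θ) p.2 = inner ℂ (toL (modeS nu (-k) θ)) p.1)
    (isClosed_eq (by fun_prop) (by fun_prop)) (fun v => inner_modeS_comm nu k θ v) hp

theorem re_inner_modeS (nu k : ℝ) (v : 𝓢(ℝ, ℂ)) :
    (inner ℂ (toL (modeS nu k v)) (toL v)).re
      = -nu * (‖toL (Dop v)‖ ^ 2 + k ^ 2 * ‖toL v‖ ^ 2) := by
  have h1 : (inner ℂ (toL (Yop (Yop v))) (toL v)).im = 0 := by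
    rw [← Complex.conj_eq_iff_im, inner_conj_symm, Yop_symm, Yop_symm]
  have h2 : (inner ℂ (toL (Gop k v)) (toL v)).im = 0 := by
    rw [← Complex.conj_eq_iff_im, inner_conj_symm, Gop_symm]
  have h3 : inner ℂ (toL (Dop (Dop v))) (toL v) = -((‖toL (Dop v)‖ ^ 2 : ℝ) : ℂ) := by
    rw [Dop_skew, inner_self_eq_norm_sq_to_K]; push_cast; rfl
  have h4 : inner ℂ (toL v) (toL v) = ((‖toL v‖ ^ 2 : ℝ) : ℂ) := by
    rw [inner_self_eq_norm_sq_to_K]; push_cast; rfl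
  rw [inner_modeS, h3, h4]
  simp only [← Complex.ofReal_pow, ← Complex.ofReal_neg, ← Complex.ofReal_mul,
    ← Complex.ofReal_sub, Complex.add_re, Complex.mul_re, Complex.mul_im,
    Complex.add_im, Complex.I_re, Complex.I_im, Complex.ofReal_re,
    Complex.ofReal_im, Complex.re_ofNat, Complex.im_ofNat, h1, h2]
  ring

theorem re_inner_le_of_mem_modeGraph {nu k : ℝ} (hnu : 0 ≤ nu) {p : LR × LR}
    (hp : p ∈ modeGraph nu k) : (inner ℂ p.2 p.1).re ≤ -(nu * k ^ 2) * ‖p.1‖ ^ 2 := by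
  refine modeGraph_induction (P := fun p => (inner ℂ p.2 p.1).re ≤ -(nu * k ^ 2) * ‖p.1‖ ^ 2)
    (isClosed_le (by fun_prop) (by fun_prop)) (fun v => ?_) hp
  simp only
  rw [re_inner_modeS]
  nlinarith [mul_nonneg hnu (sq_nonneg ‖toL (Dop v)‖)]

/-- Dissipativity bounds `λ - A` from below on its closed graph, so the range is closed. A vector
orthogonal to the range solves the weak equation of `eq_zero_of_weak` and therefore vanishes. -/
theorem modeGraph_resolvent {nu k lam : ℝ} (hnu : 0 < nu) (hlam : 0 < lam) (f : LR) :
    ∃ u, (u, lam • u - f) ∈ modeGraph nu k := by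
  have hdiss : ∀ p ∈ modeGraph nu k, (inner ℂ p.2 p.1).re ≤ 0 := fun p hp =>
    (re_inner_le_of_mem_modeGraph hnu.le hp).trans
      (mul_nonpos_of_nonpos_of_nonneg (by simp; positivity) (by positivity))
  let L : modeGraph nu k →L[ℂ] LR :=
    ((lam : ℂ) • ContinuousLinearMap.fst ℂ LR LR - ContinuousLinearMap.snd ℂ LR LR).comp
      (modeGraph nu k).subtypeL
  have hL : ∀ p : modeGraph nu k, L p = lam • (p : LR × LR).1 - (p : LR × LR).2 := fun p => rfl
  have hsub : ∀ p : modeGraph nu k, lam • (p : LR × LR).1 - L p = (p : LR × LR).2 := fun p => by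
    rw [hL]; abel
  have hb : ∀ p : modeGraph nu k, ‖p‖ ≤ ((⟨lam⁻¹ + 2, by positivity⟩ : NNReal) : ℝ) * ‖L p‖ := by
    intro p
    have h1 : lam * ‖(p : LR × LR).1‖ ≤ ‖L p‖ := by
      refine resolvent_bound hdiss (f := (p : LR × LR).1) (lam := lam) (h := L p) ?_
      exact (congrArg (fun z => ((p : LR × LR).1, z) ∈ modeGraph nu k) (hsub p)).mpr p.2
    have h2 : ‖(p : LR × LR).2‖ ≤ 2 * ‖L p‖ := by
      have : (p : LR × LR).2 = lam • (p : LR × LR).1 - L p := by rw [hL]; abel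
      rw [this]
      refine (norm_sub_le _ _).trans ?_
      rw [norm_smul, Real.norm_eq_abs, abs_of_pos hlam]
      linarith
    have h3 : ‖(p : LR × LR).1‖ ≤ lam⁻¹ * ‖L p‖ := by
      rw [inv_mul_eq_div, le_div_iff₀ hlam]; linarith
    have h4 : 0 ≤ lam⁻¹ * ‖L p‖ := by positivity
    change max ‖(p : LR × LR).1‖ ‖(p : LR × LR).2‖ ≤ (lam⁻¹ + 2) * ‖L p‖
    rw [add_mul]
    exact max_le (by linarith [norm_nonneg (L p)]) (by linarith)
  have hcl : IsClosed (Set.range L) := by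
    have : CompleteSpace (modeGraph nu k) := (isClosed_modeGraph nu k).completeSpace_coe
    exact (L.antilipschitz_of_bound hb).isClosed_range L.uniformContinuous
  have hdense : LinearMap.range (L : modeGraph nu k →ₗ[ℂ] LR) = ⊤ := by
    have hc : IsClosed (LinearMap.range (L : modeGraph nu k →ₗ[ℂ] LR) : Set LR) := by
      rw [LinearMap.coe_range]; exact hcl
    have : CompleteSpace (LinearMap.range (L : modeGraph nu k →ₗ[ℂ] LR)) := hc.completeSpace_coe
    rw [← Submodule.orthogonal_eq_bot_iff, eq_bot_iff]
    intro u hu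
    rw [Submodule.mem_orthogonal] at hu
    refine (Submodule.mem_bot ℂ).2 (eq_zero_of_weak (k := k) hnu hlam fun θ _ => ?_)
    have := hu _ ⟨⟨_, toL_mem_modeGraph nu k θ⟩, rfl⟩
    change inner ℂ ((lam : ℂ) • toL θ - toL (modeS nu k θ)) u = 0 at this
    rw [inner_sub_left, inner_smul_left, Complex.conj_ofReal, sub_eq_zero] at this
    exact this.symm
  have hf : f ∈ LinearMap.range (L : modeGraph nu k →ₗ[ℂ] LR) := by rw [hdense]; trivial
  obtain ⟨p, hp⟩ := hf
  refine ⟨(p : LR × LR).1, ?_⟩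
  have hp' : L p = f := hp
  rw [← hp', hsub]
  exact p.2

/-- Weak equals strong: subtract the resolvent solution with the same right side `u - h`. The
difference solves a homogeneous weak resolvent equation and is zero by uniqueness. -/
theorem mem_modeGraph_of_weak {nu k : ℝ} (hnu : 0 < nu) {u h : LR}
    (hw : ∀ θ : 𝓢(ℝ, ℂ), HasCompactSupport θ →
      inner ℂ (toL θ) h = inner ℂ (toL (modeS nu (-k) θ)) u) : (u, h) ∈ modeGraph nu k := by
  obtain ⟨u', hu'⟩ := modeGraph_resolvent (k := k) hnu one_pos (u - h)
  rw [one_smul] at hu'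
  have hz : u - u' = 0 := by
    refine eq_zero_of_weak (k := -k) hnu one_pos fun θ hθ => ?_
    have h1 := inner_of_mem_modeGraph hu' θ
    simp only [inner_sub_right] at h1 ⊢
    rw [← hw θ hθ, ← h1]
    push_cast
    ring
  rw [sub_eq_zero] at hz
  subst hz
  simpa using hu'

theorem modeGraph_snd_eq_zero {nu k : ℝ} {h : LR} (hh : ((0 : LR), h) ∈ modeGraph nu k) :
    h = 0 := by
  have h1 := inner_of_mem_modeGraph hh
  simp only [inner_zero_right] at h1
  refine ext_inner_left ℂ fun z => ?_
  rw [inner_zero_right]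
  exact denseRange_toL.induction_on z (isClosed_eq (by fun_prop) (by fun_prop)) h1

end ModeRange

/-! ### Orthogonal decomposition of `L²(𝕋 × ℝ)` into Fourier modes in `x`. -/

section FourierModes

open scoped ComplexConjugate

theorem integral_fourier (n : ℤ) :
    ∫ x : AddCircle (2 * Real.pi), fourier n x = if n = 0 then (2 * Real.pi : ℂ) else 0 := by
  have h := fourierCoeff_fourier (T := 2 * Real.pi) n
  have h0 : fourierCoeff (fourier n : AddCircle (2 * Real.pi) → ℂ) 0
      = if n = 0 then (1 : ℂ) else 0 := by
    rw [h]; by_cases hn : n = 0 <;> simp [hn, eq_comm]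
  rw [fourierCoeff, AddCircle.integral_haarAddCircle] at h0
  simp only [neg_zero, fourier_zero, one_smul] at h0
  have hpi : (2 * Real.pi : ℂ) ≠ 0 := by exact_mod_cast Real.two_pi_pos.ne'
  rw [Complex.real_smul] at h0
  push_cast at h0
  rw [inv_mul_eq_iff_eq_mul₀ hpi] at h0
  rw [h0]; split_ifs <;> simp

/-- The normalization constant `(2π)^{-1/2}`. -/
def cnorm : ℝ := (Real.sqrt (2 * Real.pi))⁻¹

theorem cnorm_sq : cnorm * cnorm * (2 * Real.pi) = 1 := by
  rw [cnorm, ← mul_inv, Real.mul_self_sqrt Real.two_pi_pos.le, inv_mul_cancel₀ Real.two_pi_pos.ne']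

theorem cnorm_ne_zero : cnorm ≠ 0 := by
  rw [cnorm]; positivity

/-- The function `(2π)^{-1/2} e^{ikx} u(y)` on the cylinder. -/
def modeFun (k : ℤ) (u : ℝ → ℂ) (p : Cyl) : ℂ := cnorm * fourier k p.1 * u p.2

theorem memLp_modeFun (k : ℤ) {u : ℝ → ℂ} (hu : MemLp u 2) :
    MemLp (modeFun k u) 2 (volume : Measure Cyl) := by
  have h1 : MemLp (fun p : Cyl => u p.2) 2 (volume : Measure Cyl) := hu.comp_snd _
  refine MemLp.of_le_mul (c := |cnorm|) h1 ?_ (Eventually.of_forall fun p => ?_)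
  · refine AEStronglyMeasurable.mul ?_ h1.1
    exact Continuous.aestronglyMeasurable
      (continuous_const.mul ((fourier k).continuous.comp continuous_fst))
  · rw [modeFun, norm_mul, norm_mul, Complex.norm_real, fourier_apply, Circle.norm_coe, mul_one,
      Real.norm_eq_abs]

theorem modeFun_congr (k : ℤ) {u v : ℝ → ℂ} (h : u =ᵐ[volume] v) :
    modeFun k u =ᵐ[(volume : Measure Cyl)] modeFun k v := by
  have := Measure.quasiMeasurePreserving_snd.ae_eq
    (μa := (volume : Measure Cyl)) (μb := (volume : Measure ℝ)) h
  filter_upwards [this] with p hp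
  simp only [Function.comp] at hp
  rw [modeFun, modeFun, hp]

/-- Inner products with separated functions. -/
theorem integral_modeFun_mul (k l : ℤ) (u v : ℝ → ℂ) :
    ∫ p : Cyl, conj (modeFun k u p) * modeFun l v p
      = if k = l then ∫ y, conj (u y) * v y else 0 := by
  have h1 : ∀ p : Cyl, conj (modeFun k u p) * modeFun l v p
      = (cnorm * cnorm * fourier (l - k) p.1 : ℂ) * (conj (u p.2) * v p.2) := by
    intro p
    rw [sub_eq_add_neg, fourier_add, fourier_neg, modeFun, modeFun]
    simp only [map_mul, Complex.conj_ofReal]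
    ring
  simp_rw [h1]
  have h2 := integral_prod_mul (μ := (volume : Measure (AddCircle (2 * Real.pi))))
    (ν := (volume : Measure ℝ)) (fun x => (cnorm * cnorm * fourier (l - k) x : ℂ))
    (fun y => conj (u y) * v y)
  refine h2.trans ?_
  rw [integral_const_mul, integral_fourier]
  have hc := congrArg (fun x : ℝ => (x : ℂ)) cnorm_sq
  push_cast at hc
  by_cases h : k = l
  · rw [if_pos h, if_pos (by omega), hc, one_mul]
  · rw [if_neg h, if_neg (by omega), mul_zero, zero_mul]

theorem inner_L2_eq (f g : L2) : inner ℂ f g = ∫ p, conj (f p) * g p := by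
  rw [L2.inner_def]
  simp [RCLike.inner_apply, mul_comm]

theorem inner_LR_eq (f g : LR) : inner ℂ f g = ∫ p, conj (f p) * g p := by
  rw [L2.inner_def]
  simp [RCLike.inner_apply, mul_comm]

theorem inner_toLp_left {F : Cyl → ℂ} (hF : MemLp F 2 volume) (g : L2) :
    inner ℂ (hF.toLp F) g = ∫ p, conj (F p) * g p := by
  rw [inner_L2_eq]
  refine integral_congr_ae ?_
  filter_upwards [hF.coeFn_toLp] with p hp
  rw [hp]

theorem inner_toLp_toLp {F G : Cyl → ℂ} (hF : MemLp F 2 volume) (hG : MemLp G 2 volume) :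
    inner ℂ (hF.toLp F) (hG.toLp G) = ∫ p, conj (F p) * G p := by
  rw [inner_toLp_left]
  refine integral_congr_ae ?_
  filter_upwards [hG.coeFn_toLp] with p hp
  rw [hp]

/-- The linear map `u ↦ (2π)^{-1/2} e^{ikx} u(y)`. -/
def modeLin (k : ℤ) : LR →ₗ[ℂ] L2 where
  toFun u := (memLp_modeFun k (Lp.memLp u)).toLp _
  map_add' u v := by
    rw [← MemLp.toLp_add]
    refine MemLp.toLp_congr _ _ ((modeFun_congr k (Lp.coeFn_add u v)).trans ?_)
    refine Eventually.of_forall fun p => ?_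
    simp [modeFun, mul_add]
  map_smul' c u := by
    rw [RingHom.id_apply, ← MemLp.toLp_const_smul]
    refine MemLp.toLp_congr _ _ ((modeFun_congr k (Lp.coeFn_smul c u)).trans ?_)
    refine Eventually.of_forall fun p => ?_
    simp only [modeFun, Pi.smul_apply, smul_eq_mul]
    ring

theorem inner_modeLin (k l : ℤ) (u v : LR) :
    inner ℂ (modeLin k u) (modeLin l v) = if k = l then inner ℂ u v else 0 := by
  refine (inner_toLp_toLp (memLp_modeFun k (Lp.memLp u)) (memLp_modeFun l (Lp.memLp v))).trans ?_
  rw [integral_modeFun_mul, inner_LR_eq]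

/-- The isometry `u ↦ (2π)^{-1/2} e^{ikx} u(y)` onto the `k`-th Fourier mode. -/
def modeEmb (k : ℤ) : LR →ₗᵢ[ℂ] L2 where
  toLinearMap := modeLin k
  norm_map' u := by
    rw [@norm_eq_sqrt_re_inner ℂ, @norm_eq_sqrt_re_inner ℂ, inner_modeLin, if_pos rfl]

theorem modeEmb_eq (k : ℤ) (u : LR) : modeEmb k u = (memLp_modeFun k (Lp.memLp u)).toLp _ := rfl

theorem inner_modeEmb (k : ℤ) (u : LR) (f : L2) :
    inner ℂ (modeEmb k u) f = ∫ p, conj (modeFun k u p) * f p := by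
  rw [modeEmb_eq, inner_toLp_left]

theorem orthogonal_modeEmb : OrthogonalFamily ℂ (fun _ : ℤ => LR) modeEmb := by
  intro k l hkl u v
  exact (inner_modeLin k l u v).trans (if_neg hkl)

theorem integral_modeFun_left (k : ℤ) (u : LR) (f : L2) :
    ∫ p, conj (modeFun k u p) * f p
      = ∫ y, conj (u y) * (cnorm * ∫ x, fourier (-k) x * f (x, y)) := by
  have hi : Integrable (fun p : Cyl => conj (modeFun k u p) * f p) := by
    have h1 := (memLp_modeFun k (Lp.memLp u))
    have := MemLp.integrable_mul (p := 2) (q := 2) h1.star (Lp.memLp f)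
    exact this
  refine (integral_prod_symm _ hi).trans (integral_congr_ae (Eventually.of_forall fun y => ?_))
  simp only
  rw [← mul_assoc, ← integral_const_mul]
  refine integral_congr_ae (Eventually.of_forall fun x => ?_)
  simp only [modeFun, map_mul, Complex.conj_ofReal, fourier_neg]
  ring

/-- Testing with indicators in `y` shows that for almost every `y` all Fourier coefficients of the
slice vanish, so the slice vanishes by completeness of the Fourier basis; Fubini concludes. -/
theorem eq_zero_of_inner_modeEmb {f : L2} (h : ∀ k u, inner ℂ (modeEmb k u) f = 0) : f = 0 := by
  have hfi : ∀ s : Set ℝ, MeasurableSet s → volume s < ⊤ → ∀ k : ℤ,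
      Integrable (fun p : Cyl => fourier (-k) p.1 * f p)
        ((volume : Measure (AddCircle (2 * Real.pi))).prod (volume.restrict s)) := by
    intro s hs hfin k
    have hr : ((volume : Measure (AddCircle (2 * Real.pi))).prod (volume.restrict s))
        = (volume : Measure Cyl).restrict (univ ×ˢ s) := by
      rw [Measure.volume_eq_prod, ← Measure.prod_restrict, Measure.restrict_univ]
    rw [hr]
    have : Fact ((volume : Measure Cyl) (univ ×ˢ s) < ⊤) := ⟨by
      rw [Measure.volume_eq_prod, Measure.prod_prod]
      exact ENNReal.mul_lt_top (measure_lt_top _ _) hfin⟩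
    have hf1 : Integrable f ((volume : Measure Cyl).restrict (univ ×ˢ s)) :=
      ((Lp.memLp f).restrict _).integrable (by norm_num)
    refine hf1.bdd_mul (c := 1) ?_ (Eventually.of_forall fun p => ?_)
    · exact ((fourier (-k)).continuous.comp continuous_fst).aestronglyMeasurable
    · rw [fourier_apply, Circle.norm_coe]
  have hF : ∀ k : ℤ, ∀ᵐ y : ℝ, ∫ x, fourier (-k) x * f (x, y) = 0 := by
    intro k
    refine ae_eq_zero_of_forall_setIntegral_eq_of_sigmaFinite
      (f := fun y => ∫ x, fourier (-k) x * f (x, y)) (fun s hs hfin => ?_) (fun s hs hfin => ?_)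
    · exact (hfi s hs hfin k).integral_prod_right
    · have h1 := h k (indicatorConstLp 2 hs hfin.ne 1)
      rw [inner_modeEmb, integral_modeFun_left] at h1
      have h2 : ∫ y, conj ((indicatorConstLp 2 hs hfin.ne (1 : ℂ) : LR) y)
          * (cnorm * ∫ x, fourier (-k) x * f (x, y))
          = ∫ y, s.indicator (fun y => cnorm * ∫ x, fourier (-k) x * f (x, y)) y := by
        refine integral_congr_ae ?_
        filter_upwards [indicatorConstLp_coeFn (p := 2) (hs := hs) (hμs := hfin.ne) (c := (1 : ℂ))]
          with y hy
        rw [hy]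
        by_cases hys : y ∈ s <;> simp [hys]
      rw [h2, integral_indicator hs, integral_const_mul] at h1
      exact (mul_eq_zero.1 h1).resolve_left (by exact_mod_cast cnorm_ne_zero)
  have hsec : ∀ᵐ y : ℝ, MemLp (fun x : AddCircle (2 * Real.pi) => f (x, y)) 2 volume := by
    have hf : MemLp f 2 (volume : Measure Cyl) := Lp.memLp f
    have h1 : ∀ᵐ y : ℝ, AEStronglyMeasurable (fun x : AddCircle (2 * Real.pi) => f (x, y)) volume :=
      hf.1.prod_swap.prodMk_left
    have h2 : ∀ᵐ y : ℝ, Integrable (fun x : AddCircle (2 * Real.pi) => ‖f (x, y)‖ ^ 2) volume := by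
      have hi : Integrable (fun p : Cyl => ‖f p‖ ^ 2) :=
        hf.integrable_norm_pow (by norm_num)
      exact hi.prod_left_ae
    filter_upwards [h1, h2] with y hy1 hy2
    exact (memLp_two_iff_integrable_sq_norm hy1).2 hy2
  have hz : ∀ᵐ y : ℝ, ∫⁻ x : AddCircle (2 * Real.pi), ‖f (x, y)‖ₑ = 0 := by
    filter_upwards [ae_all_iff.2 hF, hsec] with y hy hm
    have hm' := memLp_haarAddCircle_iff.2 hm
    have hcoef : fourierBasis.repr (hm'.toLp _) = 0 := by
      ext k
      rw [fourierBasis_repr]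
      have : fourierCoeff (hm'.toLp fun x => f (x, y)) k = fourierCoeff (fun x => f (x, y)) k :=
        congrFun (fourierCoeff_congr_ae hm'.coeFn_toLp) k
      rw [this, fourierCoeff, AddCircle.integral_haarAddCircle]
      simp only [smul_eq_mul, hy k]
      simp
    have h0 : hm'.toLp (fun x => f (x, y)) = 0 := by simpa using hcoef
    have h1 : ∀ᵐ x ∂(AddCircle.haarAddCircle (T := 2 * Real.pi)), f (x, y) = 0 := by
      have h2 := hm'.coeFn_toLp
      rw [h0] at h2
      filter_upwards [h2, Lp.coeFn_zero ℂ 2 (AddCircle.haarAddCircle (T := 2 * Real.pi))]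
        with x hx hx0
      rw [← hx, hx0]; rfl
    have h2 : ∀ᵐ x : AddCircle (2 * Real.pi), f (x, y) = 0 := by
      rw [AddCircle.volume_eq_smul_haarAddCircle]
      exact Measure.ae_smul_measure h1 _
    refine (lintegral_congr_ae (g := fun _ => 0) ?_).trans (by simp)
    filter_upwards [h2] with x hx
    simp [hx]
  have hm : AEMeasurable (fun p : Cyl => ‖f p‖ₑ) := (Lp.memLp f).1.enorm
  have : ∫⁻ p : Cyl, ‖f p‖ₑ = 0 := by
    refine (lintegral_prod_symm _ hm).trans ?_
    refine (lintegral_congr_ae (g := fun _ => 0) hz).trans (by simp)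
  rw [lintegral_eq_zero_iff' hm] at this
  refine (Lp.eq_zero_iff_ae_eq_zero).2 ?_
  filter_upwards [this] with p hp
  simpa using hp

theorem isHilbertSum_modeEmb : IsHilbertSum ℂ (fun _ : ℤ => LR) modeEmb := by
  refine IsHilbertSum.mk orthogonal_modeEmb ?_
  rw [top_le_iff, Submodule.topologicalClosure_eq_top_iff, eq_bot_iff]
  intro f hf
  refine (Submodule.mem_bot ℂ).2 (eq_zero_of_inner_modeEmb fun k u => ?_)
  exact (Submodule.mem_orthogonal _ _).1 hf _
    ((le_iSup (fun i => LinearMap.range (modeEmb i).toLinearMap) k) ⟨u, rfl⟩)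

/-- The `k`-th Fourier coefficient in `x`. -/
def modeCoef (k : ℤ) : L2 →L[ℂ] LR := (modeEmb k).toContinuousLinearMap.adjoint

theorem inner_modeCoef (k : ℤ) (u : LR) (f : L2) :
    inner ℂ u (modeCoef k f) = inner ℂ (modeEmb k u) f :=
  ContinuousLinearMap.adjoint_inner_right _ _ _

theorem modeCoef_modeEmb (k l : ℤ) (u : LR) :
    modeCoef k (modeEmb l u) = if k = l then u else 0 := by
  refine ext_inner_left ℂ fun v => ?_
  rw [inner_modeCoef]
  refine (inner_modeLin k l v u).trans ?_
  split_ifs <;> simp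

theorem modeCoef_eq_repr (k : ℤ) (f : L2) :
    modeCoef k f = isHilbertSum_modeEmb.linearIsometryEquiv f k := by
  set F := isHilbertSum_modeEmb.linearIsometryEquiv f with hF
  have h := isHilbertSum_modeEmb.hasSum_linearIsometryEquiv_symm F
  rw [hF, LinearIsometryEquiv.symm_apply_apply, ← hF] at h
  have h2 := h.mapL (modeCoef k)
  have h3 : HasSum (fun l => modeCoef k (modeEmb l (F l))) (F k) := by
    convert hasSum_ite_eq k (F k) using 2 with l
    rw [modeCoef_modeEmb]
    by_cases hl : k = l
    · subst hl; simp
    · simp [hl, Ne.symm hl]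
  exact h2.unique h3

theorem hasSum_modes (f : L2) : HasSum (fun k => modeEmb k (modeCoef k f)) f := by
  have h := isHilbertSum_modeEmb.hasSum_linearIsometryEquiv_symm
    (isHilbertSum_modeEmb.linearIsometryEquiv f)
  rw [LinearIsometryEquiv.symm_apply_apply] at h
  simpa only [modeCoef_eq_repr] using h

theorem hasSum_inner_modes (f g : L2) :
    HasSum (fun k => inner ℂ (modeCoef k f) (modeCoef k g)) (inner ℂ f g) := by
  have h := (hasSum_modes g).mapL (innerSL ℂ f)
  have e : ∀ k, inner ℂ (modeCoef k f) (modeCoef k g) = innerSL ℂ f (modeEmb k (modeCoef k g)) := by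
    intro k
    rw [innerSL_apply_apply, ← inner_conj_symm, inner_modeCoef, inner_conj_symm]
  simp_rw [e]
  exact h

theorem hasSum_norm_sq_modes (f : L2) : HasSum (fun k => ‖modeCoef k f‖ ^ 2) (‖f‖ ^ 2) := by
  have h := Complex.hasSum_re (hasSum_inner_modes f f)
  have e : ∀ (E : Type) [NormedAddCommGroup E] [InnerProductSpace ℂ E] (x : E),
      (inner ℂ x x).re = ‖x‖ ^ 2 := fun E _ _ x => by
    exact inner_self_eq_norm_sq (𝕜 := ℂ) x
  simpa only [e] using h

theorem ext_modes {f g : L2} (h : ∀ k, modeCoef k f = modeCoef k g) : f = g := by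
  have h1 := hasSum_modes f
  simp only [h] at h1
  exact h1.unique (hasSum_modes g)

theorem exists_of_summable_modes {b : ℤ → LR} (hb : Summable fun k => ‖b k‖ ^ 2) :
    ∃ f : L2, ∀ k, modeCoef k f = b k := by
  have hm : Memℓp b 2 := by
    rw [memℓp_gen_iff (by norm_num)]
    simpa using hb
  refine ⟨isHilbertSum_modeEmb.linearIsometryEquiv.symm ⟨b, hm⟩, fun k => ?_⟩
  rw [modeCoef_eq_repr, LinearIsometryEquiv.apply_symm_apply]

theorem summable_norm_sq_modes (f : L2) : Summable fun k => ‖modeCoef k f‖ ^ 2 :=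
  (hasSum_norm_sq_modes f).summable

theorem P0_eq (f : L2) : P0 f = modeEmb 0 (modeCoef 0 f) := by
  refine sub_eq_zero.1 (eq_zero_of_inner_modeEmb fun k u => ?_)
  rw [inner_sub_right, sub_eq_zero, ← inner_modeCoef k u (modeEmb 0 _), modeCoef_modeEmb]
  have h1 : inner ℂ (modeEmb k u) (P0 f) = ∫ p : Cyl, conj (modeFun k u p) * xMean f p := by
    rw [modeEmb_eq]; exact inner_toLp_toLp _ _
  have h2 : ∀ p : Cyl, conj (modeFun k u p) * xMean f p
      = (fourier (-k) p.1 : ℂ) * (conj (u p.2) * (cnorm * ((2 * Real.pi : ℂ)⁻¹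
        * ∫ x : AddCircle (2 * Real.pi), f (x, p.2)))) := by
    intro p
    simp only [modeFun, xMean, map_mul, Complex.conj_ofReal, fourier_neg]
    ring
  simp_rw [h2] at h1
  have h3 := integral_prod_mul (μ := (volume : Measure (AddCircle (2 * Real.pi))))
    (ν := (volume : Measure ℝ)) (fun x => (fourier (-k) x : ℂ))
    (fun y => conj (u y) * (cnorm * ((2 * Real.pi : ℂ)⁻¹
        * ∫ x : AddCircle (2 * Real.pi), f (x, y))))
  rw [h1]
  refine h3.trans ?_
  rw [integral_fourier]
  by_cases hk : k = 0
  · subst hk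
    rw [if_pos rfl, if_pos neg_zero, inner_modeCoef, inner_modeEmb, integral_modeFun_left,
      ← integral_const_mul]
    refine integral_congr_ae (Eventually.of_forall fun y => ?_)
    have hpi : (Real.pi : ℂ) ≠ 0 := by exact_mod_cast Real.pi_ne_zero
    simp only [neg_zero, fourier_zero, one_mul]
    field_simp
  · rw [if_neg hk, if_neg (by simpa using hk), zero_mul, inner_zero_right]

theorem modeCoef_P0 (k : ℤ) (f : L2) :
    modeCoef k (P0 f) = if k = 0 then modeCoef 0 f else 0 := by
  rw [P0_eq, modeCoef_modeEmb]

theorem P0_eq_zero_iff (f : L2) : P0 f = 0 ↔ modeCoef 0 f = 0 := by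
  rw [P0_eq]
  exact (modeEmb 0).toLinearMap.map_eq_zero_iff (modeEmb 0).injective

theorem modeCoef_Pneq (k : ℤ) (f : L2) :
    modeCoef k (Pneq f) = if k = 0 then 0 else modeCoef k f := by
  rw [Pneq, map_sub, modeCoef_P0]
  split_ifs with h
  · subst h; simp
  · simp

end FourierModes

/-! ### Calculus with test functions on the cylinder and integration by parts against modes. -/

section Tests

open SchwartzMap
open scoped SchwartzMap ComplexConjugate

/-- A function on the cylinder, as a function on the plane. -/
def pull (φ : Cyl → ℂ) (p : ℝ × ℝ) : ℂ := φ ((p.1 : AddCircle (2 * Real.pi)), p.2)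

/-- Smooth functions on the cylinder. -/
def IsSmooth (φ : Cyl → ℂ) : Prop := ContDiff ℝ ∞ (pull φ)

/-- Smoothness is defined on the covering plane; this is what brings continuity back to the
cylinder. -/
theorem isOpenQuotientMap_cover : IsOpenQuotientMap
    fun p : ℝ × ℝ => (((p.1 : AddCircle (2 * Real.pi)), p.2) : Cyl) :=
  (QuotientAddGroup.isOpenQuotientMap_mk (N := AddSubgroup.zmultiples (2 * Real.pi))).prodMap
    IsOpenQuotientMap.id

theorem cover_surjective (p : Cyl) : ∃ q : ℝ × ℝ, p = ((q.1 : AddCircle (2 * Real.pi)), q.2) := by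
  obtain ⟨q, hq⟩ := isOpenQuotientMap_cover.surjective p
  exact ⟨q, hq.symm⟩

namespace IsSmooth

variable {φ ψ : Cyl → ℂ}

theorem continuous (h : IsSmooth φ) : Continuous φ :=
  isOpenQuotientMap_cover.isQuotientMap.continuous_iff.2 (ContDiff.continuous h)

theorem hasDerivAt_fst (h : IsSmooth φ) (s y : ℝ) :
    HasDerivAt (fun t : ℝ => φ ((t : AddCircle (2 * Real.pi)), y)) (fderiv ℝ (pull φ) (s, y) (1, 0)) s := by
  have h1 : HasFDerivAt (pull φ) (fderiv ℝ (pull φ) (s, y)) (s, y) :=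
    (ContDiff.differentiable h (by simp) (s, y)).hasFDerivAt
  have h2 : HasDerivAt (fun t : ℝ => (t, y)) ((1 : ℝ), (0 : ℝ)) s :=
    (hasDerivAt_id s).prodMk (hasDerivAt_const s y)
  exact h1.comp_hasDerivAt s h2

theorem hasDerivAt_snd (h : IsSmooth φ) (s y : ℝ) :
    HasDerivAt (fun t : ℝ => φ ((s : AddCircle (2 * Real.pi)), t)) (fderiv ℝ (pull φ) (s, y) (0, 1)) y := by
  have h1 : HasFDerivAt (pull φ) (fderiv ℝ (pull φ) (s, y)) (s, y) :=
    (ContDiff.differentiable h (by simp) (s, y)).hasFDerivAt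
  have h2 : HasDerivAt (fun t : ℝ => (s, t)) ((0 : ℝ), (1 : ℝ)) y :=
    (hasDerivAt_const y s).prodMk (hasDerivAt_id y)
  exact h1.comp_hasDerivAt y h2

theorem pull_dx (h : IsSmooth φ) (p : ℝ × ℝ) : pull (dx φ) p = fderiv ℝ (pull φ) p (1, 0) := by
  have h1 := h.hasDerivAt_fst p.1 p.2
  have h2 : HasDerivAt (fun t : ℝ => φ (((p.1 : AddCircle (2 * Real.pi)) + (t : AddCircle _)), p.2))
      (fderiv ℝ (pull φ) p (1, 0)) 0 := by
    have h3 : HasDerivAt (fun t : ℝ => p.1 + t) 1 0 := (hasDerivAt_id 0).const_add p.1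
    have h4 := HasDerivAt.scomp (h := fun t : ℝ => p.1 + t) 0 (by simpa using h1) h3
    simpa [Function.comp_def] using h4
  exact h2.deriv

theorem pull_dy (h : IsSmooth φ) (p : ℝ × ℝ) : pull (dy φ) p = fderiv ℝ (pull φ) p (0, 1) :=
  (h.hasDerivAt_snd p.1 p.2).deriv

theorem dx (h : IsSmooth φ) : IsSmooth (dx φ) := by
  have : pull (Poiseuille.dx φ) = fun p => fderiv ℝ (pull φ) p (1, 0) := funext h.pull_dx
  rw [IsSmooth, this]
  exact (ContDiff.fderiv_right h (m := ∞) (by simp)).clm_apply contDiff_const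

theorem dy (h : IsSmooth φ) : IsSmooth (dy φ) := by
  have : pull (Poiseuille.dy φ) = fun p => fderiv ℝ (pull φ) p (0, 1) := funext h.pull_dy
  rw [IsSmooth, this]
  exact (ContDiff.fderiv_right h (m := ∞) (by simp)).clm_apply contDiff_const

theorem hasDerivAt_dx (h : IsSmooth φ) (s y : ℝ) :
    HasDerivAt (fun t : ℝ => φ ((t : AddCircle (2 * Real.pi)), y))
      (Poiseuille.dx φ ((s : AddCircle (2 * Real.pi)), y)) s := by
  have := h.hasDerivAt_fst s y
  rwa [← h.pull_dx (s, y)] at this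

theorem hasDerivAt_dy (h : IsSmooth φ) (x : AddCircle (2 * Real.pi)) (y : ℝ) :
    HasDerivAt (fun t : ℝ => φ (x, t)) (Poiseuille.dy φ (x, y)) y := by
  obtain ⟨s, rfl⟩ := QuotientAddGroup.mk_surjective x
  have := h.hasDerivAt_snd s y
  rwa [← h.pull_dy (s, y)] at this

theorem dx_eq (h : IsSmooth φ) {s y : ℝ} {d : ℂ}
    (hd : HasDerivAt (fun t : ℝ => φ ((t : AddCircle (2 * Real.pi)), y)) d s) :
    Poiseuille.dx φ ((s : AddCircle (2 * Real.pi)), y) = d :=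
  (h.hasDerivAt_dx s y).unique hd

theorem mul (hφ : IsSmooth φ) (hψ : IsSmooth ψ) : IsSmooth fun p => φ p * ψ p :=
  ContDiff.mul hφ hψ

theorem conj_smooth (hφ : IsSmooth φ) : IsSmooth fun p => (starRingEnd ℂ) (φ p) :=
  Complex.conjCLE.contDiff.comp hφ

theorem dx_mul (hφ : IsSmooth φ) (hψ : IsSmooth ψ) (p : Cyl) :
    Poiseuille.dx (fun p => φ p * ψ p) p = Poiseuille.dx φ p * ψ p + φ p * Poiseuille.dx ψ p := by
  obtain ⟨q, rfl⟩ := cover_surjective p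
  exact (hφ.mul hψ).dx_eq ((hφ.hasDerivAt_dx q.1 q.2).mul (hψ.hasDerivAt_dx q.1 q.2))

theorem dy_mul (hφ : IsSmooth φ) (hψ : IsSmooth ψ) (p : Cyl) :
    Poiseuille.dy (fun p => φ p * ψ p) p = Poiseuille.dy φ p * ψ p + φ p * Poiseuille.dy ψ p :=
  ((hφ.hasDerivAt_dy p.1 p.2).mul (hψ.hasDerivAt_dy p.1 p.2)).deriv

theorem dx_conj (hφ : IsSmooth φ) (p : Cyl) :
    Poiseuille.dx (fun p => (starRingEnd ℂ) (φ p)) p = (starRingEnd ℂ) (Poiseuille.dx φ p) := by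
  obtain ⟨q, rfl⟩ := cover_surjective p
  exact hφ.conj_smooth.dx_eq
    (Complex.conjCLE.toContinuousLinearMap.hasFDerivAt.comp_hasDerivAt _ (hφ.hasDerivAt_dx q.1 q.2))

theorem dy_conj (hφ : IsSmooth φ) (p : Cyl) :
    Poiseuille.dy (fun p => (starRingEnd ℂ) (φ p)) p = (starRingEnd ℂ) (Poiseuille.dy φ p) :=
  (Complex.conjCLE.toContinuousLinearMap.hasFDerivAt.comp_hasDerivAt _
    (hφ.hasDerivAt_dy p.1 p.2)).deriv

theorem lap_conj (hφ : IsSmooth φ) (p : Cyl) :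
    lap (fun p => (starRingEnd ℂ) (φ p)) p = (starRingEnd ℂ) (lap φ p) := by
  have h1 : Poiseuille.dx (fun p => (starRingEnd ℂ) (φ p))
      = fun p => (starRingEnd ℂ) (Poiseuille.dx φ p) := funext hφ.dx_conj
  have h2 : Poiseuille.dy (fun p => (starRingEnd ℂ) (φ p))
      = fun p => (starRingEnd ℂ) (Poiseuille.dy φ p) := funext hφ.dy_conj
  rw [lap, lap, h1, h2, hφ.dx.dx_conj, hφ.dy.dy_conj, map_add]

end IsSmooth

namespace IsTest

variable {φ ψ : Cyl → ℂ}

theorem isSmooth (h : IsTest φ) : IsSmooth φ := h.smooth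

theorem smooth_mul (hφ : IsSmooth φ) (hψ : IsTest ψ) : IsTest fun p => φ p * ψ p :=
  ⟨hφ.mul hψ.isSmooth, hψ.compact.mul_left⟩

theorem dx (h : IsTest φ) : IsTest (dx φ) := by
  refine ⟨h.isSmooth.dx, h.compact.mono' fun p hp => ?_⟩
  by_contra hc
  refine hp ?_
  have h1 : φ =ᶠ[𝓝 p] 0 := notMem_tsupport_iff_eventuallyEq.1 hc
  have h2 : Tendsto (fun s : ℝ => ((p.1 + (s : AddCircle (2 * Real.pi)), p.2) : Cyl)) (𝓝 0) (𝓝 p) := by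
    have : Continuous fun s : ℝ => ((p.1 + (s : AddCircle (2 * Real.pi)), p.2) : Cyl) :=
      (continuous_const.add (AddCircle.continuous_mk' _)).prodMk continuous_const
    simpa using this.tendsto 0
  have h3 : (fun s : ℝ => φ (p.1 + (s : AddCircle (2 * Real.pi)), p.2)) =ᶠ[𝓝 0] fun _ => 0 :=
    h2.eventually h1
  rw [Poiseuille.dx, h3.deriv_eq]
  simp

theorem dy (h : IsTest φ) : IsTest (dy φ) := by
  refine ⟨h.isSmooth.dy, h.compact.mono' fun p hp => ?_⟩
  by_contra hc
  refine hp ?_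
  have h1 : φ =ᶠ[𝓝 p] 0 := notMem_tsupport_iff_eventuallyEq.1 hc
  have h2 : Tendsto (fun s : ℝ => ((p.1, s) : Cyl)) (𝓝 p.2) (𝓝 p) :=
    (Continuous.prodMk_right p.1).tendsto p.2
  have h3 : (fun s : ℝ => φ (p.1, s)) =ᶠ[𝓝 p.2] fun _ => 0 := h2.eventually h1
  rw [Poiseuille.dy, h3.deriv_eq]
  simp

theorem integrable (h : IsTest φ) : Integrable φ :=
  h.isSmooth.continuous.integrable_of_hasCompactSupport h.compact

theorem memLp (h : IsTest φ) : MemLp φ 2 volume :=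
  h.isSmooth.continuous.memLp_of_hasCompactSupport h.compact

theorem integral_dx (h : IsTest φ) : ∫ p, Poiseuille.dx φ p = 0 := by
  refine (integral_prod_symm _ h.dx.integrable).trans ?_
  have : ∀ y : ℝ, ∫ x : AddCircle (2 * Real.pi), Poiseuille.dx φ (x, y) = 0 := by
    intro y
    rw [← AddCircle.intervalIntegral_preimage (2 * Real.pi) 0]
    have hc : Continuous fun s : ℝ => Poiseuille.dx φ ((s : AddCircle (2 * Real.pi)), y) :=
      h.isSmooth.dx.continuous.comp ((AddCircle.continuous_mk' _).prodMk continuous_const)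
    rw [intervalIntegral.integral_eq_sub_of_hasDerivAt
      (fun s _ => h.isSmooth.hasDerivAt_dx s y) (hc.intervalIntegrable _ _)]
    simp [AddCircle.coe_period]
  simp [this]

theorem integral_dy (h : IsTest φ) : ∫ p, Poiseuille.dy φ p = 0 := by
  refine (integral_prod _ h.dy.integrable).trans ?_
  have hcs : ∀ ψ : Cyl → ℂ, IsTest ψ → ∀ x, Integrable fun y : ℝ => ψ (x, y) := by
    intro ψ hψ x
    have hcl : IsClosedEmbedding fun y : ℝ => ((x, y) : Cyl) :=
      ⟨isEmbedding_prodMkRight x, by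
        have : range (fun y : ℝ => ((x, y) : Cyl)) = {x} ×ˢ univ := by
          ext p; simp [Prod.ext_iff, eq_comm]
        rw [this]
        exact isClosed_singleton.prod isClosed_univ⟩
    exact (hψ.isSmooth.continuous.comp hcl.continuous).integrable_of_hasCompactSupport
      (hψ.compact.comp_isClosedEmbedding hcl)
  have : ∀ x : AddCircle (2 * Real.pi), ∫ y : ℝ, Poiseuille.dy φ (x, y) = 0 := fun x =>
    integral_eq_zero_of_hasDerivAt_of_integrable (fun y => h.isSmooth.hasDerivAt_dy x y)
      (hcs _ h.dy x) (hcs _ h x)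
  simp [this]

end IsTest

theorem isSmooth_modeFun (k : ℤ) (v : 𝓢(ℝ, ℂ)) : IsSmooth (modeFun k v) := by
  have : pull (modeFun k v) = fun p : ℝ × ℝ =>
      (cnorm : ℂ) * Complex.exp (2 * Real.pi * Complex.I * k * p.1 / (2 * Real.pi : ℝ)) * v p.2 := by
    ext p
    rw [pull, modeFun, fourier_coe_apply]
  rw [IsSmooth, this]
  have h1 : ContDiff ℝ ∞ fun p : ℝ × ℝ => ((p.1 : ℝ) : ℂ) :=
    Complex.ofRealCLM.contDiff.comp contDiff_fst
  have h2 : ContDiff ℝ ∞ fun p : ℝ × ℝ => v p.2 := (v.smooth ⊤).comp contDiff_snd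
  exact (contDiff_const.mul ((contDiff_const.mul h1).div_const _).cexp).mul h2

theorem dx_modeFun (k : ℤ) (v : 𝓢(ℝ, ℂ)) (p : Cyl) :
    dx (modeFun k v) p = Complex.I * k * modeFun k v p := by
  obtain ⟨q, rfl⟩ := cover_surjective p
  refine (isSmooth_modeFun k v).dx_eq ?_
  have h := hasDerivAt_fourier (2 * Real.pi) k q.1
  refine ((h.const_mul (cnorm : ℂ)).mul_const (v q.2)).congr_deriv ?_
  have hpi : (Real.pi : ℂ) ≠ 0 := by exact_mod_cast Real.pi_ne_zero
  rw [modeFun]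
  push_cast
  field_simp

theorem dy_modeFun (k : ℤ) (v : 𝓢(ℝ, ℂ)) (p : Cyl) :
    dy (modeFun k v) p = modeFun k (Dop v) p :=
  ((v.differentiableAt (x := p.2)).hasDerivAt.const_mul (cnorm * fourier k p.1 : ℂ)).deriv

theorem dx_const_mul (c : ℂ) (φ : Cyl → ℂ) (p : Cyl) : dx (fun p => c * φ p) p = c * dx φ p := by
  rw [dx, dx]; exact deriv_const_mul_field c

theorem lap_modeFun (k : ℤ) (v : 𝓢(ℝ, ℂ)) (p : Cyl) :
    lap (modeFun k v) p = modeFun k (Dop (Dop v) - ((k ^ 2 : ℝ) : ℂ) • v : 𝓢(ℝ, ℂ)) p := by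
  have h1 : dx (modeFun k v) = fun p => Complex.I * k * modeFun k v p := funext (dx_modeFun k v)
  have h2 : dy (modeFun k v) = modeFun k (Dop v) := funext (dy_modeFun k v)
  rw [lap, h1, h2, dx_const_mul, dx_modeFun, dy_modeFun]
  simp only [modeFun, _root_.sub_apply, _root_.smul_apply, smul_eq_mul]
  push_cast
  linear_combination (k ^ 2 * (cnorm * fourier k p.1 * v p.2) : ℂ) * Complex.I_sq

theorem isTest_conj_modeFun (k : ℤ) {θ : 𝓢(ℝ, ℂ)} (hθ : HasCompactSupport θ) :
    IsTest fun p => conj (modeFun k θ p) := by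
  refine ⟨(isSmooth_modeFun k θ).conj_smooth, ?_⟩
  refine HasCompactSupport.of_support_subset_isCompact
    (K := (univ : Set (AddCircle (2 * Real.pi))) ×ˢ tsupport θ) (isCompact_univ.prod hθ) ?_
  intro p hp
  refine ⟨trivial, subset_tsupport _ fun h0 => hp ?_⟩
  simp [modeFun, h0]

theorem integral_mul_conj_modeFun (k : ℤ) (θ : 𝓢(ℝ, ℂ)) (f : L2) :
    ∫ p, f p * conj (modeFun k θ p) = inner ℂ (toL θ) (modeCoef k f) := by
  rw [inner_modeCoef, inner_modeEmb]
  refine integral_congr_ae ?_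
  filter_upwards [modeFun_congr k (θ.coeFn_toLp 2 volume)] with p hp
  rw [mul_comm, toL_apply, hp]

theorem integral_modeEmb_toL_mul (k : ℤ) (v : 𝓢(ℝ, ℂ)) (φ : Cyl → ℂ) :
    ∫ p, modeEmb k (toL v) p * φ p = ∫ p, modeFun k v p * φ p := by
  refine integral_congr_ae ?_
  filter_upwards [modeFun_congr k (v.coeFn_toLp 2 volume),
    (memLp_modeFun k (Lp.memLp (toL v))).coeFn_toLp] with p hp hp2
  rw [modeEmb_eq, hp2, ← hp, toL_apply]

/-- Pairings with square integrable functions are continuous. -/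
theorem exists_pairing {φ : Cyl → ℂ} (hφ : MemLp φ 2 volume) :
    ∃ T : L2 →L[ℂ] ℂ, ∀ f : L2, ∫ p, f p * φ p = T f := by
  refine ⟨innerSL ℂ (hφ.star.toLp _), fun f => ?_⟩
  rw [innerSL_apply_apply, inner_toLp_left]
  simp [mul_comm]

theorem integral_modeEmb_dx (k : ℤ) (v : 𝓢(ℝ, ℂ)) {φ : Cyl → ℂ} (hφ : IsTest φ) :
    ∫ p, modeEmb k (toL v) p * dx φ p
      = -(Complex.I * k * ∫ p, modeEmb k (toL v) p * φ p) := by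
  rw [integral_modeEmb_toL_mul, integral_modeEmb_toL_mul]
  have hs := isSmooth_modeFun k v
  have h := (IsTest.smooth_mul hs hφ).integral_dx
  simp_rw [hs.dx_mul hφ.isSmooth, dx_modeFun, mul_assoc] at h
  rw [integral_add, integral_const_mul, integral_const_mul] at h
  · linear_combination h
  · exact ((IsTest.smooth_mul hs hφ).integrable.const_mul _).const_mul _
  · exact (IsTest.smooth_mul hs hφ.dx).integrable

theorem integral_modeEmb_dy (k : ℤ) (v : 𝓢(ℝ, ℂ)) {φ : Cyl → ℂ} (hφ : IsTest φ) :
    ∫ p, modeEmb k (toL v) p * dy φ p = -∫ p, modeEmb k (toL (Dop v)) p * φ p := by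
  rw [integral_modeEmb_toL_mul, integral_modeEmb_toL_mul]
  have hs := isSmooth_modeFun k v
  have h := (IsTest.smooth_mul hs hφ).integral_dy
  simp_rw [hs.dy_mul hφ.isSmooth, dy_modeFun] at h
  rw [integral_add] at h
  · linear_combination h
  · exact (IsTest.smooth_mul (isSmooth_modeFun k (Dop v)) hφ).integrable
  · exact (IsTest.smooth_mul hs hφ.dy).integrable

theorem integral_modeEmb_lap (k : ℤ) (v : 𝓢(ℝ, ℂ)) {φ : Cyl → ℂ} (hφ : IsTest φ) :
    ∫ p, modeEmb k (toL v) p * lap φ p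
      = (∫ p, modeEmb k (toL (Dop (Dop v))) p * φ p) - k ^ 2 * ∫ p, modeEmb k (toL v) p * φ p := by
  have e : ∫ p, modeEmb k (toL v) p * lap φ p
      = (∫ p, modeEmb k (toL v) p * dx (dx φ) p) + ∫ p, modeEmb k (toL v) p * dy (dy φ) p := by
    simp only [lap, mul_add]
    exact integral_add (MemLp.integrable_mul (p := 2) (q := 2) (Lp.memLp _) hφ.dx.dx.memLp)
      (MemLp.integrable_mul (p := 2) (q := 2) (Lp.memLp _) hφ.dy.dy.memLp)
  rw [e, integral_modeEmb_dx k v hφ.dx, integral_modeEmb_dx k v hφ, integral_modeEmb_dy k v hφ.dy,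
    integral_modeEmb_dy k _ hφ]
  linear_combination (k ^ 2 * ∫ p, modeEmb k (toL v) p * φ p : ℂ) * Complex.I_sq

end Tests

/-! ### Identification of the linearized operator with its modes, and the semigroup. -/

section Generator

open SchwartzMap
open scoped SchwartzMap ComplexConjugate

theorem IsTest.lap {φ : Cyl → ℂ} (h : IsTest φ) : IsTest (lap φ) :=
  ⟨ContDiff.add h.dx.dx.smooth h.dy.dy.smooth, h.dx.dx.compact.add h.dy.dy.compact⟩

theorem IsTest.sq_mul {φ : Cyl → ℂ} (h : IsTest φ) : IsTest fun p : Cyl => (p.2 : ℂ) ^ 2 * φ p := by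
  refine IsTest.smooth_mul ?_ h
  have h1 : ContDiff ℝ ∞ fun p : ℝ × ℝ => ((p.2 : ℝ) : ℂ) :=
    Complex.ofRealCLM.contDiff.comp contDiff_snd
  exact h1.pow 2

theorem norm_greenL_le (k : ℤ) (u : LR) : ‖greenL k u‖ ≤ ‖u‖ := by
  refine (norm_extL_le (Gop_bound k) u).trans (mul_le_of_le_one_left (norm_nonneg _) ?_)
  rcases eq_or_ne k 0 with rfl | hk
  · simp
  · refine inv_le_one_of_one_le₀ ?_
    exact_mod_cast Int.add_one_le_iff.2 (by positivity : 0 < k ^ 2)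

theorem hasSum_pairing {T : L2 →L[ℂ] ℂ} (f : L2) :
    HasSum (fun k => T (modeEmb k (modeCoef k f))) (T f) := (hasSum_modes f).mapL T

theorem integral_greenL_lap {k : ℤ} (hk : k ≠ 0) (u : LR) {φ : Cyl → ℂ} (hφ : IsTest φ) :
    ∫ p, modeEmb k (-greenL k u) p * lap φ p = ∫ p, modeEmb k u p * φ p := by
  obtain ⟨T, hT⟩ := exists_pairing hφ.memLp
  obtain ⟨T', hT'⟩ := exists_pairing hφ.lap.memLp
  rw [hT, hT']
  refine denseRange_toL.induction_on u (isClosed_eq (by fun_prop) (by fun_prop)) fun v => ?_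
  have hk' : (k : ℝ) ≠ 0 := by exact_mod_cast hk
  rw [greenL_toL, map_neg, map_neg, ← hT', integral_modeEmb_lap k _ hφ, hT, hT]
  nth_rewrite 3 [← green_Gop hk' v]
  simp only [map_sub, map_smul, smul_eq_mul]
  push_cast
  ring

/-- The difference of two solutions satisfies `D² z = k² z` weakly. This is the resolvent equation
at wavenumber zero with `ν = 1` and spectral parameter `k²`, so `eq_zero_of_weak` applies. -/
theorem eq_neg_greenL_of_weak {k : ℝ} (hk : k ≠ 0) {u w : LR}
    (h : ∀ θ : 𝓢(ℝ, ℂ), HasCompactSupport θ →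
      inner ℂ (toL (Dop (Dop θ) - ((k ^ 2 : ℝ) : ℂ) • θ)) w = inner ℂ (toL θ) u) :
    w = -greenL k u := by
  have hg : ∀ θ : 𝓢(ℝ, ℂ), inner ℂ (toL (Dop (Dop θ) - ((k ^ 2 : ℝ) : ℂ) • θ)) (-greenL k u)
      = inner ℂ (toL θ) u := by
    intro θ
    refine denseRange_toL.induction_on u (isClosed_eq (by fun_prop) (by fun_prop)) fun v => ?_
    rw [greenL_toL]
    nth_rewrite 2 [← green_Gop hk v]
    rw [map_sub, map_sub, map_smul, map_smul, inner_sub_left, inner_sub_right, inner_smul_left,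
      inner_smul_right, inner_neg_right, inner_neg_right, Complex.conj_ofReal, Dop_skew, Dop_skew]
    ring
  rw [← sub_eq_zero]
  refine eq_zero_of_weak (nu := 1) (k := 0) (lam := k ^ 2) one_pos (by positivity) fun θ hθ => ?_
  have h1 : inner ℂ (toL (Dop (Dop θ) - ((k ^ 2 : ℝ) : ℂ) • θ)) (w - -greenL k u) = 0 := by
    rw [inner_sub_right, h θ hθ, hg, sub_self]
  rw [map_sub, map_smul, inner_sub_left, inner_smul_left, Complex.conj_ofReal] at h1
  rw [inner_modeS]
  push_cast at h1 ⊢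
  linear_combination h1

theorem isInvLaplacian_iff (f ψ : L2) :
    IsInvLaplacian (Pneq f) ψ ↔ ∀ k : ℤ, modeCoef k ψ = -greenL k (modeCoef k f) := by
  constructor
  · intro h k
    rcases eq_or_ne k 0 with rfl | hk
    · rw [(P0_eq_zero_iff ψ).1 h.mean, Int.cast_zero, greenL_zero, neg_zero]
    · refine eq_neg_greenL_of_weak (by exact_mod_cast hk) fun θ hθ => ?_
      have h1 := h.eq _ (isTest_conj_modeFun k hθ)
      simp_rw [(isSmooth_modeFun k θ).lap_conj, lap_modeFun] at h1
      rw [integral_mul_conj_modeFun, integral_mul_conj_modeFun, modeCoef_Pneq, if_neg hk] at h1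
      exact h1
  · intro h
    refine ⟨(P0_eq_zero_iff ψ).2 ?_, fun φ hφ => ?_⟩
    · rw [h 0, Int.cast_zero, greenL_zero, neg_zero]
    · obtain ⟨T, hT⟩ := exists_pairing hφ.memLp
      obtain ⟨T', hT'⟩ := exists_pairing hφ.lap.memLp
      have h1 := hasSum_pairing (T := T) (Pneq f)
      have h2 := hasSum_pairing (T := T') ψ
      rw [hT, hT']
      refine h2.unique ?_
      convert h1 using 2 with k
      rw [h k, modeCoef_Pneq]
      rcases eq_or_ne k 0 with rfl | hk
      · rw [Int.cast_zero, greenL_zero]; simp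
      · rw [if_neg hk, ← hT', ← hT, integral_greenL_lap hk _ hφ]

theorem exists_invLaplacian (f : L2) : ∃ ψ, IsInvLaplacian (Pneq f) ψ := by
  obtain ⟨ψ, hψ⟩ := exists_of_summable_modes (b := fun k => -greenL k (modeCoef k f))
    (Summable.of_nonneg_of_le (fun k => by positivity) (fun k => by
      rw [norm_neg]; gcongr; exact norm_greenL_le k _) (summable_norm_sq_modes f))
  exact ⟨ψ, (isInvLaplacian_iff f ψ).2 hψ⟩

theorem integral_of_mem_modeGraph {nu : ℝ} {k : ℤ} {p : LR × LR} (hp : p ∈ modeGraph nu k)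
    {φ : Cyl → ℂ} (hφ : IsTest φ) :
    ∫ q, modeEmb k p.2 q * φ q = (∫ q, modeEmb k p.1 q * ((q.2 : ℂ) ^ 2 * dx φ q))
      - 2 * (∫ q, modeEmb k (-greenL k p.1) q * dx φ q) + nu * ∫ q, modeEmb k p.1 q * lap φ q := by
  obtain ⟨T, hT⟩ := exists_pairing hφ.memLp
  obtain ⟨T1, hT1⟩ := exists_pairing hφ.dx.sq_mul.memLp
  obtain ⟨T2, hT2⟩ := exists_pairing hφ.dx.memLp
  obtain ⟨T3, hT3⟩ := exists_pairing hφ.lap.memLp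
  refine modeGraph_induction (P := fun p =>
    ∫ q, modeEmb k p.2 q * φ q = (∫ q, modeEmb k p.1 q * ((q.2 : ℂ) ^ 2 * dx φ q))
      - 2 * (∫ q, modeEmb k (-greenL k p.1) q * dx φ q) + nu * ∫ q, modeEmb k p.1 q * lap φ q)
    ?_ (fun v => ?_) hp
  · simp_rw [hT, hT1, hT2, hT3]
    exact isClosed_eq (by fun_prop) (by fun_prop)
  · simp only
    have e1 : ∫ q, modeEmb k (toL v) q * ((q.2 : ℂ) ^ 2 * dx φ q)
        = ∫ q, modeEmb k (toL (Yop (Yop v))) q * dx φ q := by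
      rw [integral_modeEmb_toL_mul, integral_modeEmb_toL_mul]
      refine integral_congr_ae (Eventually.of_forall fun q => ?_)
      simp only [modeFun, Yop_apply]
      ring
    rw [e1, integral_modeEmb_dx k _ hφ, integral_modeEmb_lap k _ hφ,
      greenL_toL, ← map_neg, integral_modeEmb_dx k _ hφ]
    simp only [hT, modeOp_apply, map_add, map_smul, map_neg, map_sub, smul_eq_mul]
    push_cast
    ring

/-- Test functions `conj (e^{ikx} θ(y))` extract the weak equation of one mode, and weak equals
strong there. Conversely, pairings with a fixed test function are continuous on `L²`, so the
modewise identities may be summed. -/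
theorem isLin_iff {nu : ℝ} (hnu : 0 < nu) (f h : L2) :
    IsLin nu f h ↔ ∀ k : ℤ, (modeCoef k f, modeCoef k h) ∈ modeGraph nu k := by
  constructor
  · rintro ⟨ψ, hψ, hh⟩ k
    refine mem_modeGraph_of_weak hnu fun θ hθ => ?_
    have hc := (isInvLaplacian_iff f ψ).1 hψ k
    have h1 := hh _ (isTest_conj_modeFun k hθ)
    have hs := isSmooth_modeFun k θ
    simp_rw [hs.lap_conj, lap_modeFun, hs.dx_conj, dx_modeFun] at h1
    have e1 : ∀ p : Cyl, f p * ((p.2 : ℂ) ^ 2 * conj (Complex.I * k * modeFun k θ p))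
        = -(Complex.I * k) * (f p * conj (modeFun k (Yop (Yop θ)) p)) := by
      intro p
      simp only [modeFun, Yop_apply, map_mul, Complex.conj_I, Complex.conj_ofReal, map_intCast]
      ring
    have e2 : ∀ p : Cyl, ψ p * conj (Complex.I * k * modeFun k θ p)
        = -(Complex.I * k) * (ψ p * conj (modeFun k θ p)) := by
      intro p
      simp only [map_mul, Complex.conj_I, map_intCast]
      ring
    simp_rw [e1, e2] at h1
    rw [integral_const_mul, integral_const_mul] at h1
    simp_rw [integral_mul_conj_modeFun] at h1
    have e3 : inner ℂ (toL θ) (modeCoef k ψ) = -inner ℂ (toL (Gop k θ)) (modeCoef k f) := by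
      rw [hc, inner_neg_right, neg_inj]
      refine denseRange_toL.induction_on (modeCoef k f) (isClosed_eq (by fun_prop) (by fun_prop))
        fun v => ?_
      rw [greenL_toL, Gop_symm]
    rw [h1, e3, inner_modeS, Gop_neg, map_sub, map_smul, inner_sub_left, inner_smul_left,
      Complex.conj_ofReal]
    push_cast
    ring
  · intro hm
    obtain ⟨ψ, hψ⟩ := exists_invLaplacian f
    refine ⟨ψ, hψ, fun φ hφ => ?_⟩
    have hc := (isInvLaplacian_iff f ψ).1 hψ
    obtain ⟨T, hT⟩ := exists_pairing hφ.memLp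
    obtain ⟨T1, hT1⟩ := exists_pairing hφ.dx.sq_mul.memLp
    obtain ⟨T2, hT2⟩ := exists_pairing hφ.dx.memLp
    obtain ⟨T3, hT3⟩ := exists_pairing hφ.lap.memLp
    rw [hT, hT1, hT2, hT3]
    refine (hasSum_pairing (T := T) h).unique ?_
    have hs := ((hasSum_pairing (T := T1) f).sub ((hasSum_pairing (T := T2) ψ).mul_left 2)).add
      ((hasSum_pairing (T := T3) f).mul_left (nu : ℂ))
    have e : ∀ k : ℤ, T (modeEmb k (modeCoef k h)) = T1 (modeEmb k (modeCoef k f))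
        - 2 * T2 (modeEmb k (modeCoef k ψ)) + nu * T3 (modeEmb k (modeCoef k f)) := fun k => by
      have := integral_of_mem_modeGraph (hm k) hφ
      rw [hT, hT1, hT2, hT3] at this
      rw [this, hc k]
    simp_rw [e]
    exact hs

theorem re_inner_nonpos_of_mem_modeGraph {nu k : ℝ} (hnu : 0 ≤ nu) {p : LR × LR}
    (hp : p ∈ modeGraph nu k) : (inner ℂ p.2 p.1).re ≤ 0 :=
  (re_inner_le_of_mem_modeGraph hnu hp).trans
    (mul_nonpos_of_nonpos_of_nonneg (neg_nonpos.2 (by positivity)) (by positivity))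

/-- The graph of the linearized operator. -/
def linGraph (nu : ℝ) : Submodule ℂ (L2 × L2) :=
  ⨅ k : ℤ, (modeGraph nu k).comap ((modeCoef k).prodMap (modeCoef k)).toLinearMap

theorem mem_linGraph {nu : ℝ} {p : L2 × L2} :
    p ∈ linGraph nu ↔ ∀ k : ℤ, (modeCoef k p.1, modeCoef k p.2) ∈ modeGraph nu k := by
  simp only [linGraph, Submodule.mem_iInf]
  rfl

/-- Everything is checked mode by mode. Surjectivity is assembled from the modes because the
resolvent bound `λ⁻¹` does not depend on `k`. -/
theorem isMaxDissipative_linGraph {nu : ℝ} (hnu : 0 < nu) : IsMaxDissipative (linGraph nu) where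
  diss p hp := by
    have h := Complex.hasSum_re (hasSum_inner_modes p.2 p.1)
    refine h.nonpos fun k => ?_
    exact re_inner_nonpos_of_mem_modeGraph hnu.le (mem_linGraph.1 hp k)
  single h hh := by
    refine ext_modes fun k => ?_
    have := mem_linGraph.1 hh k
    simp only [map_zero] at this
    rw [modeGraph_snd_eq_zero this, map_zero]
  range lam hlam h := by
    choose u hu using fun k : ℤ => modeGraph_resolvent (k := k) hnu hlam (modeCoef k h)
    have hb : ∀ k, ‖u k‖ ≤ lam⁻¹ * ‖modeCoef k h‖ := by
      intro k
      have := resolvent_bound (A := modeGraph nu k) (fun p hp =>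
        re_inner_nonpos_of_mem_modeGraph hnu.le hp) (hu k)
      rwa [inv_mul_eq_div, le_div_iff₀ hlam, mul_comm]
    obtain ⟨f, hf⟩ := exists_of_summable_modes (b := u)
      (Summable.of_nonneg_of_le (fun k => by positivity) (fun k => by
        have := pow_le_pow_left₀ (norm_nonneg _) (hb k) 2
        rwa [mul_pow] at this) ((summable_norm_sq_modes h).mul_left _))
    refine ⟨f, mem_linGraph.2 fun k => ?_⟩
    have := hu k
    rw [← hf k] at this
    rw [RCLike.real_smul_eq_coe_smul (K := ℂ) lam] at this
    have e : modeCoef k ((lam : ℂ) • f - h) = (lam : ℂ) • modeCoef k f - modeCoef k h := by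
      rw [map_sub, map_smul]
    exact (congrArg (fun z => (modeCoef k f, z) ∈ modeGraph nu k) e).mpr this

/-- The semigroup generated by the linearized operator. -/
def flow (nu : ℝ) (hnu : 0 < nu) : ℝ → L2 →L[ℂ] L2 := (isMaxDissipative_linGraph hnu).semigroup

theorem isSemigroup_flow {nu : ℝ} (hnu : 0 < nu) : IsSemigroup nu (flow nu hnu) where
  zero := (isMaxDissipative_linGraph hnu).semigroup_zero
  add s t hs ht := (isMaxDissipative_linGraph hnu).semigroup_add hs ht
  cont f := (isMaxDissipative_linGraph hnu).continuousOn_semigroup f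
  generator f h := by
    rw [isLin_iff hnu]
    exact ((isMaxDissipative_linGraph hnu).generator_iff f h).trans mem_linGraph

end Generator

/-! ### Supremum bounds for the Green operator along solutions of one mode. -/

section SupBounds

open SchwartzMap
open scoped SchwartzMap

/-- Convergence in `L²` gives almost everywhere convergence along a subsequence, so pointwise bounds
survive the limit. -/
theorem ae_norm_le_of_approx {α : Type*} [MeasurableSpace α] {μ : Measure α} {f : Lp ℂ 2 μ} {B : ℝ}
    (h : ∀ ε > 0, ∃ g : Lp ℂ 2 μ, ‖g - f‖ < ε ∧ ∀ᵐ x ∂μ, ‖g x‖ ≤ B + ε) :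
    ∀ᵐ x ∂μ, ‖f x‖ ≤ B := by
  choose g hg1 hg2 using fun n : ℕ => h (1 / ((n : ℝ) + 1)) Nat.one_div_pos_of_nat
  have ht : Tendsto g atTop (𝓝 f) := by
    rw [tendsto_iff_norm_sub_tendsto_zero]
    exact squeeze_zero (fun n => norm_nonneg _) (fun n => (hg1 n).le)
      tendsto_one_div_add_atTop_nhds_zero_nat
  obtain ⟨ns, hns, hlim⟩ := (tendstoInMeasure_of_tendsto_Lp ht).exists_seq_tendsto_ae
  filter_upwards [hlim, ae_all_iff.2 hg2] with x hx hxB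
  have h2 : Tendsto (fun i => B + 1 / ((ns i : ℝ) + 1)) atTop (𝓝 (B + 0)) :=
    tendsto_const_nhds.add (tendsto_one_div_add_atTop_nhds_zero_nat.comp hns.tendsto_atTop)
  rw [add_zero] at h2
  exact le_of_tendsto_of_tendsto' hx.norm h2 fun i => hxB (ns i)

/-- Almost everywhere bounds for the Green operator and its derivative. -/
def SupBound (k : ℝ) (u : LR) (B : ℝ) : Prop :=
  (∀ᵐ y, ‖(((|k| : ℝ) : ℂ) • greenL k u) y‖ ≤ B) ∧ ∀ᵐ y, ‖dgreenL k u y‖ ≤ B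

theorem SupBound.mono {k : ℝ} {u : LR} {B B' : ℝ} (h : SupBound k u B) (hB : B ≤ B') :
    SupBound k u B' :=
  ⟨h.1.mono fun _ hy => hy.trans hB, h.2.mono fun _ hy => hy.trans hB⟩

theorem supBound_of_approx {k : ℝ} {u : LR} {B : ℝ}
    (h : ∀ ε > 0, ∃ u', ‖u' - u‖ < ε ∧ SupBound k u' (B + ε)) : SupBound k u B := by
  have key : ∀ T : LR →L[ℂ] LR, ∀ ε > 0, ∃ δ > 0, δ ≤ ε ∧ ∀ z, ‖z‖ < δ → ‖T z‖ < ε := by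
    intro T ε hε
    refine ⟨min ε (ε / (‖T‖ + 1)), by positivity, min_le_left _ _, fun z hz => ?_⟩
    have h1 := (lt_div_iff₀ (by positivity)).1 (hz.trans_le (min_le_right _ _))
    have h2 := T.le_opNorm z
    nlinarith [norm_nonneg z]
  constructor
  · refine ae_norm_le_of_approx fun ε hε => ?_
    obtain ⟨δ, hδ, hδε, hT⟩ := key (((|k| : ℝ) : ℂ) • greenL k) ε hε
    obtain ⟨u', h1, h2⟩ := h δ hδ
    refine ⟨((|k| : ℝ) : ℂ) • greenL k u', ?_, h2.1.mono fun y hy => hy.trans (by linarith)⟩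
    have := hT _ h1
    rwa [map_sub] at this
  · refine ae_norm_le_of_approx fun ε hε => ?_
    obtain ⟨δ, hδ, hδε, hT⟩ := key (dgreenL k) ε hε
    obtain ⟨u', h1, h2⟩ := h δ hδ
    refine ⟨dgreenL k u', ?_, h2.2.mono fun y hy => hy.trans (by linarith)⟩
    have := hT _ h1
    rwa [map_sub] at this

theorem supBound_toL {k : ℝ} (hk : k ≠ 0) {v : 𝓢(ℝ, ℂ)} {B : ℝ}
    (hB : ∫ s, ‖v s‖ ≤ B ∨ ‖toL v‖ ^ 2 ≤ 2 * |k| * B ^ 2 ∧ 0 ≤ B) : SupBound k (toL v) B := by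
  have h := sup_bounds_Gop hk hB
  constructor
  · rw [greenL_toL, ← map_smul]
    filter_upwards [(((|k| : ℝ) : ℂ) • Gop k v).coeFn_toLp 2 volume] with y hy
    rw [toL_apply, hy, _root_.smul_apply, norm_smul, Complex.norm_real, Real.norm_eq_abs, abs_abs]
    exact (h y).1
  · rw [dgreenL_toL]
    filter_upwards [(Dop (Gop k v)).coeFn_toLp 2 volume] with y hy
    rw [toL_apply, hy]
    exact (h y).2

theorem supBound_of_norm {k : ℝ} (hk : k ≠ 0) (u : LR) :
    SupBound k u (Real.sqrt ((2 * |k|)⁻¹) * ‖u‖) := by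
  have hK : 0 < |k| := abs_pos.2 hk
  set c := Real.sqrt ((2 * |k|)⁻¹) with hc
  have hc2 : 2 * |k| * c ^ 2 = 1 := by
    rw [hc, Real.sq_sqrt (by positivity), mul_inv_cancel₀ (by positivity)]
  have hc0 : 0 ≤ c := Real.sqrt_nonneg _
  refine supBound_of_approx fun ε hε => ?_
  obtain ⟨v, hv⟩ := denseRange_toL.exists_dist_lt u (show 0 < min ε (ε / (c + 1)) by positivity)
  rw [dist_comm, dist_eq_norm] at hv
  refine ⟨toL v, hv.trans_le (min_le_left _ _), (supBound_toL hk (B := c * ‖toL v‖)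
    (Or.inr ⟨?_, by positivity⟩)).mono ?_⟩
  · rw [mul_pow, ← mul_assoc, hc2, one_mul]
  · have h1 := (lt_div_iff₀ (by positivity)).1 (hv.trans_le (min_le_right _ _))
    have h2 := norm_sub_norm_le (toL v) u
    nlinarith [norm_nonneg (toL v - u)]

theorem approx_of_curve {nu k : ℝ} (hnu : 0 < nu) (hk : k ≠ 0) {u h : ℝ → LR}
    (hc : ∀ t, 0 ≤ t → (u t, h t) ∈ modeGraph nu k) (hu : ContinuousOn u (Ici 0))
    (hh : ContinuousOn h (Ici 0)) (hd : ∀ t, 0 ≤ t → HasDerivWithinAt u (h t) (Ici t) t)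
    {t : ℝ} (ht : 0 ≤ t) {ε : ℝ} (hε : 0 < ε) :
    ∃ v : 𝓢(ℝ, ℂ), ‖toL v - u t‖ < ε ∧ ‖toL v‖ ^ 2 ≤ ‖u 0‖ ^ 2 + ε ∧
      nu * |k| * t ^ 2 * ‖toL v‖ ^ 2 ≤ 1440 * (‖u 0‖ ^ 2 + ε) ∧
      nu * k ^ 2 * t ^ 3 * ‖toL (Yop v)‖ ^ 2 ≤ 25920 * (‖u 0‖ ^ 2 + ε) := by
  have hM := isModeTriple hk
  obtain ⟨v, h1, h2⟩ := hM.exists_approx_of_curve hnu hk hc hu hh hd ht hε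
  have e1 := hM.decay_of_hypo (nu := nu) hnu.le ht v
  have e2 := hM.weight_of_hypo (nu := nu) hnu.le ht v
  have e3 := hM.le_hypo (nu := nu) hnu.le ht v
  have e4 : 0 ≤ nu * t * (‖toL (Dop v)‖ ^ 2 / 80 + (t * |k| * ‖toL (Yop v)‖) ^ 2 / 25920) := by
    positivity
  refine ⟨v, h1, by linarith, e1.trans (by linarith), e2.trans (by linarith)⟩

theorem decay_of_curve {nu k : ℝ} (hnu : 0 < nu) (hk : k ≠ 0) {u h : ℝ → LR}
    (hc : ∀ t, 0 ≤ t → (u t, h t) ∈ modeGraph nu k) (hu : ContinuousOn u (Ici 0))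
    (hh : ContinuousOn h (Ici 0)) (hd : ∀ t, 0 ≤ t → HasDerivWithinAt u (h t) (Ici t) t)
    {t : ℝ} (ht : 0 ≤ t) : nu * |k| * t ^ 2 * ‖u t‖ ^ 2 ≤ 1440 * ‖u 0‖ ^ 2 := by
  choose v h1 h2 h3 h4 using fun n : ℕ => approx_of_curve hnu hk hc hu hh hd ht
    (Nat.one_div_pos_of_nat (α := ℝ) (n := n))
  have hlim : Tendsto (fun n => toL (v n)) atTop (𝓝 (u t)) := by
    rw [tendsto_iff_norm_sub_tendsto_zero]
    exact squeeze_zero (fun n => norm_nonneg _) (fun n => (h1 n).le)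
      tendsto_one_div_add_atTop_nhds_zero_nat
  have h5 := (tendsto_one_div_add_atTop_nhds_zero_nat (𝕜 := ℝ)).const_add (‖u 0‖ ^ 2)
  rw [add_zero] at h5
  exact le_of_tendsto_of_tendsto' ((hlim.norm.pow 2).const_mul _) (h5.const_mul 1440) h3

/-- At the scale `δ = (|k| √(ν t³))⁻¹` the hypocoercive bound reads `‖Yv‖² ≲ δ² ‖u(0)‖²`, matching
`δ² ‖v‖²`. The weighted Cauchy–Schwarz inequality then gives `‖v‖_{L¹}² ≲ δ ‖u(0)‖²`. The constant
is `103684 = 4 · (25920 + 1)`, where `4` bounds `π`. -/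
theorem supBound_of_curve {nu k : ℝ} (hnu : 0 < nu) (hk : k ≠ 0) {u h : ℝ → LR}
    (hc : ∀ t, 0 ≤ t → (u t, h t) ∈ modeGraph nu k) (hu : ContinuousOn u (Ici 0))
    (hh : ContinuousOn h (Ici 0)) (hd : ∀ t, 0 ≤ t → HasDerivWithinAt u (h t) (Ici t) t)
    {t : ℝ} (ht : 0 < t) :
    SupBound k (u t) (Real.sqrt (103684 * (|k| * Real.sqrt (nu * t ^ 3))⁻¹) * ‖u 0‖) := by
  have hK : 0 < |k| := abs_pos.2 hk
  set δ := (|k| * Real.sqrt (nu * t ^ 3))⁻¹ with hδ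
  have hs : 0 < Real.sqrt (nu * t ^ 3) := Real.sqrt_pos.2 (by positivity)
  have hδ0 : 0 < δ := by positivity
  have hδ2 : δ ^ 2 * (nu * k ^ 2 * t ^ 3) = 1 := by
    rw [hδ, inv_pow, mul_pow, Real.sq_sqrt (by positivity), sq_abs]
    field_simp
  set c := Real.sqrt (103684 * δ) with hcdef
  have hc0 : 0 ≤ c := Real.sqrt_nonneg _
  have hc2 : c ^ 2 = 103684 * δ := Real.sq_sqrt (by positivity)
  refine supBound_of_approx fun ε hε => ?_
  set ε' := min ε ((ε / (c + 1)) ^ 2) with hε'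
  have hε'0 : 0 < ε' := by positivity
  obtain ⟨v, h1, h2, -, h3⟩ := approx_of_curve hnu hk hc hu hh hd ht.le hε'0
  refine ⟨toL v, h1.trans_le (min_le_left _ _), supBound_toL hk (Or.inl ?_)⟩
  have h4 := sq_integral_norm_le hδ0 v
  have h5 : ‖toL (Yop v)‖ ^ 2 ≤ 25920 * δ ^ 2 * (‖u 0‖ ^ 2 + ε') := by
    have := mul_le_mul_of_nonneg_left h3 (sq_nonneg δ)
    rw [← mul_assoc, hδ2, one_mul] at this
    linarith
  have h6 : (∫ s, ‖v s‖) ^ 2 ≤ c ^ 2 * (‖u 0‖ ^ 2 + ε') := by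
    refine h4.trans ?_
    have h7 : δ ^ 2 * ‖toL v‖ ^ 2 + ‖toL (Yop v)‖ ^ 2 ≤ 25921 * δ ^ 2 * (‖u 0‖ ^ 2 + ε') := by
      have := mul_le_mul_of_nonneg_left h2 (sq_nonneg δ)
      linarith
    calc Real.pi / δ * (δ ^ 2 * ‖toL v‖ ^ 2 + ‖toL (Yop v)‖ ^ 2)
        ≤ 4 / δ * (25921 * δ ^ 2 * (‖u 0‖ ^ 2 + ε')) := by
          gcongr
          exact Real.pi_le_four
      _ = c ^ 2 * (‖u 0‖ ^ 2 + ε') := by rw [hc2]; field_simp; ring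
  have h8 : c ^ 2 * (‖u 0‖ ^ 2 + ε') ≤ (c * ‖u 0‖ + ε) ^ 2 := by
    have h9 : c ^ 2 * ε' ≤ ε ^ 2 := by
      calc c ^ 2 * ε' ≤ c ^ 2 * (ε / (c + 1)) ^ 2 := by gcongr; exact min_le_right _ _
        _ = (c / (c + 1) * ε) ^ 2 := by ring
        _ ≤ (1 * ε) ^ 2 := by
          gcongr
          exact (div_le_one (by positivity)).2 (by linarith)
        _ = ε ^ 2 := by ring
    have : 0 ≤ c * ‖u 0‖ * ε := by positivity
    nlinarith
  exact abs_le_of_sq_le_sq' (h6.trans h8) (by positivity) |>.2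

end SupBounds

/-! ### Decay of the modes of the flow, and the bound on `∂ₓ`. -/

section FlowModes

variable {nu : ℝ} (hnu : 0 < nu)

theorem flow_induction {P : L2 → Prop} (hP : IsClosed {g | P g})
    (h : ∀ f f' : L2, (f, f') ∈ linGraph nu → P f) (hnu : 0 < nu) (g : L2) : P g := by
  have h1 : {f : L2 | ∃ f', (f, f') ∈ linGraph nu} ⊆ {g | P g} := by
    rintro f ⟨f', hf⟩
    exact h f f' hf
  exact closure_minimal h1 hP ((isMaxDissipative_linGraph hnu).dense_domain g)

theorem flow_mem {f f' : L2} (hf : (f, f') ∈ linGraph nu) (k : ℤ) {t : ℝ} (ht : 0 ≤ t) :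
    (modeCoef k (flow nu hnu t f), modeCoef k (flow nu hnu t f')) ∈ modeGraph nu k :=
  mem_linGraph.1 ((isMaxDissipative_linGraph hnu).semigroup_mem hf ht) k

theorem flow_continuousOn (k : ℤ) (f : L2) :
    ContinuousOn (fun t => modeCoef k (flow nu hnu t f)) (Ici 0) :=
  (modeCoef k).continuous.comp_continuousOn
    ((isMaxDissipative_linGraph hnu).continuousOn_semigroup f)

theorem flow_hasDerivWithinAt {f f' : L2} (hf : (f, f') ∈ linGraph nu) (k : ℤ) {t : ℝ}
    (ht : 0 ≤ t) : HasDerivWithinAt (fun t => modeCoef k (flow nu hnu t f))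
      (modeCoef k (flow nu hnu t f')) (Ici t) t :=
  ((modeCoef k).restrictScalars ℝ).hasFDerivAt.comp_hasDerivWithinAt t
    ((isMaxDissipative_linGraph hnu).hasDerivWithinAt_semigroup hf ht)

theorem flow_zero (f : L2) : flow nu hnu 0 f = f := by
  rw [(isSemigroup_flow hnu).zero]; rfl

theorem flow_add {s t : ℝ} (hs : 0 ≤ s) (ht : 0 ≤ t) (f : L2) :
    flow nu hnu (s + t) f = flow nu hnu s (flow nu hnu t f) := by
  rw [(isSemigroup_flow hnu).add s t hs ht]; rfl

theorem flow_hasDerivWithinAt_norm_sq {f f' : L2} (hf : (f, f') ∈ linGraph nu) (k : ℤ) {t : ℝ}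
    (ht : 0 ≤ t) : HasDerivWithinAt (fun t => ‖modeCoef k (flow nu hnu t f)‖ ^ 2)
      (2 * (inner ℂ (modeCoef k (flow nu hnu t f')) (modeCoef k (flow nu hnu t f))).re)
      (Ici t) t :=
  hasDerivWithinAt_norm_sq (flow_hasDerivWithinAt hnu hf k ht)

/-- Plain heat decay in `x`: `e^{2νk²t} ‖u(t)‖²` does not increase for data in the domain, and
density does the rest. -/
theorem norm_modeCoef_flow_le (k : ℤ) {t : ℝ} (ht : 0 ≤ t) (g : L2) :
    ‖modeCoef k (flow nu hnu t g)‖ ≤ Real.exp (-(nu * k ^ 2 * t)) * ‖modeCoef k g‖ := by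
  refine flow_induction (P := fun g => ‖modeCoef k (flow nu hnu t g)‖
    ≤ Real.exp (-(nu * k ^ 2 * t)) * ‖modeCoef k g‖)
    (isClosed_le (by fun_prop) (by fun_prop)) (fun f f' hf => ?_) hnu g
  set c := 2 * (nu * k ^ 2) with hc
  have hexp : ∀ s : ℝ, HasDerivAt (fun s => Real.exp (c * s)) (Real.exp (c * s) * c) s := by
    intro s
    simpa using ((hasDerivAt_id s).const_mul c).exp
  have hle := image_le_of_deriv_right_le_deriv_boundary (a := 0) (b := t)
    (f := fun s => Real.exp (c * s) * ‖modeCoef k (flow nu hnu s f)‖ ^ 2)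
    (f' := fun s => Real.exp (c * s) * c * ‖modeCoef k (flow nu hnu s f)‖ ^ 2
      + Real.exp (c * s) *
        (2 * (inner ℂ (modeCoef k (flow nu hnu s f')) (modeCoef k (flow nu hnu s f))).re))
    (B := fun _ => ‖modeCoef k f‖ ^ 2) (B' := fun _ => 0)
    (ContinuousOn.mul (by fun_prop)
      (((flow_continuousOn hnu k f).mono fun s hs => hs.1).norm.pow 2))
    (fun s hs => (hexp s).hasDerivWithinAt.mul (flow_hasDerivWithinAt_norm_sq hnu hf k hs.1))
    (by simp [flow_zero]) (by fun_prop) (fun s _ => hasDerivWithinAt_const _ _ _)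
    (fun s hs => by
      have h1 := re_inner_le_of_mem_modeGraph hnu.le (flow_mem hnu hf k hs.1)
      simp only at h1
      have h2 := Real.exp_pos (c * s)
      rw [mul_assoc, ← mul_add]
      refine mul_nonpos_of_nonneg_of_nonpos h2.le ?_
      rw [hc]; linarith) ⟨ht, le_refl t⟩
  refine abs_le_of_sq_le_sq' ?_ (by positivity) |>.2
  rw [mul_pow, ← Real.exp_nat_mul]
  have e : Real.exp ((2 : ℕ) * -(nu * k ^ 2 * t)) = (Real.exp (c * t))⁻¹ := by
    rw [← Real.exp_neg, hc]; congr 1; push_cast; ring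
  rw [e, inv_mul_eq_div, le_div_iff₀ (Real.exp_pos _)]
  linarith

theorem decay_modeCoef_flow {k : ℤ} (hk : k ≠ 0) {t : ℝ} (ht : 0 ≤ t) (g : L2) :
    nu * |(k : ℝ)| * t ^ 2 * ‖modeCoef k (flow nu hnu t g)‖ ^ 2 ≤ 1440 * ‖modeCoef k g‖ ^ 2 := by
  refine flow_induction (P := fun g => nu * |(k : ℝ)| * t ^ 2 * ‖modeCoef k (flow nu hnu t g)‖ ^ 2
    ≤ 1440 * ‖modeCoef k g‖ ^ 2)
    (isClosed_le (by fun_prop) (by fun_prop)) (fun f f' hf => ?_) hnu g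
  have := decay_of_curve hnu (k := k) (by exact_mod_cast hk)
    (u := fun t => modeCoef k (flow nu hnu t f)) (h := fun t => modeCoef k (flow nu hnu t f'))
    (fun t ht => flow_mem hnu hf k ht)
    (flow_continuousOn hnu k f) (flow_continuousOn hnu k f')
    (fun t ht => flow_hasDerivWithinAt hnu hf k ht) ht
  simpa only [flow_zero] using this

theorem supBound_modeCoef_flow {k : ℤ} (hk : k ≠ 0) {t : ℝ} (ht : 0 < t) (g : L2) :
    SupBound k (modeCoef k (flow nu hnu t g))
      (Real.sqrt (103684 * (|(k : ℝ)| * Real.sqrt (nu * t ^ 3))⁻¹) * ‖modeCoef k g‖) := by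
  set c := Real.sqrt (103684 * (|(k : ℝ)| * Real.sqrt (nu * t ^ 3))⁻¹)
  have hc0 : 0 ≤ c := Real.sqrt_nonneg _
  have hdom : ∀ f f' : L2, (f, f') ∈ linGraph nu →
      SupBound k (modeCoef k (flow nu hnu t f)) (c * ‖modeCoef k f‖) := by
    intro f f' hf
    have := supBound_of_curve hnu (k := k) (by exact_mod_cast hk)
      (u := fun t => modeCoef k (flow nu hnu t f)) (h := fun t => modeCoef k (flow nu hnu t f'))
      (fun t ht => flow_mem hnu hf k ht)
      (flow_continuousOn hnu k f) (flow_continuousOn hnu k f')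
      (fun t ht => flow_hasDerivWithinAt hnu hf k ht) ht
    simpa only [flow_zero] using this
  refine supBound_of_approx fun ε hε => ?_
  have hcont : Continuous fun f : L2 => modeCoef k (flow nu hnu t f) := by fun_prop
  have hcont2 : Continuous fun f : L2 => c * ‖modeCoef k f‖ := by fun_prop
  have h1 : ∀ᶠ f in 𝓝 g, ‖modeCoef k (flow nu hnu t f) - modeCoef k (flow nu hnu t g)‖ < ε := by
    have := Metric.tendsto_nhds.1 (hcont.tendsto g) ε hε
    simpa only [dist_eq_norm] using this
  have h2 : ∀ᶠ f in 𝓝 g, c * ‖modeCoef k f‖ < c * ‖modeCoef k g‖ + ε :=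
    (hcont2.tendsto g).eventually (gt_mem_nhds (by linarith))
  obtain ⟨f, ⟨hf1, hf2⟩, f', hf⟩ := mem_closure_iff_nhds.1
    ((isMaxDissipative_linGraph hnu).dense_domain g) _ (h1.and h2)
  exact ⟨_, hf1, (hdom f f' hf).mono hf2.le⟩

/-- Weak `x`-derivatives are given by the Fourier modes. -/
theorem hasWeakDx_of_modes {f a : L2}
    (h : ∀ k : ℤ, modeCoef k a = (Complex.I * k) • modeCoef k f) : HasWeakDx f a := by
  intro φ hφ
  obtain ⟨T, hT⟩ := exists_pairing hφ.memLp
  obtain ⟨T', hT'⟩ := exists_pairing hφ.dx.memLp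
  rw [hT, hT', ← neg_eq_iff_eq_neg]
  refine (hasSum_pairing (T := T') f).neg.unique ?_
  have e : ∀ k : ℤ, -T' (modeEmb k (modeCoef k f)) = T (modeEmb k (modeCoef k a)) := by
    intro k
    rw [h k]
    refine denseRange_toL.induction_on (modeCoef k f) (isClosed_eq (by fun_prop) (by fun_prop))
      fun v => ?_
    rw [← hT', integral_modeEmb_dx k v hφ, hT, map_smul, map_smul, smul_eq_mul, neg_neg]
  simp_rw [e]
  exact hasSum_pairing a

theorem dxNorm_le {f g : L2} {m : ℝ} (hm : 0 ≤ m)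
    (h : ∀ k : ℤ, |(k : ℝ)| * ‖modeCoef k f‖ ≤ m * ‖modeCoef k g‖) :
    dxNorm f ≤ ENNReal.ofReal (m * ‖g‖) := by
  have hb : ∀ k : ℤ, ‖(Complex.I * k) • modeCoef k f‖ ^ 2 ≤ m ^ 2 * ‖modeCoef k g‖ ^ 2 := by
    intro k
    rw [norm_smul, norm_mul, Complex.norm_I, one_mul, Complex.norm_intCast, ← mul_pow]
    exact pow_le_pow_left₀ (by positivity) (h k) 2
  obtain ⟨a, ha⟩ := exists_of_summable_modes (b := fun k : ℤ => (Complex.I * k) • modeCoef k f)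
    (Summable.of_nonneg_of_le (fun k => by positivity) hb ((summable_norm_sq_modes g).mul_left _))
  have h1 : ‖a‖ ^ 2 ≤ (m * ‖g‖) ^ 2 := by
    rw [mul_pow]
    refine hasSum_le (fun k => ?_) (hasSum_norm_sq_modes a) ((hasSum_norm_sq_modes g).mul_left _)
    rw [ha k]
    exact hb k
  have h2 : ‖a‖ ≤ m * ‖g‖ := abs_le_of_sq_le_sq' h1 (by positivity) |>.2
  refine (iInf₂_le a (hasWeakDx_of_modes ha)).trans ?_
  rw [← ofReal_norm]
  exact ENNReal.ofReal_le_ofReal h2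

theorem dxNorm_flow_le_of_exp {t : ℝ} (ht : 0 < t) (g : L2) :
    dxNorm (flow nu hnu t g) ≤ ENNReal.ofReal ((nu * t) ^ (-(1 / 2) : ℝ) * ‖g‖) := by
  refine dxNorm_le (by positivity) fun k => ?_
  have h1 := norm_modeCoef_flow_le hnu k ht.le g
  -- After squaring, this is `x e^{-2x} ≤ 1` with `x = ν k² t`.
  have h2 : |(k : ℝ)| * Real.exp (-(nu * k ^ 2 * t)) ≤ (nu * t) ^ (-(1 / 2) : ℝ) := by
    rw [Real.rpow_neg (by positivity), ← Real.sqrt_eq_rpow, ← one_div,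
      le_div_iff₀ (Real.sqrt_pos.2 (by positivity))]
    refine abs_le_of_sq_le_sq' ?_ zero_le_one |>.2
    rw [mul_pow, mul_pow, Real.sq_sqrt (by positivity), sq_abs, one_pow, ← Real.exp_nat_mul]
    have h3 := Real.add_one_le_exp (nu * k ^ 2 * t)
    have h4 : Real.exp (-(nu * k ^ 2 * t)) * Real.exp (nu * k ^ 2 * t) = 1 := by
      rw [← Real.exp_add]; simp
    have h5 : Real.exp ((2 : ℕ) * -(nu * k ^ 2 * t)) ≤ Real.exp (-(nu * k ^ 2 * t)) := by
      refine Real.exp_le_exp.2 ?_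
      have : 0 ≤ nu * k ^ 2 * t := by positivity
      push_cast; linarith
    have h6 := Real.exp_pos (-(nu * k ^ 2 * t))
    have h7 : 0 ≤ nu * k ^ 2 * t := by positivity
    calc (k : ℝ) ^ 2 * Real.exp ((2 : ℕ) * -(nu * k ^ 2 * t)) * (nu * t)
        = (nu * k ^ 2 * t) * Real.exp ((2 : ℕ) * -(nu * k ^ 2 * t)) := by ring
      _ ≤ Real.exp (nu * k ^ 2 * t) * Real.exp (-(nu * k ^ 2 * t)) := by
          gcongr; linarith
      _ = 1 := by rw [mul_comm, h4]
  calc |(k : ℝ)| * ‖modeCoef k (flow nu hnu t g)‖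
      ≤ |(k : ℝ)| * (Real.exp (-(nu * k ^ 2 * t)) * ‖modeCoef k g‖) := by gcongr
    _ ≤ (nu * t) ^ (-(1 / 2) : ℝ) * ‖modeCoef k g‖ := by rw [← mul_assoc]; gcongr

/-- One use of the hypocoercive decay gains `|k|^{-1/2}`. Using it on each half of `[0, t]` gains a
full `|k|⁻¹`, which cancels the derivative and makes the bound uniform in `k`; `5760 = 4 · 1440`. -/
theorem dxNorm_flow_le_of_decay {t : ℝ} (ht : 0 < t) (g : L2) :
    dxNorm (flow nu hnu t g) ≤ ENNReal.ofReal (5760 / nu * t ^ (-2 : ℝ) * ‖g‖) := by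
  refine dxNorm_le (by positivity) fun k => ?_
  rcases eq_or_ne k 0 with rfl | hk
  · simp only [Int.cast_zero, abs_zero, zero_mul]; positivity
  have hK : 0 < |(k : ℝ)| := abs_pos.2 (by exact_mod_cast hk)
  have ht2 : 0 ≤ t / 2 := by positivity
  have h1 := decay_modeCoef_flow hnu hk ht2 (flow nu hnu (t / 2) g)
  have h2 := decay_modeCoef_flow hnu hk ht2 g
  rw [← flow_add hnu ht2 ht2, add_halves] at h1
  rw [Real.rpow_neg ht.le, Real.rpow_two, ← div_eq_mul_inv, div_div, div_mul_eq_mul_div,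
    le_div_iff₀ (by positivity)]
  refine abs_le_of_sq_le_sq' ?_ (by positivity) |>.2
  set a := ‖modeCoef k (flow nu hnu t g)‖ ^ 2
  set b := ‖modeCoef k (flow nu hnu (t / 2) g)‖ ^ 2
  set c := ‖modeCoef k g‖ ^ 2 with hc
  have h3 : nu * |(k : ℝ)| * (t / 2) ^ 2 * (nu * |(k : ℝ)| * (t / 2) ^ 2 * a)
      ≤ nu * |(k : ℝ)| * (t / 2) ^ 2 * (1440 * b) := by gcongr
  calc (|(k : ℝ)| * ‖modeCoef k (flow nu hnu t g)‖ * (nu * t ^ 2)) ^ 2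
      = 16 * (nu * |(k : ℝ)| * (t / 2) ^ 2 * (nu * |(k : ℝ)| * (t / 2) ^ 2 * a)) := by ring
    _ ≤ 16 * (1440 * (1440 * c)) := by linarith
    _ = (5760 * ‖modeCoef k g‖) ^ 2 := by rw [hc]; ring

theorem lintegral_rpow_Ioc {τ s : ℝ} (hτ : 0 < τ) (hs : -1 < s) :
    ∫⁻ t in Ioc 0 τ, ENNReal.ofReal (t ^ s) = ENNReal.ofReal (τ ^ (s + 1) / (s + 1)) := by
  have hi : IntegrableOn (fun t : ℝ => t ^ s) (Ioc 0 τ) := by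
    rw [← intervalIntegrable_iff_integrableOn_Ioc_of_le hτ.le]
    exact intervalIntegral.intervalIntegrable_rpow' hs
  rw [← ofReal_integral_eq_lintegral_ofReal hi]
  · rw [← intervalIntegral.integral_of_le hτ.le, integral_rpow (Or.inl hs),
      Real.zero_rpow (by linarith), sub_zero]
  · exact (ae_restrict_iff' measurableSet_Ioc).2 (Eventually.of_forall fun t ht =>
      Real.rpow_nonneg ht.1.le _)

theorem lintegral_rpow_Ioi {τ s : ℝ} (hτ : 0 < τ) (hs : s < -1) :
    ∫⁻ t in Ioi τ, ENNReal.ofReal (t ^ s) = ENNReal.ofReal (-τ ^ (s + 1) / (s + 1)) := by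
  rw [← ofReal_integral_eq_lintegral_ofReal (integrableOn_Ioi_rpow_of_lt hs hτ)]
  · rw [integral_Ioi_rpow_of_lt hs hτ]
  · exact (ae_restrict_iff' measurableSet_Ioi).2 (Eventually.of_forall fun t ht =>
      Real.rpow_nonneg (hτ.trans ht).le _)

theorem lintegral_Ioc_le_split {F : ℝ → ℝ≥0∞} {τ T : ℝ} (hτ : 0 < τ) :
    ∫⁻ t in Ioc 0 T, F t ≤ (∫⁻ t in Ioc 0 τ, F t) + ∫⁻ t in Ioi τ, F t := by
  refine (lintegral_mono_set (t := Ioc 0 τ ∪ Ioi τ) fun t ht => ?_).trans (lintegral_union_le _ _ _)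
  rw [Ioc_union_Ioi_eq_Ioi hτ.le]
  exact ht.1

/-- At `τ = ν^{-1/3}` the short time bound `(ν t)^{-1/2}` and the long time bound `(ν t²)⁻¹` both
integrate to order `ν^{-2/3}`, giving `5762 = 2 + 5760`. -/
theorem lintegral_dxNorm_flow_le (g : L2) (T : ℝ) :
    ∫⁻ t in Ioc 0 T, dxNorm (flow nu hnu t g)
      ≤ ENNReal.ofReal (5762 * nu ^ (-(2 / 3) : ℝ) * ‖g‖) := by
  set τ := nu ^ (-(1 / 3) : ℝ) with hτdef
  have hτ : 0 < τ := by positivity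
  refine (lintegral_Ioc_le_split hτ).trans ?_
  have h1 : ∫⁻ t in Ioc 0 τ, dxNorm (flow nu hnu t g)
      ≤ ENNReal.ofReal (2 * nu ^ (-(2 / 3) : ℝ) * ‖g‖) := by
    calc ∫⁻ t in Ioc 0 τ, dxNorm (flow nu hnu t g)
        ≤ ∫⁻ t in Ioc 0 τ, ENNReal.ofReal (nu ^ (-(1 / 2) : ℝ) * ‖g‖)
            * ENNReal.ofReal (t ^ (-(1 / 2) : ℝ)) := by
          refine setLIntegral_mono' measurableSet_Ioc fun t ht => ?_
          refine (dxNorm_flow_le_of_exp hnu ht.1 g).trans ?_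
          rw [← ENNReal.ofReal_mul (by positivity), Real.mul_rpow hnu.le ht.1.le]
          refine ENNReal.ofReal_le_ofReal (le_of_eq (by ring))
      _ = ENNReal.ofReal (2 * nu ^ (-(2 / 3) : ℝ) * ‖g‖) := by
          rw [lintegral_const_mul' _ _ ENNReal.ofReal_ne_top, lintegral_rpow_Ioc hτ (by norm_num),
            ← ENNReal.ofReal_mul (by positivity), hτdef, ← Real.rpow_mul hnu.le]
          congr 1
          have : nu ^ (-(2 / 3) : ℝ) = nu ^ (-(1 / 2) : ℝ)
              * nu ^ (-(1 / 3) * (-(1 / 2) + 1) : ℝ) := by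
            rw [← Real.rpow_add hnu]; norm_num
          rw [this]; ring
  have h2 : ∫⁻ t in Ioi τ, dxNorm (flow nu hnu t g)
      ≤ ENNReal.ofReal (5760 * nu ^ (-(2 / 3) : ℝ) * ‖g‖) := by
    calc ∫⁻ t in Ioi τ, dxNorm (flow nu hnu t g)
        ≤ ∫⁻ t in Ioi τ, ENNReal.ofReal (5760 / nu * ‖g‖) * ENNReal.ofReal (t ^ (-2 : ℝ)) := by
          refine setLIntegral_mono' measurableSet_Ioi fun t ht => ?_
          refine (dxNorm_flow_le_of_decay hnu (hτ.trans ht) g).trans ?_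
          rw [← ENNReal.ofReal_mul (by positivity)]
          refine ENNReal.ofReal_le_ofReal (le_of_eq (by ring))
      _ = ENNReal.ofReal (5760 * nu ^ (-(2 / 3) : ℝ) * ‖g‖) := by
          rw [lintegral_const_mul' _ _ ENNReal.ofReal_ne_top, lintegral_rpow_Ioi hτ (by norm_num),
            ← ENNReal.ofReal_mul (by positivity), hτdef, ← Real.rpow_mul hnu.le]
          congr 1
          have : nu ^ (-(2 / 3) : ℝ) = nu⁻¹ * nu ^ (-(1 / 3) * (-2 + 1) : ℝ) := by
            rw [← Real.rpow_neg_one, ← Real.rpow_add hnu]; norm_num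
          rw [this]; ring
  refine (add_le_add h1 h2).trans ?_
  rw [← ENNReal.ofReal_add (by positivity) (by positivity)]
  exact ENNReal.ofReal_le_ofReal (le_of_eq (by ring))

end FlowModes

/-! ### The energy dissipation estimate for the full gradient. -/

section Gradient

open SchwartzMap
open scoped SchwartzMap

/-- `b` is the weak derivative of `u` on the line. -/
def WeakD (u b : LR) : Prop :=
  ∀ v : 𝓢(ℝ, ℂ), inner ℂ (toL (Dop v)) u = -inner ℂ (toL v) b

theorem inner_greenL (k : ℝ) (z w : LR) : inner ℂ z (greenL k w) = inner ℂ (greenL k z) w := by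
  refine denseRange_toL.induction_on z (isClosed_eq (by fun_prop) (by fun_prop)) fun v => ?_
  refine denseRange_toL.induction_on w (isClosed_eq (by fun_prop) (by fun_prop)) fun x => ?_
  rw [greenL_toL, greenL_toL, Gop_symm]

theorem inner_dgreenL (k : ℝ) (z w : LR) :
    inner ℂ z (dgreenL k w) = -inner ℂ (dgreenL k z) w := by
  refine denseRange_toL.induction_on z (isClosed_eq (by fun_prop) (by fun_prop)) fun v => ?_
  refine denseRange_toL.induction_on w (isClosed_eq (by fun_prop) (by fun_prop)) fun x => ?_
  rw [dgreenL_toL, dgreenL_toL, Dop_Gop, ← Gop_symm, Dop_skew, neg_neg]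

/-- The Schwartz space is a core for the weak derivative. -/
theorem WeakD.induction {u b : LR} (h : WeakD u b) {U : Set (LR × LR)} (hU : IsClosed U)
    (hx : ∀ x : 𝓢(ℝ, ℂ), (toL x, toL (Dop x)) ∈ U) : (u, b) ∈ U := by
  have hgreen : ∀ v : 𝓢(ℝ, ℂ), Dop (Dop (Gop 1 v)) = Gop 1 v - v := by
    intro v
    nth_rewrite 3 [← green_Gop one_ne_zero v]
    simp
  have hu : u = greenL 1 u - dgreenL 1 b := by
    refine ext_inner_left ℂ fun z => ?_
    refine denseRange_toL.induction_on z (isClosed_eq (by fun_prop) (by fun_prop)) fun v => ?_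
    rw [inner_sub_right, inner_greenL, inner_dgreenL, greenL_toL, dgreenL_toL]
    have h1 := h (Dop (Gop 1 v))
    rw [hgreen, map_sub, inner_sub_left] at h1
    linear_combination -h1
  have hb : greenL 1 b = dgreenL 1 u := by
    refine ext_inner_left ℂ fun z => ?_
    refine denseRange_toL.induction_on z (isClosed_eq (by fun_prop) (by fun_prop)) fun v => ?_
    rw [inner_greenL, inner_dgreenL, greenL_toL, dgreenL_toL, h, neg_neg]
  have key : ∀ u b : LR, (greenL 1 u - dgreenL 1 b, dgreenL 1 u - greenL 1 b + b) ∈ U := by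
    intro u b
    refine denseRange_toL.induction_on u (hU.preimage (by fun_prop)) fun x => ?_
    refine denseRange_toL.induction_on b (hU.preimage (by fun_prop)) fun y => ?_
    have := hx (Gop 1 x - Dop (Gop 1 y))
    rw [map_sub Dop, hgreen] at this
    simp only [greenL_toL, dgreenL_toL]
    convert this using 2
    · rw [map_sub]
    · rw [map_sub, map_sub]; abel
  have := key u b
  rwa [← hu, hb, sub_self, zero_add] at this

theorem WeakD.integral_dy {u b : LR} (h : WeakD u b) (k : ℤ) {φ : Cyl → ℂ} (hφ : IsTest φ) :
    ∫ p, modeEmb k u p * dy φ p = -∫ p, modeEmb k b p * φ p := by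
  obtain ⟨T, hT⟩ := exists_pairing hφ.memLp
  obtain ⟨T', hT'⟩ := exists_pairing hφ.dy.memLp
  rw [hT, hT']
  refine h.induction (U := {z | T' (modeEmb k z.1) = -T (modeEmb k z.2)})
    (isClosed_eq (by fun_prop) (by fun_prop)) fun x => ?_
  change T' (modeEmb k (toL x)) = -T (modeEmb k (toL (Dop x)))
  rw [← hT, ← hT', integral_modeEmb_dy k x hφ]

theorem hasWeakDy_of_modes {f b : L2} (h : ∀ k, WeakD (modeCoef k f) (modeCoef k b)) :
    HasWeakDy f b := by
  intro φ hφ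
  obtain ⟨T, hT⟩ := exists_pairing hφ.memLp
  obtain ⟨T', hT'⟩ := exists_pairing hφ.dy.memLp
  rw [hT, hT', ← neg_eq_iff_eq_neg]
  refine (hasSum_pairing (T := T') f).neg.unique ?_
  have e : ∀ k : ℤ, -T' (modeEmb k (modeCoef k f)) = T (modeEmb k (modeCoef k b)) := by
    intro k
    rw [← hT', (h k).integral_dy k hφ, hT, neg_neg]
  simp_rw [e]
  exact hasSum_pairing b

/-- The squared norm of the gradient of the `k`-th mode, in variational form. -/
def modeGrad (k : ℝ) (u : LR) : ℝ≥0∞ :=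
  ⨆ (v : 𝓢(ℝ, ℂ)) (_ : ‖toL v‖ ≤ 1),
    ENNReal.ofReal (k ^ 2 * ‖u‖ ^ 2 + ‖inner ℂ (toL (Dop v)) u‖ ^ 2)

/-- This is the purpose of the variational form: it is defined without any regularity, is measurable
along the flow, and is compatible with Fatou's lemma. -/
theorem lowerSemicontinuous_modeGrad (k : ℝ) : LowerSemicontinuous (modeGrad k) := by
  refine lowerSemicontinuous_iSup fun v => lowerSemicontinuous_iSup fun _ => ?_
  refine Continuous.lowerSemicontinuous (ENNReal.continuous_ofReal.comp ?_)
  fun_prop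

/-- On Schwartz functions the right side equals `‖Dw‖² + k² ‖w‖²`, and the inequality for each test
vector is closed in the graph norm. -/
theorem modeGrad_le_of_mem {nu k : ℝ} (hnu : 0 < nu) {p : LR × LR} (hp : p ∈ modeGraph nu k) :
    modeGrad k p.1 ≤ ENNReal.ofReal (-nu⁻¹ * (inner ℂ p.2 p.1).re) := by
  refine iSup₂_le fun v hv => ENNReal.ofReal_le_ofReal ?_
  refine modeGraph_induction (P := fun p => k ^ 2 * ‖p.1‖ ^ 2 + ‖inner ℂ (toL (Dop v)) p.1‖ ^ 2
    ≤ -nu⁻¹ * (inner ℂ p.2 p.1).re) (isClosed_le (by fun_prop) (by fun_prop)) (fun w => ?_) hp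
  have h1 : (inner ℂ (toL (modeS nu k w)) (toL w)).re
      = -nu * (‖toL (Dop w)‖ ^ 2 + k ^ 2 * ‖toL w‖ ^ 2) := re_inner_modeS nu k w
  have h2 : ‖inner ℂ (toL (Dop v)) (toL w)‖ ≤ ‖toL (Dop w)‖ := by
    rw [Dop_skew, norm_neg]
    exact (norm_inner_le_norm _ _).trans (mul_le_of_le_one_left (norm_nonneg _) hv)
  have h3 : ‖inner ℂ (toL (Dop v)) (toL w)‖ ^ 2 ≤ ‖toL (Dop w)‖ ^ 2 := by gcongr
  simp only
  rw [h1]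
  have : -nu⁻¹ * (-nu * (‖toL (Dop w)‖ ^ 2 + k ^ 2 * ‖toL w‖ ^ 2))
      = ‖toL (Dop w)‖ ^ 2 + k ^ 2 * ‖toL w‖ ^ 2 := by field_simp
  rw [this]
  linarith

/-- Finiteness means that `v ↦ ⟨u, Dv⟩` is bounded in `L²`; the Riesz representation of its
extension is the weak derivative, up to sign. -/
theorem exists_weakD {k : ℝ} {u : LR} (h : modeGrad k u ≠ ⊤) :
    ∃ b, WeakD u b ∧ k ^ 2 * ‖u‖ ^ 2 + ‖b‖ ^ 2 ≤ (modeGrad k u).toReal := by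
  set M := (modeGrad k u).toReal with hM
  have h1 : ∀ v : 𝓢(ℝ, ℂ), ‖toL v‖ ≤ 1 →
      k ^ 2 * ‖u‖ ^ 2 + ‖inner ℂ (toL (Dop v)) u‖ ^ 2 ≤ M := by
    intro v hv
    have := le_iSup₂ (f := fun (v : 𝓢(ℝ, ℂ)) (_ : ‖toL v‖ ≤ 1) =>
      ENNReal.ofReal (k ^ 2 * ‖u‖ ^ 2 + ‖inner ℂ (toL (Dop v)) u‖ ^ 2)) v hv
    exact (ENNReal.ofReal_le_iff_le_toReal h).1 this
  have hM0 : 0 ≤ M - k ^ 2 * ‖u‖ ^ 2 := by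
    have := h1 0 (by simp)
    simp at this
    linarith
  set N := Real.sqrt (M - k ^ 2 * ‖u‖ ^ 2) with hN
  have hN2 : N ^ 2 = M - k ^ 2 * ‖u‖ ^ 2 := Real.sq_sqrt hM0
  have hN0 : 0 ≤ N := Real.sqrt_nonneg _
  have h2 : ∀ v : 𝓢(ℝ, ℂ), ‖toL v‖ ≤ 1 → ‖inner ℂ (toL (Dop v)) u‖ ≤ N := by
    intro v hv
    refine Real.le_sqrt_of_sq_le ?_
    linarith [h1 v hv]
  have h3 : ∀ v : 𝓢(ℝ, ℂ), ‖inner ℂ (toL (Dop v)) u‖ ≤ N * ‖toL v‖ := by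
    intro v
    refine le_of_forall_pos_le_add fun ε hε => ?_
    -- Normalizing by slightly more than the norm avoids a separate case for norm zero.
    set r := ‖toL v‖ + ε / (N + 1) with hr
    have hr0 : 0 < r := by positivity
    have h4 := h2 (((r⁻¹ : ℝ) : ℂ) • v) (by
      rw [map_smul, norm_smul, Complex.norm_real, Real.norm_eq_abs, abs_of_pos (by positivity),
        inv_mul_le_iff₀ hr0, mul_one]
      rw [hr]; have : 0 < ε / (N + 1) := by positivity
      linarith)
    rw [map_smul, map_smul, inner_smul_left, norm_mul, RCLike.norm_conj, Complex.norm_real,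
      Real.norm_eq_abs, abs_of_pos (by positivity), inv_mul_le_iff₀ hr0] at h4
    refine h4.trans ?_
    rw [hr, add_mul, mul_comm]
    have : ε / (N + 1) * N ≤ ε := by
      rw [div_mul_eq_mul_div, div_le_iff₀ (by positivity)]; nlinarith
    linarith
  set ℓ : 𝓢(ℝ, ℂ) →ₗ[ℂ] ℂ := (innerSL ℂ u).toLinearMap ∘ₗ toL ∘ₗ Dop with hℓ
  have h5 : ∀ v, ‖ℓ v‖ ≤ N * ‖toL v‖ := by
    intro v
    exact (le_of_eq (norm_inner_symm _ _)).trans (h3 v)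
  set E : LR →L[ℂ] ℂ := ℓ.extendOfNorm toL with hE
  have hE1 : ∀ v, E (toL v) = inner ℂ u (toL (Dop v)) := fun v =>
    LinearMap.extendOfNorm_eq denseRange_toL ⟨N, h5⟩ v
  have hE2 : ‖E‖ ≤ N := LinearMap.opNorm_extendOfNorm_le denseRange_toL hN0 h5
  set b := (InnerProductSpace.toDual ℂ LR).symm E with hb
  refine ⟨-b, fun v => ?_, ?_⟩
  · have : inner ℂ b (toL v) = inner ℂ u (toL (Dop v)) := by
      rw [hb, InnerProductSpace.toDual_symm_apply, hE1]
    rw [inner_neg_right, neg_neg, ← inner_conj_symm, ← this, inner_conj_symm]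
  · rw [norm_neg, hb, LinearIsometryEquiv.norm_map]
    have : ‖E‖ ^ 2 ≤ N ^ 2 := by gcongr
    linarith

theorem gradNormSq_le_tsum (f : L2) : gradNormSq f ≤ ∑' k : ℤ, modeGrad k (modeCoef k f) := by
  by_cases htop : ∑' k : ℤ, modeGrad k (modeCoef k f) = ⊤
  · rw [htop]; exact le_top
  have hfin : ∀ k : ℤ, modeGrad k (modeCoef k f) ≠ ⊤ := ENNReal.ne_top_of_tsum_ne_top htop
  choose b hb1 hb2 using fun k : ℤ => exists_weakD (hfin k)
  have hsum : Summable fun k : ℤ => (modeGrad k (modeCoef k f)).toReal :=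
    ENNReal.summable_toReal htop
  have ha : ∀ k : ℤ, ‖(Complex.I * k) • modeCoef k f‖ ^ 2 = (k : ℝ) ^ 2 * ‖modeCoef k f‖ ^ 2 := by
    intro k
    rw [norm_smul, norm_mul, Complex.norm_I, one_mul, Complex.norm_intCast, mul_pow, sq_abs]
  obtain ⟨a, ha1⟩ := exists_of_summable_modes (b := fun k : ℤ => (Complex.I * k) • modeCoef k f)
    (Summable.of_nonneg_of_le (fun k => by positivity)
      (fun k => by rw [ha]; linarith [hb2 k, sq_nonneg ‖b k‖]) hsum)
  obtain ⟨c, hc1⟩ := exists_of_summable_modes (b := b)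
    (Summable.of_nonneg_of_le (fun k => by positivity)
      (fun k => by
        have : 0 ≤ (k : ℝ) ^ 2 * ‖modeCoef k f‖ ^ 2 := by positivity
        linarith [hb2 k]) hsum)
  have hle : ‖a‖ ^ 2 + ‖c‖ ^ 2 ≤ ∑' k : ℤ, (modeGrad k (modeCoef k f)).toReal := by
    refine hasSum_le (fun k => ?_) ((hasSum_norm_sq_modes a).add (hasSum_norm_sq_modes c))
      hsum.hasSum
    rw [ha1, hc1, ha]
    exact hb2 k
  refine (iInf_le_of_le a (iInf_le_of_le c (iInf₂_le (hasWeakDx_of_modes ha1)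
    (hasWeakDy_of_modes fun k => by rw [hc1]; exact hb1 k)))).trans ?_
  rw [← ofReal_norm, ← ofReal_norm, ← ENNReal.ofReal_pow (norm_nonneg _),
    ← ENNReal.ofReal_pow (norm_nonneg _), ← ENNReal.ofReal_add (by positivity) (by positivity)]
  refine (ENNReal.ofReal_le_ofReal hle).trans ?_
  rw [← ENNReal.tsum_toReal_eq hfin, ENNReal.ofReal_toReal htop]

/-- Since `N' = 2e`, integrating and discarding `N T ≥ 0` leaves the sharp factor one half. Right
derivatives suffice. -/
theorem lintegral_neg_deriv_le {N e : ℝ → ℝ} {T c : ℝ} (hT : 0 < T) (hc : 0 < c)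
    (hN : ContinuousOn N (Icc 0 T)) (he : ContinuousOn e (Icc 0 T))
    (hd : ∀ t ∈ Ioo 0 T, HasDerivWithinAt N (2 * e t) (Ioi t) t) (hneg : ∀ t ∈ Ioc 0 T, e t ≤ 0)
    (hN0 : 0 ≤ N T) :
    ∫⁻ t in Ioc 0 T, ENNReal.ofReal (-c * e t) ≤ ENNReal.ofReal (1 / 2 * c * N 0) := by
  have hint : IntervalIntegrable (fun t => 2 * e t) volume 0 T :=
    ContinuousOn.intervalIntegrable_of_Icc hT.le (continuousOn_const.mul he)
  have hftc := intervalIntegral.integral_eq_sub_of_hasDeriv_right_of_le hT.le hN hd hint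
  have hneg' : ∀ t ∈ Ioc 0 T, 0 ≤ -c * e t := fun t ht =>
    mul_nonneg_of_nonpos_of_nonpos (neg_nonpos.2 hc.le) (hneg t ht)
  have hi : IntegrableOn (fun t => -c * e t) (Ioc 0 T) :=
    ((continuousOn_const.mul he).integrableOn_Icc).mono_set Ioc_subset_Icc_self
  rw [← ofReal_integral_eq_lintegral_ofReal hi
    ((ae_restrict_iff' measurableSet_Ioc).2 (Eventually.of_forall hneg'))]
  refine ENNReal.ofReal_le_ofReal ?_
  rw [integral_const_mul, ← intervalIntegral.integral_of_le hT.le]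
  rw [intervalIntegral.integral_const_mul] at hftc
  nlinarith

theorem lintegral_modeGrad_flow_le_of_mem {nu : ℝ} (hnu : 0 < nu) {f f' : L2}
    (hf : (f, f') ∈ linGraph nu) (k : ℤ) {T : ℝ} (hT : 0 < T) :
    ∫⁻ t in Ioc 0 T, modeGrad k (modeCoef k (flow nu hnu t f))
      ≤ ENNReal.ofReal (1 / 2 * nu⁻¹ * ‖modeCoef k f‖ ^ 2) := by
  have h1 : ContinuousOn (fun t => modeCoef k (flow nu hnu t f)) (Icc 0 T) :=
    (flow_continuousOn hnu k f).mono fun s hs => hs.1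
  have h2 : ContinuousOn (fun t => modeCoef k (flow nu hnu t f')) (Icc 0 T) :=
    (flow_continuousOn hnu k f').mono fun s hs => hs.1
  have h3 := lintegral_neg_deriv_le (N := fun t => ‖modeCoef k (flow nu hnu t f)‖ ^ 2)
    (e := fun t => (inner ℂ (modeCoef k (flow nu hnu t f')) (modeCoef k (flow nu hnu t f))).re)
    hT (inv_pos.2 hnu) (h1.norm.pow 2) (Complex.continuous_re.comp_continuousOn (h2.inner h1))
    (fun t ht => (flow_hasDerivWithinAt_norm_sq hnu hf k ht.1.le).mono Ioi_subset_Ici_self)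
    (fun t ht => re_inner_nonpos_of_mem_modeGraph hnu.le (flow_mem hnu hf k ht.1.le))
    (sq_nonneg _)
  rw [flow_zero] at h3
  exact (setLIntegral_mono' measurableSet_Ioc fun t ht =>
    modeGrad_le_of_mem hnu (flow_mem hnu hf k ht.1.le)).trans h3

/-- Continuity of the flow is known only for nonnegative times, hence the truncation `max t 0`. -/
theorem measurable_modeGrad_flow {nu : ℝ} (hnu : 0 < nu) (k : ℤ) (g : L2) :
    Measurable fun t : ℝ => modeGrad k (modeCoef k (flow nu hnu (max t 0) g)) := by
  have hc : Continuous fun t : ℝ => modeCoef k (flow nu hnu (max t 0) g) :=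
    (flow_continuousOn hnu k g).comp_continuous (by fun_prop) fun t => le_max_right t 0
  exact ((lowerSemicontinuous_modeGrad k).comp hc).measurable

theorem setLIntegral_max {F : ℝ → ℝ≥0∞} {T : ℝ} :
    ∫⁻ t in Ioc 0 T, F t = ∫⁻ t in Ioc 0 T, F (max t 0) :=
  setLIntegral_congr_fun measurableSet_Ioc fun t ht => by simp only [max_eq_left ht.1.le]

/-- Approximate the data from the domain. Lower semicontinuity pointwise in time and Fatou's lemma
carry the bound to arbitrary data. -/
theorem lintegral_modeGrad_flow_le {nu : ℝ} (hnu : 0 < nu) (g : L2) (k : ℤ) {T : ℝ} (hT : 0 < T) :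
    ∫⁻ t in Ioc 0 T, modeGrad k (modeCoef k (flow nu hnu t g))
      ≤ ENNReal.ofReal (1 / 2 * nu⁻¹ * ‖modeCoef k g‖ ^ 2) := by
  obtain ⟨f, hf, hlim⟩ := mem_closure_iff_seq_limit.1
    ((isMaxDissipative_linGraph hnu).dense_domain g)
  choose f' hf' using hf
  have h1 : ∀ t, modeGrad k (modeCoef k (flow nu hnu (max t 0) g))
      ≤ liminf (fun n => modeGrad k (modeCoef k (flow nu hnu (max t 0) (f n)))) atTop := by
    intro t
    have hc : Tendsto (fun n => modeCoef k (flow nu hnu (max t 0) (f n))) atTop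
        (𝓝 (modeCoef k (flow nu hnu (max t 0) g))) :=
      (((modeCoef k).comp (flow nu hnu (max t 0))).continuous.tendsto g).comp hlim
    exact ((lowerSemicontinuous_modeGrad k).le_liminf _).trans (liminf_le_liminf_of_le hc)
  have h2 : Tendsto (fun n => ENNReal.ofReal (1 / 2 * nu⁻¹ * ‖modeCoef k (f n)‖ ^ 2)) atTop
      (𝓝 (ENNReal.ofReal (1 / 2 * nu⁻¹ * ‖modeCoef k g‖ ^ 2))) := by
    have hc : Continuous fun f : L2 => ENNReal.ofReal (1 / 2 * nu⁻¹ * ‖modeCoef k f‖ ^ 2) :=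
      ENNReal.continuous_ofReal.comp (by fun_prop)
    exact (hc.tendsto g).comp hlim
  rw [setLIntegral_max]
  refine (lintegral_mono h1).trans ((lintegral_liminf_le fun n =>
    measurable_modeGrad_flow hnu k (f n)).trans ?_)
  rw [← h2.liminf_eq]
  refine liminf_le_liminf (Eventually.of_forall fun n => ?_)
  rw [← setLIntegral_max (F := fun t => modeGrad k (modeCoef k (flow nu hnu t (f n))))]
  exact lintegral_modeGrad_flow_le_of_mem hnu (hf' n) k hT

theorem lintegral_gradNormSq_flow_le {nu : ℝ} (hnu : 0 < nu) (g : L2) {T : ℝ} (hT : 0 < T) :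
    ∫⁻ t in Ioc 0 T, gradNormSq (flow nu hnu t g)
      ≤ ENNReal.ofReal (1 / 2 * nu⁻¹ * ‖g‖ ^ 2) := by
  calc ∫⁻ t in Ioc 0 T, gradNormSq (flow nu hnu t g)
      ≤ ∫⁻ t in Ioc 0 T, ∑' k : ℤ, modeGrad k (modeCoef k (flow nu hnu (max t 0) g)) := by
        rw [setLIntegral_max]
        exact lintegral_mono fun t => gradNormSq_le_tsum _
    _ = ∑' k : ℤ, ∫⁻ t in Ioc 0 T, modeGrad k (modeCoef k (flow nu hnu (max t 0) g)) :=
        lintegral_tsum fun k => (measurable_modeGrad_flow hnu k g).aemeasurable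
    _ ≤ ∑' k : ℤ, ENNReal.ofReal (1 / 2 * nu⁻¹ * ‖modeCoef k g‖ ^ 2) := by
        refine ENNReal.tsum_le_tsum fun k => ?_
        rw [← setLIntegral_max (F := fun t => modeGrad k (modeCoef k (flow nu hnu t g)))]
        exact lintegral_modeGrad_flow_le hnu g k hT
    _ = ENNReal.ofReal (1 / 2 * nu⁻¹ * ‖g‖ ^ 2) := by
        have hs := (hasSum_norm_sq_modes g).mul_left (1 / 2 * nu⁻¹)
        rw [← hs.tsum_eq, ENNReal.ofReal_tsum_of_nonneg (fun k => by positivity) hs.summable]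

end Gradient

/-! ### From supremum bounds on modes to the supremum norm of `∇Δ⁻¹`. -/

section SupNorm

open SchwartzMap
open scoped SchwartzMap

theorem abs_cnorm_le_one : |cnorm| ≤ 1 := by
  rw [cnorm, abs_of_nonneg (by positivity)]
  refine inv_le_one_of_one_le₀ (Real.one_le_sqrt.2 ?_)
  linarith [Real.pi_gt_three]

theorem ae_norm_modeEmb_le (k : ℤ) {u : LR} {B : ℝ} (h : ∀ᵐ y, ‖u y‖ ≤ B) :
    ∀ᵐ p, ‖modeEmb k u p‖ ≤ B := by
  rw [modeEmb_eq]
  have h' := Measure.quasiMeasurePreserving_snd.ae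
    (μa := (volume : Measure Cyl)) (μb := (volume : Measure ℝ)) h
  filter_upwards [(memLp_modeFun k (Lp.memLp u)).coeFn_toLp, h'] with p hp hp'
  rw [hp, modeFun, norm_mul, norm_mul, Complex.norm_real, fourier_apply, Circle.norm_coe, mul_one,
    Real.norm_eq_abs]
  exact (mul_le_of_le_one_left (norm_nonneg _) abs_cnorm_le_one).trans hp'

/-- Finite partial sums obey the bound by the triangle inequality and converge in `L²`, so
`ae_norm_le_of_approx` applies without pointwise convergence of the series. -/
theorem ae_norm_le_tsum {F : L2} {B : ℤ → ℝ} (hB0 : ∀ k, 0 ≤ B k) (hB : Summable B)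
    (h : ∀ k, ∀ᵐ y, ‖modeCoef k F y‖ ≤ B k) : ∀ᵐ p, ‖F p‖ ≤ ∑' k, B k := by
  have hsum : ∀ s : Finset ℤ, ∀ᵐ p, ‖(∑ k ∈ s, modeEmb k (modeCoef k F) : L2) p‖
      ≤ ∑ k ∈ s, B k := by
    intro s
    induction s using Finset.induction_on with
    | empty =>
      simp only [Finset.sum_empty]
      exact Eventually.of_forall fun p => by simp
    | insert k s hk ih =>
      simp only [Finset.sum_insert hk]
      filter_upwards [Lp.coeFn_add (modeEmb k (modeCoef k F))
        (∑ k ∈ s, modeEmb k (modeCoef k F)), ih, ae_norm_modeEmb_le k (h k)] with p hp h1 h2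
      rw [hp, Pi.add_apply]
      exact (norm_add_le _ _).trans (add_le_add h2 h1)
  refine ae_norm_le_of_approx fun ε hε => ?_
  obtain ⟨s, hs⟩ := ((Metric.tendsto_nhds.1 (hasSum_modes F)) ε hε).exists
  rw [dist_eq_norm] at hs
  refine ⟨_, hs, (hsum s).mono fun p hp => hp.trans ?_⟩
  linarith [hB.sum_le_tsum s fun k _ => hB0 k]

theorem norm_dgreenL_le {k : ℤ} (hk : k ≠ 0) (u : LR) : ‖dgreenL k u‖ ≤ ‖u‖ := by
  refine (norm_extL_le (Dop_Gop_bound k) u).trans (mul_le_of_le_one_left (norm_nonneg _) ?_)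
  exact inv_le_one_of_one_le₀ (by exact_mod_cast Int.one_le_abs hk)

theorem abs_mul_norm_greenL_le (k : ℤ) (u : LR) : |(k : ℝ)| * ‖greenL k u‖ ≤ ‖u‖ := by
  rcases eq_or_ne k 0 with rfl | hk
  · simp
  have h := norm_extL_le (Gop_bound k) u
  have hK : (1 : ℝ) ≤ |(k : ℝ)| := by exact_mod_cast Int.one_le_abs hk
  calc |(k : ℝ)| * ‖greenL k u‖ ≤ |(k : ℝ)| * (((k : ℝ) ^ 2)⁻¹ * ‖u‖) := by gcongr; exact h
    _ = |(k : ℝ)|⁻¹ * ‖u‖ := by rw [← sq_abs]; field_simp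
    _ ≤ ‖u‖ := mul_le_of_le_one_left (norm_nonneg _) (inv_le_one_of_one_le₀ hK)

theorem weakD_greenL (k : ℝ) (u : LR) : WeakD (greenL k u) (dgreenL k u) := by
  intro v
  refine denseRange_toL.induction_on u (isClosed_eq (by fun_prop) (by fun_prop)) fun x => ?_
  rw [greenL_toL, dgreenL_toL, Dop_skew]

theorem WeakD.neg {u b : LR} (h : WeakD u b) : WeakD (-u) (-b) := by
  intro v
  rw [inner_neg_right, inner_neg_right, h v]

theorem exists_of_norm_le {f : L2} {b : ℤ → LR} (h : ∀ k, ‖b k‖ ≤ ‖modeCoef k f‖) :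
    ∃ g, ∀ k, modeCoef k g = b k :=
  exists_of_summable_modes (Summable.of_nonneg_of_le (fun k => by positivity)
    (fun k => pow_le_pow_left₀ (norm_nonneg _) (h k) 2) (summable_norm_sq_modes f))

/-- The inverse Laplacian and its gradient are built from their modes. Both components are bounded
by the same sum, and the factor two covers the Euclidean length. -/
theorem gradInvLapSup_le {f : L2} (h0 : modeCoef 0 f = 0) {B : ℤ → ℝ} (hB0 : ∀ k, 0 ≤ B k)
    (hB : ∀ k : ℤ, k ≠ 0 → SupBound k (modeCoef k f) (B k)) :
    gradInvLapSup f ≤ 2 * ∑' k, ENNReal.ofReal (B k) := by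
  rcases eq_or_ne (∑' k, ENNReal.ofReal (B k)) ⊤ with htop | htop
  · rw [htop, ENNReal.mul_top two_ne_zero]; exact le_top
  have hs : Summable B := by
    have := ENNReal.summable_toReal htop
    simpa only [ENNReal.toReal_ofReal (hB0 _)] using this
  rw [← ENNReal.ofReal_tsum_of_nonneg hB0 hs]
  obtain ⟨ψ, hψ⟩ := exists_of_norm_le (f := f) (b := fun k : ℤ => -greenL k (modeCoef k f))
    fun k => by rw [norm_neg]; exact norm_greenL_le k _
  obtain ⟨a, ha⟩ := exists_of_norm_le (f := f)
    (b := fun k : ℤ => (Complex.I * k) • -greenL k (modeCoef k f)) fun k => by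
      rw [norm_smul, norm_mul, Complex.norm_I, one_mul, Complex.norm_intCast, norm_neg]
      exact abs_mul_norm_greenL_le k _
  obtain ⟨b, hb⟩ := exists_of_norm_le (f := f)
    (b := fun k : ℤ => -dgreenL k (modeCoef k f)) fun k => by
      rw [norm_neg]
      rcases eq_or_ne k 0 with rfl | hk
      · simp [h0]
      · exact norm_dgreenL_le hk _
  have hf : Pneq f = f := ext_modes fun k => by
    rw [modeCoef_Pneq]
    split_ifs with hk
    · rw [hk, h0]
    · rfl
  have hinv : IsInvLaplacian f ψ := by
    rw [← hf, isInvLaplacian_iff]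
    exact hψ
  have hdx : HasWeakDx ψ a := hasWeakDx_of_modes fun k => by rw [ha, hψ]
  have hdy : HasWeakDy ψ b := hasWeakDy_of_modes fun k => by
    rw [hb, hψ]
    exact (weakD_greenL k _).neg
  have hzero : ∀ k : ℤ, ∀ᵐ y, ‖(0 : LR) y‖ ≤ B k := fun k => by
    filter_upwards [Lp.coeFn_zero ℂ 2 (volume : Measure ℝ)] with y hy
    rw [hy, Pi.zero_apply, norm_zero]
    exact hB0 k
  have hA := ae_norm_le_tsum (F := a) hB0 hs fun k => by
    rw [ha]
    rcases eq_or_ne k 0 with rfl | hk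
    · rw [h0, map_zero, neg_zero, smul_zero]; exact hzero 0
    filter_upwards [(hB k hk).1, Lp.coeFn_smul (Complex.I * k) (-greenL k (modeCoef k f)),
      Lp.coeFn_neg (greenL k (modeCoef k f)),
      Lp.coeFn_smul (((|(k : ℝ)| : ℝ) : ℂ)) (greenL k (modeCoef k f))] with y h1 h2 h3 h4
    rw [h4, Pi.smul_apply, norm_smul, Complex.norm_real, Real.norm_eq_abs, abs_abs] at h1
    rw [h2, Pi.smul_apply, h3, Pi.neg_apply, norm_smul, norm_neg, norm_mul, Complex.norm_I,
      one_mul, Complex.norm_intCast]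
    exact h1
  have hB' := ae_norm_le_tsum (F := b) hB0 hs fun k => by
    rw [hb]
    rcases eq_or_ne k 0 with rfl | hk
    · rw [h0, map_zero, neg_zero]; exact hzero 0
    filter_upwards [(hB k hk).2, Lp.coeFn_neg (dgreenL k (modeCoef k f))] with y h1 h2
    rw [h2, Pi.neg_apply, norm_neg]
    exact h1
  refine (iInf₂_le ψ a).trans ((iInf₂_le b hinv).trans ((iInf₂_le hdx hdy).trans ?_))
  rw [eLpNorm_exponent_top]
  have hS : 0 ≤ ∑' k, B k := tsum_nonneg hB0
  have : ENNReal.ofReal (2 * ∑' k, B k) = 2 * ENNReal.ofReal (∑' k, B k) := by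
    rw [ENNReal.ofReal_mul two_pos.le, ENNReal.ofReal_ofNat]
  rw [← this]
  refine eLpNormEssSup_le_of_ae_bound ?_
  filter_upwards [hA, hB'] with p h1 h2
  rw [Real.norm_eq_abs, abs_of_nonneg (Real.sqrt_nonneg _)]
  refine Real.sqrt_le_iff.2 ⟨by positivity, ?_⟩
  nlinarith [norm_nonneg (a p), norm_nonneg (b p)]

end SupNorm

/-! ### Summation over modes and the logarithm. -/

section LogSum

/-- Hölder's inequality for the counting measure. -/
theorem sq_tsum_mul_le {ι : Type*} (f g : ι → ℝ≥0∞) :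
    (∑' i, f i * g i) ^ 2 ≤ (∑' i, f i ^ 2) * ∑' i, g i ^ 2 := by
  let _ : MeasurableSpace ι := ⊤
  have h := ENNReal.lintegral_mul_le_Lp_mul_Lq (Measure.count : Measure ι)
    Real.HolderConjugate.two_two (f := f) (g := g) measurable_from_top.aemeasurable
    measurable_from_top.aemeasurable
  simp only [lintegral_count, Pi.mul_apply, ENNReal.rpow_two] at h
  calc (∑' i, f i * g i) ^ 2
      ≤ ((∑' i, f i ^ 2) ^ (1 / 2 : ℝ) * (∑' i, g i ^ 2) ^ (1 / 2 : ℝ)) ^ 2 := by gcongr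
    _ = (∑' i, f i ^ 2) * ∑' i, g i ^ 2 := by
      rw [mul_pow, ← ENNReal.rpow_natCast, ← ENNReal.rpow_natCast, ← ENNReal.rpow_mul,
        ← ENNReal.rpow_mul]
      norm_num

/-- The logarithmically divergent harmonic sum, cut off at `N`. -/
theorem sum_cutoff_le {N : ℝ} (hN : 0 < N) (M : ℕ) :
    ∑ i ∈ Finset.range M, ((i : ℝ) + 1)⁻¹ * min 1 (N ^ 2 / ((i : ℝ) + 1) ^ 2)
      ≤ 2 + Real.log (N + 1) := by
  set F : ℕ → ℝ := fun i => ((i : ℝ) + 1)⁻¹ * min 1 (N ^ 2 / ((i : ℝ) + 1) ^ 2) with hF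
  have hF0 : ∀ i, 0 ≤ F i := fun i => by positivity
  set m := ⌈N⌉₊ with hm
  have hm0 : 0 < m := Nat.ceil_pos.2 hN
  have hmr : (0 : ℝ) < m := by exact_mod_cast hm0
  have hmN : N ≤ m := Nat.le_ceil N
  have hhead : ∑ i ∈ Finset.range m, F i ≤ 1 + Real.log (N + 1) := by
    calc ∑ i ∈ Finset.range m, F i ≤ ∑ i ∈ Finset.range m, ((i : ℝ) + 1)⁻¹ :=
          Finset.sum_le_sum fun i _ => mul_le_of_le_one_right (by positivity) (min_le_left _ _)
      _ = ((harmonic m : ℚ) : ℝ) := by rw [harmonic]; push_cast; rfl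
      _ ≤ 1 + Real.log m := harmonic_le_one_add_log m
      _ ≤ 1 + Real.log (N + 1) := by
          gcongr
          exact (Nat.ceil_lt_add_one hN.le).le
  -- Beyond the cutoff the terms are of order `N² / i³`, dominated by the telescoping differences
  -- `m/(m+L) - m/(m+L+1)`, so the tail costs at most one.
  have htail : ∀ L : ℕ, ∑ i ∈ Finset.range L, F (m + i) ≤ 1 - m / (m + L) := by
    intro L
    induction L with
    | zero => simp [hmr.ne']
    | succ L ih =>
      rw [Finset.sum_range_succ]
      have h1 : F (m + L) ≤ m / (m + L) - m / (m + L + 1) := by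
        have hL : (0 : ℝ) ≤ L := L.cast_nonneg
        calc F (m + L) ≤ ((m : ℝ) + L + 1)⁻¹ * (N ^ 2 / ((m : ℝ) + L + 1) ^ 2) := by
              rw [hF]; push_cast; gcongr; exact min_le_right _ _
          _ ≤ ((m : ℝ) + L + 1)⁻¹ * ((m : ℝ) * (m + L) / ((m : ℝ) + L) ^ 2) := by
              gcongr ?_ * (?_ / ?_ ^ 2)
              · nlinarith
              · linarith
          _ = m / (m + L) - m / (m + L + 1) := by field_simp; ring
      push_cast
      rw [← add_assoc]
      linarith
  calc ∑ i ∈ Finset.range M, F i ≤ ∑ i ∈ Finset.range (m + M), F i :=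
        Finset.sum_le_sum_of_subset_of_nonneg
          (Finset.range_mono (Nat.le_add_left M m)) fun i _ _ => hF0 i
    _ = ∑ i ∈ Finset.range m, F i + ∑ i ∈ Finset.range M, F (m + i) :=
        Finset.sum_range_add _ _ _
    _ ≤ 2 + Real.log (N + 1) := by
        have := htail M
        have h2 : (0 : ℝ) ≤ m / (m + M) := by positivity
        linarith

theorem log_rpow_add_one_le {nu : ℝ} (hnu : 0 < nu) :
    Real.log (nu ^ (-(1 / 3) : ℝ) + 1) ≤ 1 + |Real.log nu| := by
  rw [Real.log_le_iff_le_exp (by positivity), Real.exp_add, Real.rpow_def_of_pos hnu]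
  have h1 : Real.exp (Real.log nu * -(1 / 3)) ≤ Real.exp |Real.log nu| := by
    refine Real.exp_le_exp.2 ?_
    have := neg_abs_le (Real.log nu)
    have := abs_nonneg (Real.log nu)
    linarith
  have h2 : 1 ≤ Real.exp |Real.log nu| := Real.one_le_exp (abs_nonneg _)
  have h3 := Real.add_one_le_exp (1 : ℝ)
  nlinarith

theorem tsum_int_eq {f : ℤ → ℝ≥0∞} (h0 : f 0 = 0) (hf : ∀ k, f (-k) = f k) :
    ∑' k, f k = 2 * ∑' n : ℕ, f (n + 1) := by
  have h1 : HasSum (fun n : ℕ => f n) (∑' n : ℕ, f (n + 1)) := by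
    have := tsum_eq_zero_add' (f := fun n : ℕ => f n) ENNReal.summable
    simp only [Nat.cast_zero, h0, zero_add, Nat.cast_add, Nat.cast_one] at this
    rw [← this]
    exact ENNReal.summable.hasSum
  have h2 : HasSum (fun n : ℕ => f (-((n : ℤ) + 1))) (∑' n : ℕ, f (n + 1)) := by
    simp only [hf]
    exact ENNReal.summable.hasSum
  rw [(h1.of_nat_of_neg_add_one h2).tsum_eq, two_mul]

/-- With `N = ν^{-1/3}` the viscous bound is `1/(2νk²) = N³/(2k²)`. The minimum is thus at most `3N
min(1, N²/k²)`: a harmonic sum up to `|k| ≈ N`, with logarithm at most `1 + |log ν|`. -/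
theorem tsum_cutoff_le {nu : ℝ} (hnu : 0 < nu) :
    ∑' k : ℤ, ENNReal.ofReal (|(k : ℝ)|⁻¹
      * min (1 / (2 * nu * k ^ 2)) (3 * nu ^ (-(1 / 3) : ℝ)))
      ≤ ENNReal.ofReal (18 * (|Real.log nu| + 1) * nu ^ (-(1 / 3) : ℝ)) := by
  set N := nu ^ (-(1 / 3) : ℝ) with hNdef
  have hN : 0 < N := by positivity
  have hN3 : N ^ 3 = nu⁻¹ := by
    rw [hNdef, ← Real.rpow_natCast, ← Real.rpow_mul hnu.le, ← Real.rpow_neg_one]; norm_num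
  have hlog := log_rpow_add_one_le hnu
  rw [← hNdef] at hlog
  have habs := abs_nonneg (Real.log nu)
  rw [tsum_int_eq (by simp) (by simp)]
  have h1 : ∑' n : ℕ, ENNReal.ofReal (|(((n : ℤ) + 1 : ℤ) : ℝ)|⁻¹
      * min (1 / (2 * nu * (((n : ℤ) + 1 : ℤ) : ℝ) ^ 2)) (3 * N))
      ≤ ENNReal.ofReal (9 * (|Real.log nu| + 1) * N) := by
    refine ENNReal.tsum_le_of_sum_range_le fun M => ?_
    rw [← ENNReal.ofReal_sum_of_nonneg fun i _ => by positivity]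
    refine ENNReal.ofReal_le_ofReal ?_
    calc ∑ i ∈ Finset.range M, |(((i : ℤ) + 1 : ℤ) : ℝ)|⁻¹
          * min (1 / (2 * nu * (((i : ℤ) + 1 : ℤ) : ℝ) ^ 2)) (3 * N)
        ≤ ∑ i ∈ Finset.range M,
            3 * N * (((i : ℝ) + 1)⁻¹ * min 1 (N ^ 2 / ((i : ℝ) + 1) ^ 2)) := by
          refine Finset.sum_le_sum fun i _ => ?_
          push_cast
          have hi : (0 : ℝ) < (i : ℝ) + 1 := by positivity
          rw [abs_of_pos hi, mul_left_comm]
          gcongr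
          rw [mul_min_of_nonneg _ _ (by positivity), mul_one, min_comm]
          refine min_le_min le_rfl ?_
          have : 1 / (2 * nu * ((i : ℝ) + 1) ^ 2) = N ^ 3 / (2 * ((i : ℝ) + 1) ^ 2) := by
            rw [hN3]; field_simp
          rw [this, ← mul_div_assoc, div_le_div_iff₀ (by positivity) (by positivity)]
          have : 0 ≤ N ^ 3 * ((i : ℝ) + 1) ^ 2 := by positivity
          nlinarith
      _ ≤ 3 * N * (2 + Real.log (N + 1)) := by
          rw [← Finset.mul_sum]
          gcongr
          exact sum_cutoff_le hN M
      _ ≤ 9 * (|Real.log nu| + 1) * N := by nlinarith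
  calc _ ≤ 2 * ENNReal.ofReal (9 * (|Real.log nu| + 1) * N) := by gcongr
    _ = _ := by
      rw [← ENNReal.ofReal_ofNat 2, ← ENNReal.ofReal_mul two_pos.le]
      congr 1; ring

end LogSum

/-! ### Time integration of the supremum bound. -/

section SupEstimate

/-- The square of the factor bounding `∇Δ⁻¹` of the `k`-th mode at time `t`, up to a constant. -/
def supWeight (nu : ℝ) (k : ℤ) (t : ℝ) : ℝ :=
  |(k : ℝ)|⁻¹ * min (Real.exp (-(2 * nu * k ^ 2) * t)) (Real.sqrt (nu * t ^ 3))⁻¹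

theorem supWeight_nonneg (nu : ℝ) (k : ℤ) (t : ℝ) : 0 ≤ supWeight nu k t := by
  rw [supWeight]; positivity

theorem measurable_supWeight (nu : ℝ) (k : ℤ) : Measurable (supWeight nu k) := by
  unfold supWeight
  fun_prop

/-- Where the exponential is the smaller entry, the `L²` bound on the Green operator is combined
with heat decay; otherwise the `L¹` bound from hypocoercivity is used. -/
theorem supBound_flow_supWeight {nu : ℝ} (hnu : 0 < nu) {k : ℤ} (hk : k ≠ 0) {t : ℝ} (ht : 0 < t)
    (g : L2) : SupBound k (modeCoef k (flow nu hnu t g))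
      (Real.sqrt (103684 * supWeight nu k t) * ‖modeCoef k g‖) := by
  have hK : 0 < |(k : ℝ)| := abs_pos.2 (by exact_mod_cast hk)
  rcases le_total (Real.exp (-(2 * nu * k ^ 2) * t)) (Real.sqrt (nu * t ^ 3))⁻¹ with h | h
  · refine (supBound_of_norm (by exact_mod_cast hk) _).mono ?_
    rw [supWeight, min_eq_left h]
    calc Real.sqrt ((2 * |(k : ℝ)|)⁻¹) * ‖modeCoef k (flow nu hnu t g)‖
        ≤ Real.sqrt ((2 * |(k : ℝ)|)⁻¹) * (Real.exp (-(nu * k ^ 2 * t)) * ‖modeCoef k g‖) := by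
          gcongr
          exact norm_modeCoef_flow_le hnu k ht.le g
      _ ≤ _ := by
          rw [← mul_assoc]
          gcongr
          refine Real.le_sqrt_of_sq_le ?_
          rw [mul_pow, Real.sq_sqrt (by positivity), ← Real.exp_nat_mul, mul_inv]
          have e : ((2 : ℕ) : ℝ) * -(nu * k ^ 2 * t) = -(2 * nu * k ^ 2) * t := by
            push_cast; ring
          rw [e]
          have : 0 ≤ |(k : ℝ)|⁻¹ * Real.exp (-(2 * nu * k ^ 2) * t) := by positivity
          linarith
  · have := supBound_modeCoef_flow hnu hk ht g
    rwa [mul_inv, ← min_eq_right h] at this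

/-- Cauchy–Schwarz in `k` separates the weights from the data, so only the sum of squared factors,
which is linear in `supWeight`, has to be integrated in time. -/
theorem sq_gradInvLapSup_flow_le {nu : ℝ} (hnu : 0 < nu) {g : L2} (hg : modeCoef 0 g = 0) {t : ℝ}
    (ht : 0 < t) : gradInvLapSup (flow nu hnu t g) ^ 2
      ≤ ENNReal.ofReal (4 * 103684 * ‖g‖ ^ 2) * ∑' k, ENNReal.ofReal (supWeight nu k t) := by
  have h0 : modeCoef 0 (flow nu hnu t g) = 0 := by
    have := norm_modeCoef_flow_le hnu 0 ht.le g
    rw [hg, norm_zero, mul_zero] at this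
    exact norm_le_zero_iff.1 this
  have h1 := gradInvLapSup_le h0
    (B := fun k => Real.sqrt (103684 * supWeight nu k t) * ‖modeCoef k g‖)
    (fun k => by positivity) fun k hk => supBound_flow_supWeight hnu hk ht g
  have h2 : (∑' k, ENNReal.ofReal (Real.sqrt (103684 * supWeight nu k t) * ‖modeCoef k g‖)) ^ 2
      ≤ ENNReal.ofReal 103684 * (∑' k, ENNReal.ofReal (supWeight nu k t))
        * ENNReal.ofReal (‖g‖ ^ 2) := by
    simp_rw [ENNReal.ofReal_mul (Real.sqrt_nonneg _)]
    refine (sq_tsum_mul_le _ _).trans (le_of_eq ?_)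
    have hs := hasSum_norm_sq_modes g
    congr 1
    · rw [← ENNReal.tsum_mul_left]
      refine tsum_congr fun k => ?_
      rw [← ENNReal.ofReal_pow (Real.sqrt_nonneg _),
        Real.sq_sqrt (mul_nonneg (by norm_num) (supWeight_nonneg nu k t)),
        ENNReal.ofReal_mul (by norm_num)]
    · rw [← hs.tsum_eq, ENNReal.ofReal_tsum_of_nonneg (fun k => by positivity) hs.summable]
      exact tsum_congr fun k => (ENNReal.ofReal_pow (norm_nonneg _) 2).symm
  calc gradInvLapSup (flow nu hnu t g) ^ 2 ≤ _ := pow_le_pow_left₀ zero_le h1 2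
    _ ≤ 2 ^ 2 * (ENNReal.ofReal 103684 * (∑' k, ENNReal.ofReal (supWeight nu k t))
        * ENNReal.ofReal (‖g‖ ^ 2)) := by
      rw [mul_pow]
      gcongr
    _ = _ := by
      have : (2 : ℝ≥0∞) ^ 2 = ENNReal.ofReal 4 := by norm_num
      rw [this, ENNReal.ofReal_mul (by norm_num), ENNReal.ofReal_mul (by norm_num)]
      ring

theorem lintegral_exp_neg_le {c : ℝ} (hc : 0 < c) (T : ℝ) :
    ∫⁻ t in Ioc 0 T, ENNReal.ofReal (Real.exp (-c * t)) ≤ ENNReal.ofReal (1 / c) := by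
  refine (lintegral_mono_set Ioc_subset_Ioi_self).trans (le_of_eq ?_)
  rw [← ofReal_integral_eq_lintegral_ofReal (integrableOn_exp_mul_Ioi (neg_lt_zero.2 hc) 0)
    (Eventually.of_forall fun t => (Real.exp_pos _).le), integral_exp_mul_Ioi (neg_lt_zero.2 hc)]
  congr 1
  simp [neg_div_neg_eq]

/-- The entry `(ν t³)^{-1/2}` is not integrable at zero, so the integrand is bounded by one up to
`ν^{-1/3}`; the two pieces give `ν^{-1/3}` and `2 ν^{-1/3}`. -/
theorem lintegral_min_le {nu : ℝ} (hnu : 0 < nu) {c : ℝ} (hc : 0 ≤ c) (T : ℝ) :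
    ∫⁻ t in Ioc 0 T, ENNReal.ofReal (min (Real.exp (-c * t)) (Real.sqrt (nu * t ^ 3))⁻¹)
      ≤ ENNReal.ofReal (3 * nu ^ (-(1 / 3) : ℝ)) := by
  set τ := nu ^ (-(1 / 3) : ℝ) with hτdef
  have hτ : 0 < τ := by positivity
  refine (lintegral_Ioc_le_split hτ).trans ?_
  have h1 : ∫⁻ t in Ioc 0 τ, ENNReal.ofReal (min (Real.exp (-c * t)) (Real.sqrt (nu * t ^ 3))⁻¹)
      ≤ ENNReal.ofReal τ := by
    calc _ ≤ ∫⁻ t in Ioc 0 τ, 1 := by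
          refine setLIntegral_mono' measurableSet_Ioc fun t ht => ?_
          rw [← ENNReal.ofReal_one]
          refine ENNReal.ofReal_le_ofReal ((min_le_left _ _).trans (Real.exp_le_one_iff.2 ?_))
          nlinarith [ht.1]
      _ = _ := by rw [setLIntegral_one, Real.volume_Ioc, sub_zero]
  have h2 : ∫⁻ t in Ioi τ, ENNReal.ofReal (min (Real.exp (-c * t)) (Real.sqrt (nu * t ^ 3))⁻¹)
      ≤ ENNReal.ofReal (2 * τ) := by
    calc _ ≤ ∫⁻ t in Ioi τ, ENNReal.ofReal (nu ^ (-(1 / 2) : ℝ))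
          * ENNReal.ofReal (t ^ (-(3 / 2) : ℝ)) := by
          refine setLIntegral_mono' measurableSet_Ioi fun t ht => ?_
          have ht0 : 0 < t := hτ.trans ht
          rw [← ENNReal.ofReal_mul (by positivity)]
          refine ENNReal.ofReal_le_ofReal ((min_le_right _ _).trans (le_of_eq ?_))
          rw [Real.sqrt_eq_rpow, Real.mul_rpow hnu.le (by positivity), mul_inv,
            ← Real.rpow_neg hnu.le, ← Real.rpow_natCast, ← Real.rpow_mul ht0.le,
            ← Real.rpow_neg ht0.le]
          norm_num
      _ = _ := by
          rw [lintegral_const_mul' _ _ ENNReal.ofReal_ne_top, lintegral_rpow_Ioi hτ (by norm_num),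
            ← ENNReal.ofReal_mul (by positivity), hτdef, ← Real.rpow_mul hnu.le]
          congr 1
          have : nu ^ (-(1 / 3) : ℝ) = nu ^ (-(1 / 2) : ℝ)
              * nu ^ (-(1 / 3) * (-(3 / 2) + 1) : ℝ) := by
            rw [← Real.rpow_add hnu]; norm_num
          rw [this]; ring
  refine (add_le_add h1 h2).trans ?_
  rw [← ENNReal.ofReal_add (by positivity) (by positivity)]
  exact ENNReal.ofReal_le_ofReal (le_of_eq (by ring))

theorem lintegral_supWeight_le {nu : ℝ} (hnu : 0 < nu) (k : ℤ) (T : ℝ) :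
    ∫⁻ t in Ioc 0 T, ENNReal.ofReal (supWeight nu k t)
      ≤ ENNReal.ofReal (|(k : ℝ)|⁻¹
        * min (1 / (2 * nu * k ^ 2)) (3 * nu ^ (-(1 / 3) : ℝ))) := by
  rcases eq_or_ne k 0 with rfl | hk
  · simp [supWeight]
  have hk' : (k : ℝ) ≠ 0 := by exact_mod_cast hk
  simp_rw [supWeight, ENNReal.ofReal_mul (inv_nonneg.2 (abs_nonneg (k : ℝ)))]
  rw [lintegral_const_mul' _ _ ENNReal.ofReal_ne_top, ENNReal.ofReal_min]
  gcongr
  refine le_min ?_ (lintegral_min_le hnu (by positivity) T)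
  refine (lintegral_mono fun t => ENNReal.ofReal_le_ofReal (min_le_left _ _)).trans ?_
  exact lintegral_exp_neg_le (by positivity) T

theorem lintegral_sq_gradInvLapSup_flow_le {nu : ℝ} (hnu : 0 < nu) {g : L2}
    (hg : modeCoef 0 g = 0) (T : ℝ) :
    ∫⁻ t in Ioc 0 T, gradInvLapSup (flow nu hnu t g) ^ 2
      ≤ ENNReal.ofReal (7465248 * (|Real.log nu| + 1) * nu ^ (-(1 / 3) : ℝ) * ‖g‖ ^ 2) := by
  calc ∫⁻ t in Ioc 0 T, gradInvLapSup (flow nu hnu t g) ^ 2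
      ≤ ∫⁻ t in Ioc 0 T, ENNReal.ofReal (4 * 103684 * ‖g‖ ^ 2)
          * ∑' k, ENNReal.ofReal (supWeight nu k t) :=
        setLIntegral_mono' measurableSet_Ioc fun t ht => sq_gradInvLapSup_flow_le hnu hg ht.1
    _ = ENNReal.ofReal (4 * 103684 * ‖g‖ ^ 2)
          * ∑' k, ∫⁻ t in Ioc 0 T, ENNReal.ofReal (supWeight nu k t) := by
        rw [lintegral_const_mul' _ _ ENNReal.ofReal_ne_top, lintegral_tsum]
        exact fun k => (measurable_supWeight nu k).ennreal_ofReal.aemeasurable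
    _ ≤ ENNReal.ofReal (4 * 103684 * ‖g‖ ^ 2)
          * ENNReal.ofReal (18 * (|Real.log nu| + 1) * nu ^ (-(1 / 3) : ℝ)) := by
        gcongr
        exact (ENNReal.tsum_le_tsum fun k => lintegral_supWeight_le hnu k T).trans
          (tsum_cutoff_le hnu)
    _ = _ := by
        rw [← ENNReal.ofReal_mul (by positivity)]
        congr 1; ring

end SupEstimate

end Poiseuille

end

theorem lemma3p1 :
    ∃ C : ℝ, 0 < C ∧ ∀ ν : ℝ, 0 < ν →
      ∃ S : ℝ → Poiseuille.L2 →L[ℂ] Poiseuille.L2, Poiseuille.IsSemigroup ν S ∧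
        ∀ g : Poiseuille.L2, Poiseuille.P0 g = 0 → ∀ T : ℝ, 0 < T →
          (∫⁻ t in Set.Ioc 0 T, Poiseuille.gradNormSq (S t g))
              ≤ ENNReal.ofReal (1 / 2 * ν⁻¹ * ‖g‖ ^ 2) ∧
          (∫⁻ t in Set.Ioc 0 T, Poiseuille.dxNorm (S t g))
              ≤ ENNReal.ofReal (C * ν ^ (-(2 / 3) : ℝ) * ‖g‖) ∧
          (∫⁻ t in Set.Ioc 0 T, Poiseuille.gradInvLapSup (S t (Poiseuille.Pneq g)) ^ 2)
              ≤ ENNReal.ofReal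
                  (C * (|Real.log ν| + 1) * ν ^ (-(1 / 3) : ℝ) * ‖Poiseuille.Pneq g‖ ^ 2) := by
  -- The constant is `4 · 103684 · 18` from the third estimate; it also exceeds the `5762` of the
  -- second.
  refine ⟨7465248, by norm_num, fun ν hν => ⟨Poiseuille.flow ν hν, Poiseuille.isSemigroup_flow hν,
    fun g _ T hT => ⟨Poiseuille.lintegral_gradNormSq_flow_le hν g hT, ?_, ?_⟩⟩⟩
  · refine (Poiseuille.lintegral_dxNorm_flow_le hν g T).trans (ENNReal.ofReal_le_ofReal ?_)
    gcongr
    norm_num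
  · exact Poiseuille.lintegral_sq_gradInvLapSup_flow_le hν
      (by rw [Poiseuille.modeCoef_Pneq, if_pos rfl]) T
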